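/- Let $\lambda\in\mathbb{R}\setminus\{0\}$. An $\mathrm{Sp}(2)$-invariant Laplacian soliton with dilation constant $\lambda$ on $(a,T)\times\mathbb{CP}^3$, where $-\infty<a<T\le\infty$ (an expander if $\lambda>0$, a shrinker if $\lambda<0$), is described by functions $x,y>0$, $\tau_1,\tau_2,u$ on $(a,T)$ satisfying \[ \tau_1=(x^2)'-2x+\frac{x^3}{y^2},\qquad \tau_2=(y^2)'-x,\qquad (xy^2)'=\tfrac12x^2+y^2, \] \[ (\tau_1-ux^2)'=\lambda x^2,\qquad(\tau_2-uy^2)'=\lambda y^2,\qquad \tau_1+2\tau_2=u(x^2+2y^2)+2\lambda xy^2 . \] Here $\varphi=(x^2\omega_1+y^2\omega_2)\wedge dt+xy^2\alpha$ is the closed $\mathrm{G}_2$-structure, $\tau=\tau_1\omega_1+\tau_2\omega_2$ its torsion and $u\,\partial_t$ the soliton vector field, where $\omega_1,\omega_2$ is a suitable basis of the invariant $2$-forms on $\mathbb{CP}^3$ and $\alpha$ an invariant closed $3$-form. A soliton end is such a solution that is forward-inextensible, i.e. does not extend to a solution on $(a,T')$ for any $T'>T$; it is forward complete if $T=\infty$.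 A closed $\mathrm{Sp}(2)$-invariant $\mathrm{G}_2$-cone is a pair $c_1,c_2>0$ with $6c_1c_2^2=c_1^2+2c_2^2$ (it corresponds to $x=c_1t$, $y=c_2t$). An end with $T=\infty$ is asymptotic to it with rate at least $-2$ if, up to a translation of $t$, $x=c_1t+O(t^{-1})$ and $y=c_2t+O(t^{-1})$ as $t\to\infty$. Every $\mathrm{Sp}(2)$-invariant soliton end with $\lambda\neq0$ satisfies exactly one of the following. (i) It is forward complete and $\log\frac yx$ is bounded as $t\to\infty$. Then it is asymptotic with rate at least $-2$ to a unique closed $\mathrm{Sp}(2)$-invariant $\mathrm{G}_2$-cone. (ii) It is forward complete and $|\log\frac yx|\to\infty$ as $t\to\infty$. Then: (a) if $\lambda>0$, then $tx\to\frac3\lambda$ and $\frac{\log(xy^2)}{t^2}\to\frac\lambda6$ as $t\to\infty$; in particular $x\to0$ and $\frac{\log y}{t^2}\to\frac{\lambda}{12}$; (b) if $\lambda<0$, then $\frac{\log x}{t}\to\sqrt{\frac{-\lambda}{18}}$ and $\frac{y^4}{x^2}\to-\frac{9}{8\lambda}$ as $t\to\infty$; in particular $\frac{\log y}{t}\to\frac12\sqrt{\frac{-\lambda}{18}}$.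 (iii) It has a finite maximal forward existence time $t_*=T<\infty$. Then $\frac yx\to\infty$, $x=O\big((t_*-t)^{1/2}\big)$ and $y=O\big((t_*-t)^{-1/4}\big)$ as $t\to t_*$. -/

import Mathlib

open Filter Topology Asymptotics

/-- The quintuple `(x, y, τ₁, τ₂, u)` solves, on the open interval `(a, T)`, the ODE system of
`Sp(2)`-invariant Laplacian solitons with dilation constant `lam`.  Here
`φ = (x² ω₁ + y² ω₂) ∧ dt + x y² α` is a closed `Sp(2)`-invariant G₂-structure on
`(a, T) × ℂP³` with `∂_t` of unit length, `τ = τ₁ ω₁ + τ₂ ω₂` is its torsion and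
`X = u ∂_t` is the soliton vector field. -/
structure IsSp2Soliton (lam a : ℝ) (T : EReal) (x y τ₁ τ₂ u : ℝ → ℝ) : Prop where
  x_pos : ∀ t : ℝ, a < t → (t : EReal) < T → 0 < x t
  y_pos : ∀ t : ℝ, a < t → (t : EReal) < T → 0 < y t
  /-- `τ₁ = (x²)' - 2x + x³/y²` -/
  torsion₁ : ∀ t : ℝ, a < t → (t : EReal) < T →
    HasDerivAt (fun s => x s ^ 2) (τ₁ t + 2 * x t - x t ^ 3 / y t ^ 2) t
  /-- `τ₂ = (y²)' - x` -/
  torsion₂ : ∀ t : ℝ, a < t → (t : EReal) < T →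
    HasDerivAt (fun s => y s ^ 2) (τ₂ t + x t) t
  /-- `(x y²)' = x²/2 + y²`, i.e. `dφ = 0` -/
  closure : ∀ t : ℝ, a < t → (t : EReal) < T →
    HasDerivAt (fun s => x s * y s ^ 2) (x t ^ 2 / 2 + y t ^ 2) t
  /-- `(τ₁ - u x²)' = λ x²` -/
  soliton₁ : ∀ t : ℝ, a < t → (t : EReal) < T →
    HasDerivAt (fun s => τ₁ s - u s * x s ^ 2) (lam * x t ^ 2) t
  /-- `(τ₂ - u y²)' = λ y²` -/
  soliton₂ : ∀ t : ℝ, a < t → (t : EReal) < T →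
    HasDerivAt (fun s => τ₂ s - u s * y s ^ 2) (lam * y t ^ 2) t
  /-- `τ₁ + 2 τ₂ = u (x² + 2 y²) + 2 λ x y²` -/
  conserved : ∀ t : ℝ, a < t → (t : EReal) < T →
    τ₁ t + 2 * τ₂ t = u t * (x t ^ 2 + 2 * y t ^ 2) + 2 * lam * (x t * y t ^ 2)

/-- A soliton end: a solution of the soliton ODE system on a nonempty interval `(a, T)`,
`a < T ≤ ∞`, that does not extend to a solution on any `(a, T')` with `T' > T`. -/
structure IsSp2SolitonEnd (lam a : ℝ) (T : EReal) (x y τ₁ τ₂ u : ℝ → ℝ) : Prop where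
  lt : (a : EReal) < T
  soliton : IsSp2Soliton lam a T x y τ₁ τ₂ u
  inextensible : ∀ (T' : EReal) (x' y' τ₁' τ₂' u' : ℝ → ℝ), T < T' →
    IsSp2Soliton lam a T' x' y' τ₁' τ₂' u' →
    ¬ ∀ t : ℝ, a < t → (t : EReal) < T →
      x' t = x t ∧ y' t = y t ∧ τ₁' t = τ₁ t ∧ τ₂' t = τ₂ t ∧ u' t = u t

/-- The cone `x = c₁ t`, `y = c₂ t` defines a closed `Sp(2)`-invariant G₂-cone. -/
def IsClosedSp2Cone (c₁ c₂ : ℝ) : Prop :=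
  0 < c₁ ∧ 0 < c₂ ∧ 6 * c₁ * c₂ ^ 2 = c₁ ^ 2 + 2 * c₂ ^ 2

/-- Up to a translation of `t`, `x = c₁ t + O(t⁻¹)` and `y = c₂ t + O(t⁻¹)` as `t → ∞`:
the end is asymptotic with rate (at least) `-2` to the cone `(c₁, c₂)`. -/
def IsAsymptoticRateNegTwo (x y : ℝ → ℝ) (c₁ c₂ : ℝ) : Prop :=
  ∃ k : ℝ, (fun t => x t - c₁ * (t + k)) =O[atTop] (fun t : ℝ => t⁻¹) ∧
    (fun t => y t - c₂ * (t + k)) =O[atTop] (fun t : ℝ => t⁻¹)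

/-- Forward complete with `log (y/x)` forward-bounded. -/
def IsBoundedWarpingEnd (T : EReal) (x y : ℝ → ℝ) : Prop :=
  T = ⊤ ∧ ∃ C : ℝ, ∀ᶠ t in atTop, |Real.log (y t / x t)| ≤ C

/-- Forward complete with `|log (y/x)| → ∞`. -/
def IsUnboundedWarpingEnd (T : EReal) (x y : ℝ → ℝ) : Prop :=
  T = ⊤ ∧ Tendsto (fun t => |Real.log (y t / x t)|) atTop atTop

/-- Finite maximal forward existence time. -/
def IsForwardIncompleteEnd (T : EReal) : Prop :=
  ∃ tstar : ℝ, T = (tstar : EReal)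

/-!
In logarithmic volume time `s = log (x y²)` the system is governed by
`w = 2 y² / (x² + 2 y²) ∈ (0, 1)` and its weighted mean `θ`, which solves `θ' = w - θ`. For
`λ < 0`, integrating the equations over unbounded `s` makes `w` converge; for `λ > 0` the mean
bounds `w` away from `0`, and also from `1` unless `τ₁ - u x²` keeps a definite sign. If `w` stays
in a compact subset of `(0, 1)`, then `w - θ` satisfies a linear equation with a coefficient of size
`(x y²)^{2/3}`, which forces `w - θ = O((x y²)^{-2/3})`; integrating twice shows that the end is
conical with rate `-2`. The other ends have `w → 1` if `λ > 0` and `w → 0` if `λ < 0`. In the first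
case `x` is slaved to `τ₁ - u x²`, which decays like `t⁻¹`. In the second case the system collapses
to a planar autonomous one whose equilibrium is a source with a Lyapunov function, so that the
solution must converge to it, and the equilibrium value is the limit of `y⁴ / x²`.

In all these cases `t → ∞`, so an end with finite maximal time has bounded volume. Then `x²`,
`v = x y²` and `p = τ₁ - u x²` have limits at the final time, and inextensibility forces `x → 0`.
The limit of `p` is negative, since otherwise the term `2 x` would make `x²` increase; as
`(x²)' → 2 p / 3`, the square of `x` vanishes linearly while `x y²` stays positive.
-/

section Calculus

variable {f f' g g' : ℝ → ℝ} {D : Set ℝ} {s₀ b c C L l : ℝ}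

theorem monotoneOn_of_hasDerivAt_nonneg (hD : Convex ℝ D)
    (hf : ∀ s ∈ D, HasDerivAt f (f' s) s) (h : ∀ s ∈ D, 0 ≤ f' s) : MonotoneOn f D :=
  monotoneOn_of_hasDerivWithinAt_nonneg hD
    (fun s hs => (hf s hs).continuousAt.continuousWithinAt)
    (fun s hs => (hf s (interior_subset hs)).hasDerivWithinAt)
    (fun s hs => h s (interior_subset hs))

theorem antitoneOn_of_hasDerivAt_nonpos (hD : Convex ℝ D)
    (hf : ∀ s ∈ D, HasDerivAt f (f' s) s) (h : ∀ s ∈ D, f' s ≤ 0) : AntitoneOn f D :=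
  antitoneOn_of_hasDerivWithinAt_nonpos hD
    (fun s hs => (hf s hs).continuousAt.continuousWithinAt)
    (fun s hs => (hf s (interior_subset hs)).hasDerivWithinAt)
    (fun s hs => h s (interior_subset hs))

theorem nonneg_of_hasDerivAt_nonpos_of_tendsto_zero
    (hf : ∀ s, s₀ ≤ s → HasDerivAt f (f' s) s) (hf' : ∀ s, s₀ ≤ s → f' s ≤ 0)
    (hlim : Tendsto f atTop (𝓝 0)) {s : ℝ} (hs : s₀ ≤ s) : 0 ≤ f s := by
  have hanti := antitoneOn_of_hasDerivAt_nonpos (convex_Ici s₀) hf hf'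
  refine le_of_tendsto hlim ?_
  filter_upwards [eventually_ge_atTop s] with σ hσ
  exact hanti hs (hs.trans hσ) hσ

theorem abs_sub_le_sub_of_abs_deriv_le (hD : Convex ℝ D)
    (hf : ∀ s ∈ D, HasDerivAt f (f' s) s) (hg : ∀ s ∈ D, HasDerivAt g (g' s) s)
    (h : ∀ s ∈ D, |f' s| ≤ g' s) {r t : ℝ} (hr : r ∈ D) (ht : t ∈ D) (hrt : r ≤ t) :
    |f t - f r| ≤ g t - g r := by
  have hadd := monotoneOn_of_hasDerivAt_nonneg (f := fun s => g s + f s) hD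
    (fun s hs => (hg s hs).fun_add (hf s hs))
    (fun s hs => by linarith [neg_le_of_abs_le (h s hs)]) hr ht hrt
  have hsub := monotoneOn_of_hasDerivAt_nonneg (f := fun s => g s - f s) hD
    (fun s hs => (hg s hs).fun_sub (hf s hs))
    (fun s hs => by linarith [le_of_abs_le (h s hs)]) hr ht hrt
  simp only at hadd hsub
  exact abs_le.2 ⟨by linarith, by linarith⟩

theorem exists_tendsto_of_abs_deriv_le {F : Filter ℝ} [F.NeBot] (hD : Convex ℝ D) (hDF : D ∈ F)
    (hf : ∀ s ∈ D, HasDerivAt f (f' s) s) (hg : ∀ s ∈ D, HasDerivAt g (g' s) s)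
    (h : ∀ s ∈ D, |f' s| ≤ g' s) (hL : Tendsto g F (𝓝 L)) : ∃ M, Tendsto f F (𝓝 M) := by
  have hdist : ∀ r ∈ D, ∀ t ∈ D, dist (f r) (f t) ≤ dist (g r) (g t) := by
    intro r hr t ht
    wlog hrt : r ≤ t generalizing r t
    · rw [dist_comm (f r), dist_comm (g r)]
      exact this t ht r hr (le_of_not_ge hrt)
    rw [dist_comm (f r), dist_comm (g r)]
    exact (abs_sub_le_sub_of_abs_deriv_le hD hf hg h hr ht hrt).trans (le_abs_self _)
  refine cauchy_map_iff_exists_tendsto.1 (Metric.cauchy_iff.2 ⟨inferInstance, fun ε hε => ?_⟩)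
  obtain ⟨t, ht, hclose⟩ := (Metric.cauchy_iff.1 hL.cauchy_map).2 ε hε
  refine ⟨f '' (g ⁻¹' t ∩ D), image_mem_map (inter_mem ht hDF), ?_⟩
  rintro _ ⟨r, hr, rfl⟩ _ ⟨s, hs, rfl⟩
  exact (hdist r hr.2 s hs.2).trans_lt (hclose _ hr.1 _ hs.1)

theorem exists_tendsto_of_monotoneOn_Ici {B : ℝ} (hf : MonotoneOn f (Set.Ici s₀))
    (hB : ∀ s, s₀ ≤ s → f s ≤ B) :
    ∃ L, Tendsto f atTop (𝓝 L) ∧ ∀ s, s₀ ≤ s → f s ≤ L := by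
  have hm : Monotone fun s => f (max s₀ s) := fun _ _ hab =>
    hf (Set.mem_Ici.2 (le_max_left _ _)) (Set.mem_Ici.2 (le_max_left _ _)) (max_le_max le_rfl hab)
  have hbd : BddAbove (Set.range fun s => f (max s₀ s)) :=
    ⟨B, by rintro _ ⟨s, rfl⟩; exact hB _ (le_max_left _ _)⟩
  refine ⟨_, (tendsto_atTop_ciSup hm hbd).congr' ?_, fun s hs => ?_⟩
  · filter_upwards [eventually_ge_atTop s₀] with s hs
    rw [max_eq_right hs]
  · simpa only [max_eq_right hs] using le_ciSup hbd s

theorem exists_tendsto_of_antitoneOn_Ici {B : ℝ} (hf : AntitoneOn f (Set.Ici s₀))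
    (hB : ∀ s, s₀ ≤ s → B ≤ f s) :
    ∃ L, Tendsto f atTop (𝓝 L) ∧ ∀ s, s₀ ≤ s → L ≤ f s := by
  obtain ⟨L, hL, hle⟩ := exists_tendsto_of_monotoneOn_Ici (f := fun s => -f s) hf.neg
    (fun s hs => neg_le_neg (hB s hs))
  exact ⟨-L, by simpa using hL.neg, fun s hs => by linarith [hle s hs]⟩

theorem tendsto_atTop_of_le_hasDerivAt (hc : 0 < c)
    (hf : ∀ s, s₀ ≤ s → HasDerivAt f (f' s) s) (h : ∀ s, s₀ ≤ s → c ≤ f' s) :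
    Tendsto f atTop atTop := by
  have hmono : MonotoneOn (fun s => f s - c * s) (Set.Ici s₀) :=
    monotoneOn_of_hasDerivAt_nonneg (f' := fun s => f' s - c) (convex_Ici s₀)
      (fun s hs => by simpa using (hf s hs).fun_sub ((hasDerivAt_id s).const_mul c))
      (fun s hs => sub_nonneg.2 (h s hs))
  have hlin : Tendsto (fun s => f s₀ - c * s₀ + c * s) atTop atTop :=
    tendsto_atTop_add_const_left _ _ (tendsto_id.const_mul_atTop hc)
  refine tendsto_atTop_mono' _ ?_ hlin
  filter_upwards [eventually_ge_atTop s₀] with s hs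
  linarith [hmono Set.self_mem_Ici hs hs]

theorem le_image_of_deriv_pos_of_eq (hf : ∀ s, s₀ ≤ s → HasDerivAt f (f' s) s) (h₀ : c ≤ f s₀)
    (h : ∀ s, s₀ ≤ s → (∀ r, s₀ ≤ r → r ≤ s → c ≤ f r) → f s = c → 0 < f' s) :
    ∀ s, s₀ ≤ s → c ≤ f s := by
  intro b hb
  set S : Set ℝ := {s | ∀ r ∈ Set.Icc s₀ s, c ≤ f r}
  have hclosed : IsClosed (S ∩ Set.Icc s₀ b) := by
    refine isClosed_of_closure_subset fun m hm => ?_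
    have hmI : m ∈ Set.Icc s₀ b :=
      isClosed_Icc.closure_subset (closure_mono Set.inter_subset_right hm)
    refine ⟨fun r hr => ?_, hmI⟩
    obtain hrm | rfl := hr.2.lt_or_eq
    · obtain ⟨s, hrs, hs, -⟩ := mem_closure_iff.1 hm _ isOpen_Ioi hrm
      exact hs r ⟨hr.1, le_of_lt hrs⟩
    by_contra! hlt
    have hnhds := (hf r hr.1).continuousAt.eventually (gt_mem_nhds hlt)
    obtain ⟨s, hsc, hs, hsI⟩ := mem_closure_iff_nhds.1 hm _ hnhds
    exact (hs s ⟨hsI.1, le_rfl⟩).not_gt hsc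
  have hstep : ∀ s ∈ S ∩ Set.Ico s₀ b, ∀ t ∈ Set.Ioi s, (S ∩ Set.Ioc s t).Nonempty := by
    rintro s ⟨hs, hs₀, -⟩ t hst
    have hright : ∀ᶠ r in 𝓝[>] s, c ≤ f r := by
      obtain heq | hlt := (hs s ⟨hs₀, le_rfl⟩).eq_or_lt
      · have hslope := (hasDerivAt_iff_tendsto_slope.1 (hf s hs₀)).mono_left
          (nhdsWithin_mono s fun r (hr : s < r) => hr.ne')
        have hpos := h s hs₀ (fun r hr hrs => hs r ⟨hr, hrs⟩) heq.symm
        filter_upwards [hslope.eventually (lt_mem_nhds hpos), self_mem_nhdsWithin] with r hr hsr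
        rw [slope_def_field] at hr
        linarith [(div_pos_iff_of_pos_right (sub_pos.2 hsr)).1 hr]
      · filter_upwards [((hf s hs₀).continuousAt.eventually (lt_mem_nhds hlt)).filter_mono
          nhdsWithin_le_nhds] with r hr using hr.le
    obtain ⟨v, hv, hvc⟩ := mem_nhdsGT_iff_exists_Ioc_subset.1 hright
    refine ⟨min v t, fun r hr => ?_, lt_min hv hst, min_le_right _ _⟩
    obtain hrs | hsr := le_or_gt r s
    · exact hs r ⟨hr.1, hrs⟩
    · exact hvc ⟨hsr, hr.2.trans (min_le_left _ _)⟩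
  have hs₀ : s₀ ∈ S := fun r hr => by rwa [le_antisymm hr.2 hr.1]
  exact hclosed.Icc_subset_of_forall_exists_gt hs₀ hstep ⟨hb, le_rfl⟩ b ⟨hb, le_rfl⟩

theorem image_le_of_deriv_neg_of_eq (hf : ∀ s, s₀ ≤ s → HasDerivAt f (f' s) s) (h₀ : f s₀ ≤ c)
    (h : ∀ s, s₀ ≤ s → (∀ r, s₀ ≤ r → r ≤ s → f r ≤ c) → f s = c → f' s < 0) :
    ∀ s, s₀ ≤ s → f s ≤ c := by
  have hneg := le_image_of_deriv_pos_of_eq (f := fun s => -f s) (f' := fun s => -f' s) (c := -c)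
    (fun s hs => (hf s hs).neg) (neg_le_neg h₀) (fun s hs hist heq =>
      neg_pos.2 (h s hs (fun r hr hrs => neg_le_neg_iff.1 (hist r hr hrs)) (neg_injective heq)))
  exact fun s hs => neg_le_neg_iff.1 (hneg s hs)

theorem eventually_exists_abs_deriv_lt (hf : ∀ s, s₀ ≤ s → HasDerivAt f (f' s) s)
    (hL : Tendsto f atTop (𝓝 L)) {d δ : ℝ} (hd : 0 < d) (hδ : 0 < δ) :
    ∀ᶠ s in atTop, ∃ r ∈ Set.Icc s (s + d), |f' r| < δ := by
  have hdiff : Tendsto (fun s => f (s + d) - f s) atTop (𝓝 0) := by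
    simpa using (hL.comp (tendsto_atTop_add_const_right _ d tendsto_id)).sub hL
  filter_upwards [eventually_ge_atTop s₀, hdiff.eventually (Metric.ball_mem_nhds 0 (mul_pos hδ hd))]
    with s hs hsmall
  obtain ⟨r, hr, hslope⟩ := exists_hasDerivAt_eq_slope f f' (lt_add_of_pos_right s hd)
    (fun r hr => (hf r (hs.trans hr.1)).continuousAt.continuousWithinAt)
    (fun r hr => hf r (hs.trans hr.1.le))
  refine ⟨r, Set.Ioo_subset_Icc_self hr, ?_⟩
  rw [hslope, add_sub_cancel_left, abs_div, abs_of_pos hd, div_lt_iff₀ hd]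
  simpa using hsmall

theorem exists_forall_Icc_abs_sub_le (hg : ∀ s, s₀ ≤ s → HasDerivAt g (g' s) s)
    (hC : ∀ s, s₀ ≤ s → |g' s| ≤ C) {ε : ℝ} (hε : 0 < ε) :
    ∃ d > 0, ∀ s, s₀ ≤ s → ∀ r ∈ Set.Icc s (s + d), |g r - g s| ≤ ε := by
  have hC0 : 0 ≤ C := (abs_nonneg _).trans (hC s₀ le_rfl)
  refine ⟨ε / (C + 1), by positivity, fun s hs r hr => ?_⟩
  have hlip : |g r - g s| ≤ C * r - C * s :=
    abs_sub_le_sub_of_abs_deriv_le (convex_Ici s₀) hg (g := fun r => C * r)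
      (fun r _ => by simpa using (hasDerivAt_id r).const_mul C) hC hs (hs.trans hr.1) hr.1
  calc |g r - g s| ≤ C * (r - s) := by linarith
    _ ≤ (C + 1) * (ε / (C + 1)) := by gcongr <;> linarith [hr.1, hr.2]
    _ = ε := mul_div_cancel₀ _ (by positivity)

/-- Barbalat's lemma, with the usual `f' = g` relaxed to a lower bound on `f'` where `g` is not
small. -/
theorem tendsto_zero_of_deriv_ge_of_tendsto (hf : ∀ s, s₀ ≤ s → HasDerivAt f (f' s) s)
    (hL : Tendsto f atTop (𝓝 L)) (hg : ∀ s, s₀ ≤ s → HasDerivAt g (g' s) s)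
    (hC : ∀ s, s₀ ≤ s → |g' s| ≤ C)
    (h : ∀ ε > 0, ∃ δ > 0, ∀ᶠ s in atTop, ε ≤ |g s| → δ ≤ f' s) :
    Tendsto g atTop (𝓝 0) := by
  refine Metric.tendsto_nhds.2 fun ε hε => ?_
  obtain ⟨δ, hδ, hlow⟩ := h (ε / 2) (half_pos hε)
  obtain ⟨d, hd, hlip⟩ := exists_forall_Icc_abs_sub_le hg hC (half_pos hε)
  filter_upwards [eventually_ge_atTop s₀, eventually_forall_ge_atTop.2 hlow,
    eventually_exists_abs_deriv_lt hf hL hd hδ] with s hs hlow ⟨r, hr, hsmall⟩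
  rw [Real.dist_0_eq_abs]
  have hgr : |g r| < ε / 2 := by
    by_contra! hge
    linarith [hlow r hr.1 hge, le_abs_self (f' r)]
  linarith [abs_sub_abs_le_abs_sub (g s) (g r), abs_sub_comm (g s) (g r), hlip s hs r hr]

theorem tendsto_zero_of_deriv_sub_of_tendsto (hf : ∀ s, s₀ ≤ s → HasDerivAt f (f' s) s)
    (hL : Tendsto f atTop (𝓝 L)) (hg : ∀ s, s₀ ≤ s → HasDerivAt g (g' s) s)
    (hC : ∀ s, s₀ ≤ s → |g' s| ≤ C) (h : Tendsto (fun s => f' s - g s) atTop (𝓝 0)) :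
    Tendsto g atTop (𝓝 0) := by
  refine Metric.tendsto_nhds.2 fun ε hε => ?_
  obtain ⟨d, hd, hlip⟩ := exists_forall_Icc_abs_sub_le hg hC (half_pos hε)
  have hclose := eventually_forall_ge_atTop.2 (Metric.tendsto_nhds.1 h (ε / 4) (by positivity))
  filter_upwards [eventually_ge_atTop s₀, hclose,
    eventually_exists_abs_deriv_lt hf hL hd (show 0 < ε / 4 by positivity)]
    with s hs hclose ⟨r, hr, hsmall⟩
  have hfg := hclose r hr.1
  rw [Real.dist_0_eq_abs] at hfg ⊢
  rw [abs_lt] at hfg hsmall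
  have hgr := abs_le.1 (hlip s hs r hr)
  exact abs_lt.2 ⟨by linarith, by linarith⟩

theorem eq_zero_of_tendsto_deriv (hf : ∀ s, s₀ ≤ s → HasDerivAt f (f' s) s)
    (hL : Tendsto f atTop (𝓝 L)) (hl : Tendsto f' atTop (𝓝 l)) : l = 0 :=
  tendsto_nhds_unique tendsto_const_nhds <|
    tendsto_zero_of_deriv_sub_of_tendsto (g := fun _ => l) (C := 0) hf hL
      (fun s _ => hasDerivAt_const s l) (by simp) (by simpa using hl.sub_const l)

theorem eventually_div_lt_of_tendsto_deriv_div (hf : ∀ s, s₀ ≤ s → HasDerivAt f (f' s) s)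
    (hg : ∀ s, s₀ ≤ s → HasDerivAt g (g' s) s) (hg' : ∀ s, s₀ ≤ s → 0 < g' s)
    (hgt : Tendsto g atTop atTop) (h : Tendsto (fun s => f' s / g' s) atTop (𝓝 l)) {ε : ℝ}
    (hε : 0 < ε) : ∀ᶠ s in atTop, f s / g s < l + ε := by
  obtain ⟨M, hM⟩ := eventually_atTop.1 <| (eventually_ge_atTop s₀).and
    (h.eventually (gt_mem_nhds (lt_add_of_pos_right l (half_pos hε))))
  have hanti : AntitoneOn (fun s => f s - (l + ε / 2) * g s) (Set.Ici M) :=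
    antitoneOn_of_hasDerivAt_nonpos (f' := fun s => f' s - (l + ε / 2) * g' s) (convex_Ici M)
      (fun s hs => (hf s (hM s hs).1).sub ((hg s (hM s hs).1).const_mul _))
      (fun s hs => sub_nonpos.2 ((div_lt_iff₀ (hg' s (hM s hs).1)).1 (hM s hs).2).le)
  filter_upwards [eventually_ge_atTop M, hgt.eventually_gt_atTop 0,
    hgt.eventually_gt_atTop ((f M - (l + ε / 2) * g M) / (ε / 2))] with s hs hg0 hlarge
  rw [div_lt_iff₀ (half_pos hε)] at hlarge
  rw [div_lt_iff₀ hg0]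
  have := hanti Set.self_mem_Ici hs hs
  simp only at this
  linarith

theorem tendsto_div_of_tendsto_deriv_div (hf : ∀ s, s₀ ≤ s → HasDerivAt f (f' s) s)
    (hg : ∀ s, s₀ ≤ s → HasDerivAt g (g' s) s) (hg' : ∀ s, s₀ ≤ s → 0 < g' s)
    (hgt : Tendsto g atTop atTop) (h : Tendsto (fun s => f' s / g' s) atTop (𝓝 l)) :
    Tendsto (fun s => f s / g s) atTop (𝓝 l) := by
  refine Metric.tendsto_nhds.2 fun ε hε => ?_
  have hneg := eventually_div_lt_of_tendsto_deriv_div (f := fun s => -f s)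
    (f' := fun s => -f' s) (l := -l) (fun s hs => (hf s hs).neg) hg hg' hgt
    (by simpa [neg_div] using h.neg) hε
  filter_upwards [eventually_div_lt_of_tendsto_deriv_div hf hg hg' hgt h hε, hneg] with s h₁ h₂
  rw [neg_div] at h₂
  exact abs_lt.2 ⟨by linarith, by linarith⟩

theorem tendsto_exp_const_mul_atTop (hc : 0 < c) :
    Tendsto (fun s : ℝ => Real.exp (c * s)) atTop atTop :=
  Real.tendsto_exp_atTop.comp (tendsto_id.const_mul_atTop hc)

theorem tendsto_exp_const_mul_nhds_zero (hc : c < 0) :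
    Tendsto (fun s : ℝ => Real.exp (c * s)) atTop (𝓝 0) :=
  Real.tendsto_exp_atBot.comp (tendsto_id.const_mul_atTop_of_neg hc)

theorem hasDerivAt_exp_const_mul (c s : ℝ) :
    HasDerivAt (fun s => Real.exp (c * s)) (c * Real.exp (c * s)) s := by
  simpa [mul_comm] using ((hasDerivAt_id s).const_mul c).exp

theorem exists_abs_sub_le_of_abs_deriv_le_exp (hc : 0 < c)
    (hf : ∀ s, s₀ ≤ s → HasDerivAt f (f' s) s)
    (h : ∀ s, s₀ ≤ s → |f' s| ≤ C * Real.exp (-c * s)) :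
    ∃ L, ∀ s, s₀ ≤ s → |f s - L| ≤ C / c * Real.exp (-c * s) := by
  have hE (s : ℝ) :
      HasDerivAt (fun s => -(C / c * Real.exp (-c * s))) (C * Real.exp (-c * s)) s :=
    ((hasDerivAt_exp_const_mul (-c) s).const_mul (C / c)).neg.congr_deriv (by field_simp)
  have hE0 : Tendsto (fun s => -(C / c * Real.exp (-c * s))) atTop (𝓝 0) := by
    simpa using ((tendsto_exp_const_mul_nhds_zero (neg_lt_zero.2 hc)).const_mul (C / c)).neg
  obtain ⟨L, hL⟩ := exists_tendsto_of_abs_deriv_le (convex_Ici s₀) (Ici_mem_atTop s₀) hf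
    (fun s _ => hE s) h hE0
  refine ⟨L, fun s hs => ?_⟩
  rw [abs_sub_comm]
  have hlim := hE0.sub_const (-(C / c * Real.exp (-c * s)))
  rw [zero_sub, neg_neg] at hlim
  refine le_of_tendsto_of_tendsto (hL.sub_const (f s)).abs hlim ?_
  filter_upwards [eventually_ge_atTop s] with r hr
  exact abs_sub_le_sub_of_abs_deriv_le (convex_Ici s₀) hf (fun s _ => hE s) h hs (hs.trans hr) hr

/-- Above the level `M` such a function grows at least like `exp s`. -/
theorem le_of_self_le_deriv_of_le_exp {B M c : ℝ} (hM : 0 < M) (hc : c < 1)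
    (hf : ∀ s, s₀ ≤ s → HasDerivAt f (f' s) s) (hgrow : ∀ s, s₀ ≤ s → M ≤ f s → f s ≤ f' s)
    (hB : ∀ s, s₀ ≤ s → f s ≤ B * Real.exp (c * s)) : ∀ s, s₀ ≤ s → f s ≤ M := by
  intro s hs
  by_contra! hlt
  have hstay := le_image_of_deriv_pos_of_eq (fun r hr => hf r (hs.trans hr)) hlt.le
    (fun r hr _ heq => (hM.trans_eq heq.symm).trans_le (hgrow r (hs.trans hr) heq.ge))
  have hmono : MonotoneOn (fun r => f r * Real.exp (-1 * r)) (Set.Ici s) :=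
    monotoneOn_of_hasDerivAt_nonneg (convex_Ici s)
      (fun r hr => (hf r (hs.trans hr)).fun_mul (hasDerivAt_exp_const_mul (-1) r))
      (fun r hr => by
        have := hgrow r (hs.trans hr) (hstay r hr)
        nlinarith [Real.exp_pos (-1 * r)])
  have hpos : 0 < f s * Real.exp (-1 * s) := mul_pos (hM.trans hlt) (Real.exp_pos _)
  have hlim := (tendsto_exp_const_mul_nhds_zero (sub_neg.2 hc)).const_mul B
  rw [mul_zero] at hlim
  obtain ⟨r, hsmall, hr⟩ :=
    ((hlim.eventually (gt_mem_nhds hpos)).and (eventually_ge_atTop s)).exists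
  refine (hmono Set.self_mem_Ici hr hr).not_gt (lt_of_le_of_lt ?_ hsmall)
  calc f r * Real.exp (-1 * r) ≤ B * Real.exp (c * r) * Real.exp (-1 * r) := by
        gcongr; exact hB r (hs.trans hr)
    _ = B * Real.exp ((c - 1) * r) := by rw [mul_assoc, ← Real.exp_add]; ring_nf

end Calculus
/-! ### The soliton system in logarithmic volume time -/

/-- The weight `2 y² / (x² + 2 y²)`, in terms of `x` and `s = log (x y²)`. It tends to `0`, `1`
or stays inside `(0, 1)` according to whether `y / x` tends to `0`, `∞` or stays comparable
to `1`. -/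
noncomputable def warp (x : ℝ → ℝ) (s : ℝ) : ℝ := 2 * Real.exp s / (x s ^ 3 + 2 * Real.exp s)

/-- A primitive of `warp x s * eˢ` along solutions, see `IsLogSoliton.hasDerivAt_warpMass`. -/
noncomputable def warpMass (P : ℝ → ℝ) (s : ℝ) : ℝ := Real.exp s - P s / 2

/-- The mean of `warp` with respect to the weight `eˢ ds`: it solves `θ' = warp - θ`. -/
noncomputable def warpMean (P : ℝ → ℝ) (s : ℝ) : ℝ := warpMass P s * Real.exp (-s)

/-- The logarithmic derivative of `y² / x²` with respect to `s = log (x y²)`. -/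
noncomputable def ratioRate (lam : ℝ) (x P : ℝ → ℝ) (s : ℝ) : ℝ :=
  4 - 6 * warp x s - 2 * lam / x s * (warp x s * Real.exp s - warpMass P s)

/-- The soliton system on `[s₀, ∞)` with independent variable `s = log (x y²)`; here
`lam * P = τ₁ - u x²` and `t` is the arc length parameter. -/
structure IsLogSoliton (lam s₀ : ℝ) (x P t : ℝ → ℝ) : Prop where
  x_pos : ∀ s, s₀ ≤ s → 0 < x s
  deriv_x : ∀ s, s₀ ≤ s → HasDerivAt x
    (x s - 2 * (1 - warp x s) * x s + lam / 3 * (P s - warp x s * x s ^ 3)) s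
  deriv_P : ∀ s, s₀ ≤ s → HasDerivAt P (warp x s * x s ^ 3) s
  deriv_t : ∀ s, s₀ ≤ s → HasDerivAt t (warp x s * x s) s

section Warp

variable {x : ℝ → ℝ} {s : ℝ}

theorem warp_pos (h : 0 < x s) : 0 < warp x s := by
  unfold warp; positivity

theorem warp_lt_one (h : 0 < x s) : warp x s < 1 := by
  rw [warp, div_lt_one (by positivity)]
  exact lt_add_of_pos_left _ (pow_pos h 3)

theorem warp_mul_cube (h : 0 < x s) :
    warp x s * x s ^ 3 = 2 * (1 - warp x s) * Real.exp s := by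
  have : x s ^ 3 + 2 * Real.exp s ≠ 0 := by positivity
  unfold warp
  field_simp
  ring

theorem one_sub_warp (h : 0 < x s) :
    1 - warp x s = x s ^ 3 / (x s ^ 3 + 2 * Real.exp s) := by
  have : x s ^ 3 + 2 * Real.exp s ≠ 0 := by positivity
  unfold warp
  field_simp
  ring

theorem one_sub_warp_le (h : 0 < x s) : 1 - warp x s ≤ x s ^ 3 / (2 * Real.exp s) := by
  rw [one_sub_warp h]
  have : 0 < x s ^ 3 := by positivity
  gcongr
  linarith

theorem cube_eq (h : 0 < x s) : x s ^ 3 = 2 * (1 - warp x s) * Real.exp s / warp x s := by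
  rw [← warp_mul_cube h, mul_div_cancel_left₀ _ (warp_pos h).ne']

theorem warpMass_eq_warpMean_mul_exp (P : ℝ → ℝ) (s : ℝ) :
    warpMass P s = warpMean P s * Real.exp s := by
  rw [warpMean, mul_assoc, ← Real.exp_add, neg_add_cancel, Real.exp_zero, mul_one]

theorem warpMean_eq (P : ℝ → ℝ) (s : ℝ) : warpMean P s = 1 - P s / 2 * Real.exp (-s) := by
  rw [warpMean, warpMass, sub_mul, ← Real.exp_add, add_neg_cancel, Real.exp_zero]

theorem ratioRate_eq (lam : ℝ) (x P : ℝ → ℝ) (s : ℝ) :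
    ratioRate lam x P s =
      4 - 6 * warp x s - 2 * lam / x s * ((warp x s - warpMean P s) * Real.exp s) := by
  rw [ratioRate, warpMass_eq_warpMean_mul_exp, sub_mul]

end Warp

namespace IsLogSoliton

variable {lam s₀ s : ℝ} {x P t : ℝ → ℝ}

theorem mono (h : IsLogSoliton lam s₀ x P t) {s₁ : ℝ} (hs : s₀ ≤ s₁) :
    IsLogSoliton lam s₁ x P t where
  x_pos s h1 := h.x_pos s (hs.trans h1)
  deriv_x s h1 := h.deriv_x s (hs.trans h1)
  deriv_P s h1 := h.deriv_P s (hs.trans h1)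
  deriv_t s h1 := h.deriv_t s (hs.trans h1)

theorem deriv_x_eq (h : IsLogSoliton lam s₀ x P t) (hs : s₀ ≤ s) :
    x s - 2 * (1 - warp x s) * x s + lam / 3 * (P s - warp x s * x s ^ 3) =
      x s * (1 - ratioRate lam x P s) / 3 := by
  have hx := h.x_pos s hs
  rw [warp_mul_cube hx, ratioRate, warpMass]
  field_simp
  ring

theorem hasDerivAt_x (h : IsLogSoliton lam s₀ x P t) (hs : s₀ ≤ s) :
    HasDerivAt x (x s * (1 - ratioRate lam x P s) / 3) s :=
  h.deriv_x_eq hs ▸ h.deriv_x s hs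

theorem hasDerivAt_warp (h : IsLogSoliton lam s₀ x P t) (hs : s₀ ≤ s) :
    HasDerivAt (warp x) (warp x s * (1 - warp x s) * ratioRate lam x P s) s := by
  have hx := h.x_pos s hs
  have hne : x s ^ 3 + 2 * Real.exp s ≠ 0 := by positivity
  have hdiv := ((Real.hasDerivAt_exp s).const_mul 2).fun_div
    (((h.hasDerivAt_x hs).fun_pow 3).fun_add ((Real.hasDerivAt_exp s).const_mul 2)) hne
  refine hdiv.congr_deriv ?_
  rw [one_sub_warp hx]
  generalize ratioRate lam x P s = R
  simp only [warp]
  field_simp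
  push_cast
  ring

theorem hasDerivAt_warpMass (h : IsLogSoliton lam s₀ x P t) (hs : s₀ ≤ s) :
    HasDerivAt (warpMass P) (warp x s * Real.exp s) s := by
  refine ((Real.hasDerivAt_exp s).fun_sub ((h.deriv_P s hs).div_const 2)).congr_deriv ?_
  rw [warp_mul_cube (h.x_pos s hs)]
  ring

theorem hasDerivAt_warpMean (h : IsLogSoliton lam s₀ x P t) (hs : s₀ ≤ s) :
    HasDerivAt (warpMean P) (warp x s - warpMean P s) s := by
  refine ((h.hasDerivAt_warpMass hs).mul (hasDerivAt_neg s).exp).congr_deriv ?_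
  have hexp : Real.exp s * Real.exp (-s) = 1 := by rw [← Real.exp_add]; simp
  rw [warpMean]
  linear_combination warp x s * hexp

theorem monotoneOn_P (h : IsLogSoliton lam s₀ x P t) : MonotoneOn P (Set.Ici s₀) :=
  monotoneOn_of_hasDerivAt_nonneg (convex_Ici s₀) h.deriv_P fun s hs =>
    mul_nonneg (warp_pos (h.x_pos s hs)).le (pow_pos (h.x_pos s hs) 3).le

theorem monotoneOn_warpMass (h : IsLogSoliton lam s₀ x P t) :
    MonotoneOn (warpMass P) (Set.Ici s₀) :=
  monotoneOn_of_hasDerivAt_nonneg (convex_Ici s₀) (fun _ hs => h.hasDerivAt_warpMass hs)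
    fun s hs => mul_nonneg (warp_pos (h.x_pos s hs)).le (Real.exp_pos s).le

theorem exists_warpMean_bounds (h : IsLogSoliton lam s₀ x P t) :
    ∃ B, 0 ≤ B ∧ ∀ s, s₀ ≤ s →
      -(B * Real.exp (-s)) ≤ warpMean P s ∧ warpMean P s ≤ 1 + B * Real.exp (-s) := by
  refine ⟨max |P s₀ / 2| |warpMass P s₀|, by positivity, fun s hs => ⟨?_, ?_⟩⟩
  · rw [warpMean, ← neg_mul]
    gcongr
    exact (neg_le_neg (le_max_right _ _)).trans <| (neg_abs_le _).trans <|
      h.monotoneOn_warpMass Set.self_mem_Ici hs hs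
  · rw [warpMean_eq, sub_eq_add_neg, ← neg_mul]
    gcongr
    have := h.monotoneOn_P Set.self_mem_Ici hs hs
    linarith [neg_abs_le (P s₀ / 2), le_max_left |P s₀ / 2| |warpMass P s₀|]

end IsLogSoliton

/-! ### Ends with `warp` inside `(0, 1)` are asymptotically conical -/

section FastLinear

variable {s₀ A₀ b B c : ℝ} {W A E f : ℝ → ℝ}

theorem le_max_of_fast_damping (hb : 0 ≤ b) (hA₀ : 0 < A₀) (hE : ∀ s, s₀ ≤ s → 0 < E s)
    (hA : ∀ s, s₀ ≤ s → A₀ ≤ A s) (hf : ∀ s, s₀ ≤ s → f s ≤ 1)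
    (hW : ∀ s, s₀ ≤ s → HasDerivAt W (-b * W s + E s * (f s - A s * W s)) s) :
    ∀ s, s₀ ≤ s → W s ≤ max (W s₀) (2 / A₀) := by
  refine image_le_of_deriv_neg_of_eq hW (le_max_left _ _) fun s hs _ heq => ?_
  have hge : 2 / A₀ ≤ W s := heq ▸ le_max_right _ _
  have hWpos : 0 < W s := lt_of_lt_of_le (by positivity) hge
  rw [div_le_iff₀' hA₀] at hge
  have hAW : A₀ * W s ≤ A s * W s := by gcongr; exact hA s hs
  have hforce : E s * (f s - A s * W s) < 0 :=
    mul_neg_of_pos_of_neg (hE s hs) (by linarith [hf s hs])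
  linarith [mul_nonneg hb hWpos.le]

/-- Above `2 / A₀` the solution would grow faster than `eˢ`. -/
theorem exists_eventually_le_of_fast_growth (hb : 0 ≤ b) (hA₀ : 0 < A₀) (hc : c < 1)
    (hE : Tendsto E atTop atTop) (hA : ∀ s, s₀ ≤ s → A s ≤ -A₀) (hf : ∀ s, s₀ ≤ s → -1 ≤ f s)
    (hW : ∀ s, s₀ ≤ s → HasDerivAt W (-b * W s + E s * (f s - A s * W s)) s)
    (hB : ∀ s, s₀ ≤ s → W s ≤ B * Real.exp (c * s)) :
    ∃ M, ∀ᶠ s in atTop, W s ≤ M := by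
  obtain ⟨s₁, hs₁⟩ := eventually_atTop.1
    ((eventually_ge_atTop s₀).and (hE.eventually_ge_atTop (2 * (1 + b) / A₀)))
  refine ⟨2 / A₀, eventually_atTop.2 ⟨s₁, le_of_self_le_deriv_of_le_exp (by positivity) hc
    (fun s hs => hW s (hs₁ s hs).1) (fun s hs hge => ?_) fun s hs => hB s (hs₁ s hs).1⟩⟩
  obtain ⟨hs0, hEs⟩ := hs₁ s hs
  have hWpos : 0 < W s := lt_of_lt_of_le (by positivity) hge
  have hEpos : 0 < E s := lt_of_lt_of_le (by positivity) hEs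
  rw [div_le_iff₀' hA₀] at hge hEs
  have hforce : A₀ * W s / 2 ≤ f s - A s * W s := by
    have : A s * W s ≤ -A₀ * W s := by gcongr; exact hA s hs0
    linarith [hf s hs0]
  calc W s = -b * W s + 2 * (1 + b) * (W s / 2) := by ring
    _ ≤ -b * W s + A₀ * E s * (W s / 2) := by gcongr
    _ = -b * W s + E s * (A₀ * W s / 2) := by ring
    _ ≤ -b * W s + E s * (f s - A s * W s) := by gcongr

theorem exists_eventually_le_of_fast_linear {lam : ℝ} (hlam : lam ≠ 0) (hb : 0 ≤ b)
    (hA₀ : 0 < A₀) (hc : c < 1) (hEpos : ∀ s, 0 < E s) (hE : Tendsto E atTop atTop)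
    (hA : ∀ s, s₀ ≤ s → A₀ ≤ A s) (hf : ∀ s, s₀ ≤ s → |f s| ≤ 1)
    (hW : ∀ s, s₀ ≤ s → HasDerivAt W (-b * W s + E s * (f s - lam * A s * W s)) s)
    (hB : ∀ s, s₀ ≤ s → W s ≤ B * Real.exp (c * s)) :
    ∃ M, ∀ᶠ s in atTop, W s ≤ M := by
  obtain hneg | hpos := hlam.lt_or_gt
  · refine exists_eventually_le_of_fast_growth (A₀ := -lam * A₀) hb
      (mul_pos (neg_pos.2 hneg) hA₀) hc hE (fun s hs => ?_) (fun s hs => (abs_le.1 (hf s hs)).1)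
      hW hB
    nlinarith [hA s hs]
  · refine ⟨_, eventually_atTop.2 ⟨s₀, le_max_of_fast_damping (A₀ := lam * A₀) hb
      (by positivity) (fun s _ => hEpos s) (fun s hs => ?_)
      (fun s hs => (abs_le.1 (hf s hs)).2) hW⟩⟩
    gcongr
    exact hA s hs

theorem isBigO_one_of_fast_linear {lam : ℝ} (hlam : lam ≠ 0) (hb : 0 ≤ b)
    (hA₀ : 0 < A₀) (hc : c < 1) (hEpos : ∀ s, 0 < E s) (hE : Tendsto E atTop atTop)
    (hA : ∀ s, s₀ ≤ s → A₀ ≤ A s) (hf : ∀ s, s₀ ≤ s → |f s| ≤ 1)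
    (hW : ∀ s, s₀ ≤ s → HasDerivAt W (-b * W s + E s * (f s - lam * A s * W s)) s)
    (hB : ∀ s, s₀ ≤ s → |W s| ≤ B * Real.exp (c * s)) :
    W =O[atTop] (fun _ => (1 : ℝ)) := by
  obtain ⟨M₁, hM₁⟩ := exists_eventually_le_of_fast_linear hlam hb hA₀ hc hEpos hE hA hf hW
    fun s hs => (le_abs_self _).trans (hB s hs)
  obtain ⟨M₂, hM₂⟩ := exists_eventually_le_of_fast_linear (W := fun s => -W s)
    (f := fun s => -f s) hlam hb hA₀ hc hEpos hE hA (by simpa only [abs_neg] using hf)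
    (fun s hs => (hW s hs).neg.congr_deriv (by ring)) fun s hs => (neg_le_abs _).trans (hB s hs)
  refine IsBigO.of_bound (max M₁ M₂) ?_
  filter_upwards [hM₁, hM₂] with s h₁ h₂
  rw [norm_one, mul_one, Real.norm_eq_abs, abs_le']
  exact ⟨h₁.trans (le_max_left _ _), h₂.trans (le_max_right _ _)⟩

end FastLinear

theorem isBigO_comp_sub_of_differentiableAt {α : Type*} {L : Filter α} {F : ℝ → ℝ}
    {u g : α → ℝ} {l : ℝ} (hF : DifferentiableAt ℝ F l) (hu : (fun s => u s - l) =O[L] g)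
    (hg : Tendsto g L (𝓝 0)) : (fun s => F (u s) - F l) =O[L] g := by
  have hlim : Tendsto u L (𝓝 l) := by simpa using (hu.trans_tendsto hg).add_const l
  exact (hF.isBigO_sub.comp_tendsto hlim).trans hu

/-- The length scale `(x y²)^{1/3}` in terms of `s = log (x y²)`. -/
noncomputable def lengthScale (s : ℝ) : ℝ := Real.exp (1 / 3 * s)

theorem lengthScale_pos (s : ℝ) : 0 < lengthScale s := Real.exp_pos _

theorem lengthScale_cube (s : ℝ) : lengthScale s ^ 3 = Real.exp s := by
  rw [lengthScale, ← Real.exp_nat_mul]; push_cast; ring_nf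

theorem lengthScale_sq (s : ℝ) : lengthScale s ^ 2 = Real.exp (2 / 3 * s) := by
  rw [lengthScale, ← Real.exp_nat_mul]; push_cast; ring_nf

theorem hasDerivAt_lengthScale (s : ℝ) : HasDerivAt lengthScale (lengthScale s / 3) s :=
  (hasDerivAt_exp_const_mul (1 / 3) s).congr_deriv (by rw [lengthScale]; ring)

theorem hasDerivAt_lengthScale_sq (s : ℝ) :
    HasDerivAt (fun s => lengthScale s ^ 2) (2 / 3 * lengthScale s ^ 2) s :=
  ((hasDerivAt_lengthScale s).fun_pow 2).congr_deriv (by push_cast; ring)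

theorem tendsto_lengthScale : Tendsto lengthScale atTop atTop :=
  tendsto_exp_const_mul_atTop (by norm_num)

theorem tendsto_lengthScale_sq : Tendsto (fun s => lengthScale s ^ 2) atTop atTop :=
  (tendsto_pow_atTop two_ne_zero).comp tendsto_lengthScale

namespace IsLogSoliton

variable {lam s₀ s ε : ℝ} {x P t : ℝ → ℝ}

/-- The rescaled deviation `W = (x y²)^{2/3} (warp - θ)` of `warp` from its mean solves a linear
equation whose coefficient has the sign of `-lam` and grows like `(x y²)^{2/3}`. -/
theorem hasDerivAt_lengthScale_sq_mul_warp_sub (h : IsLogSoliton lam s₀ x P t) (hs : s₀ ≤ s) :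
    HasDerivAt (fun s => lengthScale s ^ 2 * (warp x s - warpMean P s))
      (-(1 / 3) * (lengthScale s ^ 2 * (warp x s - warpMean P s)) + lengthScale s ^ 2 *
        (warp x s * (1 - warp x s) * (4 - 6 * warp x s) -
          lam * (2 * (warp x s * (1 - warp x s)) * (lengthScale s / x s)) *
            (lengthScale s ^ 2 * (warp x s - warpMean P s)))) s := by
  refine ((hasDerivAt_lengthScale_sq s).fun_mul
    ((h.hasDerivAt_warp hs).fun_sub (h.hasDerivAt_warpMean hs))).congr_deriv ?_
  have hx := h.x_pos s hs
  rw [ratioRate_eq, ← lengthScale_cube]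
  field_simp
  ring

theorem x_le_of_le_warp (h : IsLogSoliton lam s₀ x P t) (hs : s₀ ≤ s) (hε : 0 < ε)
    (hε' : ε ≤ 1 / 2) (hw : ε ≤ warp x s) : x s ≤ 2 / ε * lengthScale s := by
  have hx := h.x_pos s hs
  have hwarp := warp_pos hx
  have h2 : 1 ≤ 2 / ε := by rw [le_div_iff₀ hε]; linarith
  refine le_of_pow_le_pow_left₀ three_ne_zero (by have := lengthScale_pos s; positivity) ?_
  rw [mul_pow, lengthScale_cube, cube_eq hx, div_le_iff₀ hwarp]
  calc 2 * (1 - warp x s) * Real.exp s ≤ 2 * 1 * Real.exp s := by gcongr; linarith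
    _ = 2 / ε * ε * Real.exp s := by rw [div_mul_cancel₀ _ hε.ne', mul_one]
    _ ≤ (2 / ε) ^ 3 * warp x s * Real.exp s := by gcongr; exact le_self_pow₀ h2 three_ne_zero
    _ = (2 / ε) ^ 3 * Real.exp s * warp x s := by ring

theorem abs_warp_mul_le_one (hx : 0 < x s) :
    |warp x s * (1 - warp x s) * (4 - 6 * warp x s)| ≤ 1 := by
  have h0 := warp_pos hx
  have h1 := warp_lt_one hx
  have hprod : 0 ≤ warp x s * (1 - warp x s) := mul_nonneg h0.le (by linarith)
  rw [abs_mul, abs_of_nonneg hprod]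
  calc warp x s * (1 - warp x s) * |4 - 6 * warp x s| ≤ 1 / 4 * 4 := by
        gcongr
        · nlinarith [sq_nonneg (warp x s - 1 / 2)]
        · exact abs_le.2 ⟨by linarith, by linarith⟩
    _ = 1 := by norm_num

theorem exists_abs_warp_sub_warpMean_le (h : IsLogSoliton lam s₀ x P t) :
    ∃ B, ∀ s, s₀ ≤ s → |warp x s - warpMean P s| ≤ B := by
  obtain ⟨B, hB0, hB⟩ := h.exists_warpMean_bounds
  refine ⟨1 + B * Real.exp (-s₀), fun s hs => ?_⟩
  have hexp : B * Real.exp (-s) ≤ B * Real.exp (-s₀) := by gcongr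
  have h0 := warp_pos (h.x_pos s hs)
  have h1 := warp_lt_one (h.x_pos s hs)
  exact abs_le.2 ⟨by linarith [(hB s hs).2], by linarith [(hB s hs).1]⟩

theorem isBigO_warp_sub_warpMean (h : IsLogSoliton lam s₀ x P t) (hlam : lam ≠ 0) (hε : 0 < ε)
    (hw : ∀ s, s₀ ≤ s → ε ≤ warp x s ∧ warp x s ≤ 1 - ε) :
    (fun s => warp x s - warpMean P s) =O[atTop] (fun s => (lengthScale s ^ 2)⁻¹) := by
  have hε' : ε ≤ 1 / 2 := by linarith [(hw s₀ le_rfl).1, (hw s₀ le_rfl).2]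
  obtain ⟨B, hB⟩ := h.exists_abs_warp_sub_warpMean_le
  have hcoeff : ∀ s, s₀ ≤ s →
      2 * (ε * ε) * (ε / 2) ≤ 2 * (warp x s * (1 - warp x s)) * (lengthScale s / x s) := by
    intro s hs
    have hx := h.x_pos s hs
    have hscale := h.x_le_of_le_warp hs hε hε' (hw s hs).1
    have hprod : ε * ε ≤ warp x s * (1 - warp x s) :=
      mul_le_mul (hw s hs).1 (by linarith [(hw s hs).2]) hε.le (warp_pos hx).le
    have hquot : ε / 2 ≤ lengthScale s / x s := by
      rw [le_div_iff₀ hx]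
      calc ε / 2 * x s ≤ ε / 2 * (2 / ε * lengthScale s) := by gcongr
        _ = lengthScale s := by field_simp
    have := (mul_pos hε hε).le.trans hprod
    gcongr
  have hbound : ∀ s, s₀ ≤ s →
      |lengthScale s ^ 2 * (warp x s - warpMean P s)| ≤ B * Real.exp (2 / 3 * s) := by
    intro s hs
    rw [abs_mul, abs_of_pos (by have := lengthScale_pos s; positivity), mul_comm, lengthScale_sq]
    gcongr
    exact hB s hs
  have hW := isBigO_one_of_fast_linear hlam (by norm_num) (by positivity) (by norm_num)
    (fun s => pow_pos (lengthScale_pos s) 2) tendsto_lengthScale_sq hcoeff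
    (fun s hs => abs_warp_mul_le_one (h.x_pos s hs))
    (fun s hs => h.hasDerivAt_lengthScale_sq_mul_warp_sub hs) hbound
  refine ((isBigO_refl (fun s => (lengthScale s ^ 2)⁻¹) atTop).mul hW).congr
    (fun s => ?_) (fun s => mul_one _)
  rw [inv_mul_cancel_left₀ (pow_pos (lengthScale_pos s) 2).ne']

theorem exists_isBigO_warp_sub (h : IsLogSoliton lam s₀ x P t) (hlam : lam ≠ 0) (hε : 0 < ε)
    (hw : ∀ s, s₀ ≤ s → ε ≤ warp x s ∧ warp x s ≤ 1 - ε) :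
    ∃ l, ε ≤ l ∧ l ≤ 1 - ε ∧
      (fun s => warp x s - l) =O[atTop] (fun s => (lengthScale s ^ 2)⁻¹) := by
  have hO := h.isBigO_warp_sub_warpMean hlam hε hw
  obtain ⟨C, hC⟩ := hO.bound
  obtain ⟨s₁, hs₁⟩ := eventually_atTop.1 hC
  have hinv : ∀ s, (lengthScale s ^ 2)⁻¹ = Real.exp (-(2 / 3) * s) := fun s => by
    rw [lengthScale_sq, ← Real.exp_neg, neg_mul]
  obtain ⟨l, hl⟩ := exists_abs_sub_le_of_abs_deriv_le_exp (s₀ := max s₀ s₁) (C := C)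
    (by norm_num : (0 : ℝ) < 2 / 3)
    (fun s hs => h.hasDerivAt_warpMean ((le_max_left _ _).trans hs)) fun s hs => by
      simpa [hinv, Real.norm_eq_abs] using hs₁ s ((le_max_right _ _).trans hs)
  have hmean : (fun s => warpMean P s - l) =O[atTop] (fun s => (lengthScale s ^ 2)⁻¹) := by
    refine IsBigO.of_bound (C / (2 / 3)) (eventually_atTop.2 ⟨max s₀ s₁, fun s hs => ?_⟩)
    simpa [hinv, Real.norm_eq_abs] using hl s hs
  have hlO : (fun s => warp x s - l) =O[atTop] (fun s => (lengthScale s ^ 2)⁻¹) :=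
    (hO.add hmean).congr_left fun s => sub_add_sub_cancel _ _ _
  have hlim : Tendsto (warp x) atTop (𝓝 l) := by
    simpa using (hlO.trans_tendsto tendsto_lengthScale_sq.inv_tendsto_atTop).add_const l
  exact ⟨l, ge_of_tendsto hlim ((eventually_ge_atTop s₀).mono fun s hs => (hw s hs).1),
    le_of_tendsto hlim ((eventually_ge_atTop s₀).mono fun s hs => (hw s hs).2), hlO⟩

end IsLogSoliton

/-- The ratio `x / (x y²)^{1/3}` as a function of the value of `warp`. -/
noncomputable def xShape (w : ℝ) : ℝ := (2 * (1 - w) / w) ^ (1 / 3 : ℝ)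

section Shape

variable {x : ℝ → ℝ} {l s : ℝ}

theorem xShape_pos (h0 : 0 < l) (h1 : l < 1) : 0 < xShape l :=
  Real.rpow_pos_of_pos (div_pos (by linarith) h0) _

theorem mul_xShape_cube (h0 : 0 < l) (h1 : l < 1) : l * xShape l ^ 3 = 2 * (1 - l) := by
  rw [xShape, ← Real.rpow_natCast, ← Real.rpow_mul (div_pos (by linarith) h0).le]
  norm_num
  field_simp

theorem differentiableAt_xShape (h0 : 0 < l) (h1 : l < 1) : DifferentiableAt ℝ xShape l := by
  have hpos : 2 * (1 - l) / l ≠ 0 := (div_pos (by linarith) h0).ne'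
  unfold xShape
  exact (((differentiableAt_id.const_sub 1).const_mul 2).div differentiableAt_id h0.ne').rpow_const
    (Or.inl hpos)

theorem eq_xShape_warp_mul_lengthScale (h : 0 < x s) :
    x s = xShape (warp x s) * lengthScale s := by
  have h0 := warp_pos h
  have h1 := warp_lt_one h
  refine (pow_left_inj₀ h.le (mul_pos (xShape_pos h0 h1) (lengthScale_pos s)).le
    three_ne_zero).1 ?_
  rw [mul_pow, lengthScale_cube, cube_eq h, div_eq_iff h0.ne']
  linear_combination -Real.exp s * mul_xShape_cube h0 h1

theorem sqrt_exp_div_eq (h : 0 < x s) :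
    √(Real.exp s / x s) = √(xShape (warp x s))⁻¹ * lengthScale s := by
  have hξ := xShape_pos (warp_pos h) (warp_lt_one h)
  have hρ := lengthScale_pos s
  rw [← Real.sqrt_sq hρ.le, ← Real.sqrt_mul (inv_pos.2 hξ).le, ← lengthScale_cube]
  rw [eq_xShape_warp_mul_lengthScale h]
  congr 1
  field_simp

theorem isClosedSp2Cone_of_xShape (h0 : 0 < l) (h1 : l < 1) :
    IsClosedSp2Cone (xShape l / (3 * (l * xShape l))) (√(xShape l)⁻¹ / (3 * (l * xShape l))) := by
  have hξ := xShape_pos h0 h1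
  have hcube := mul_xShape_cube h0 h1
  refine ⟨by positivity, by positivity, ?_⟩
  rw [div_pow √_, Real.sq_sqrt (by positivity)]
  field_simp
  linear_combination -3 * hcube

end Shape

namespace IsLogSoliton

variable {lam s₀ l k ε : ℝ} {x P t : ℝ → ℝ}

theorem isBigO_lengthScale_inv (ht : (fun s => t s - (3 * l * lengthScale s + k)) =O[atTop]
    (fun s => (lengthScale s)⁻¹)) (httop : Tendsto t atTop atTop) :
    (fun s => (lengthScale s)⁻¹) =O[atTop] (fun s => (t s)⁻¹) := by
  have hinv : (fun s => (lengthScale s)⁻¹) =O[atTop] lengthScale :=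
    (tendsto_lengthScale.inv_tendsto_atTop.isBigO_one ℝ).trans
      (isLittleO_const_left.2 (Or.inr (tendsto_norm_atTop_atTop.comp tendsto_lengthScale))).isBigO
  have hconst : (fun _ => k) =O[atTop] lengthScale :=
    (isLittleO_const_left.2 (Or.inr (tendsto_norm_atTop_atTop.comp tendsto_lengthScale))).isBigO
  have htO : t =O[atTop] lengthScale :=
    ((ht.trans hinv).add (((isBigO_refl _ _).const_mul_left (3 * l)).add hconst)).congr_left
      fun s => sub_add_cancel _ _
  refine htO.inv_rev ?_
  filter_upwards [httop.eventually_gt_atTop 0] with s hs h0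
  exact absurd h0 hs.ne'

theorem exists_isBigO_arcLength_sub (h : IsLogSoliton lam s₀ x P t) (h0 : 0 < l) (h1 : l < 1)
    (hw : (fun s => warp x s - l) =O[atTop] (fun s => (lengthScale s ^ 2)⁻¹)) :
    ∃ k, (fun s => t s - (3 * (l * xShape l) * lengthScale s + k)) =O[atTop]
      (fun s => (lengthScale s)⁻¹) := by
  have hspeed := isBigO_comp_sub_of_differentiableAt (F := fun w => w * xShape w)
    (differentiableAt_id.mul (differentiableAt_xShape h0 h1)) hw
    tendsto_lengthScale_sq.inv_tendsto_atTop
  obtain ⟨C, hC⟩ := hspeed.bound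
  obtain ⟨s₁, hs₁⟩ := eventually_atTop.1 hC
  have hinv : ∀ s, (lengthScale s)⁻¹ = Real.exp (-(1 / 3) * s) := fun s => by
    rw [lengthScale, ← Real.exp_neg, neg_mul]
  have hderiv : ∀ s, max s₀ s₁ ≤ s → HasDerivAt
      (fun s => t s - 3 * (l * xShape l) * lengthScale s)
      ((warp x s * xShape (warp x s) - l * xShape l) * lengthScale s) s := by
    intro s hs
    have hs0 := (le_max_left _ _).trans hs
    refine ((h.deriv_t s hs0).fun_sub ((hasDerivAt_lengthScale s).const_mul
      (3 * (l * xShape l)))).congr_deriv ?_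
    linear_combination warp x s * eq_xShape_warp_mul_lengthScale (h.x_pos s hs0)
  have hbound : ∀ s, max s₀ s₁ ≤ s →
      |(warp x s * xShape (warp x s) - l * xShape l) * lengthScale s| ≤
        C * Real.exp (-(1 / 3) * s) := by
    intro s hs
    have hρ := lengthScale_pos s
    have hle := hs₁ s ((le_max_right _ _).trans hs)
    rw [Real.norm_eq_abs, Real.norm_eq_abs, abs_of_pos (a := (_)⁻¹) (by positivity)] at hle
    rw [abs_mul, abs_of_pos hρ, ← hinv]
    calc _ ≤ C * (lengthScale s ^ 2)⁻¹ * lengthScale s := by gcongr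
      _ = C * (lengthScale s)⁻¹ := by field_simp
  obtain ⟨k, hk⟩ := exists_abs_sub_le_of_abs_deriv_le_exp (by norm_num) hderiv hbound
  refine ⟨k, IsBigO.of_bound (C / (1 / 3)) (eventually_atTop.2 ⟨max s₀ s₁, fun s hs => ?_⟩)⟩
  simpa only [Real.norm_eq_abs, sub_sub, hinv, abs_of_pos (Real.exp_pos _)] using hk s hs

theorem isBigO_mul_lengthScale_sub {F : ℝ → ℝ} (hF : DifferentiableAt ℝ F l) {κ : ℝ}
    (hκ : κ ≠ 0) (hw : (fun s => warp x s - l) =O[atTop] (fun s => (lengthScale s ^ 2)⁻¹))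
    (ht : (fun s => t s - (κ * lengthScale s + k)) =O[atTop] (fun s => (lengthScale s)⁻¹)) :
    (fun s => F (warp x s) * lengthScale s - F l / κ * (t s + -k)) =O[atTop]
      (fun s => (lengthScale s)⁻¹) := by
  have hFO := isBigO_comp_sub_of_differentiableAt hF hw
    tendsto_lengthScale_sq.inv_tendsto_atTop
  have hmul : (fun s => (F (warp x s) - F l) * lengthScale s) =O[atTop]
      (fun s => (lengthScale s)⁻¹) := by
    refine (hFO.mul (isBigO_refl lengthScale atTop)).congr_right fun s => ?_
    have := (lengthScale_pos s).ne'
    field_simp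
  refine (hmul.add (ht.const_mul_left (-(F l / κ)))).congr_left fun s => ?_
  field_simp
  ring

theorem conical (h : IsLogSoliton lam s₀ x P t) (hlam : lam ≠ 0) (hε : 0 < ε)
    (hw : ∀ s, s₀ ≤ s → ε ≤ warp x s ∧ warp x s ≤ 1 - ε) :
    Tendsto t atTop atTop ∧ ∃ c₁ c₂ k : ℝ, IsClosedSp2Cone c₁ c₂ ∧
      (fun s => x s - c₁ * (t s + k)) =O[atTop] (fun s => (t s)⁻¹) ∧
      (fun s => √(Real.exp s / x s) - c₂ * (t s + k)) =O[atTop] (fun s => (t s)⁻¹) := by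
  obtain ⟨l, hl0, hl1, hlO⟩ := h.exists_isBigO_warp_sub hlam hε hw
  have h0 : 0 < l := hε.trans_le hl0
  have h1 : l < 1 := by linarith
  have hξ := xShape_pos h0 h1
  have hκ : 0 < 3 * (l * xShape l) := by positivity
  obtain ⟨k, hk⟩ := h.exists_isBigO_arcLength_sub h0 h1 hlO
  have httop : Tendsto t atTop atTop := by
    have hlim := (hk.trans_tendsto tendsto_lengthScale.inv_tendsto_atTop).add_atTop
      (tendsto_atTop_add_const_right _ k (tendsto_lengthScale.const_mul_atTop hκ))
    exact hlim.congr fun s => sub_add_cancel _ _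
  have hρt := isBigO_lengthScale_inv hk httop
  have hdiff : DifferentiableAt ℝ (fun w => √(xShape w)⁻¹) l :=
    ((differentiableAt_xShape h0 h1).inv hξ.ne').sqrt (inv_pos.2 hξ).ne'
  refine ⟨httop, _, _, -k, isClosedSp2Cone_of_xShape h0 h1, ?_, ?_⟩
  · refine ((isBigO_mul_lengthScale_sub (differentiableAt_xShape h0 h1) hκ.ne' hlO hk).congr'
      ?_ EventuallyEq.rfl).trans hρt
    filter_upwards [eventually_ge_atTop s₀] with s hs
    rw [← eq_xShape_warp_mul_lengthScale (h.x_pos s hs)]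
  · refine ((isBigO_mul_lengthScale_sub hdiff hκ.ne' hlO hk).congr' ?_ EventuallyEq.rfl).trans hρt
    filter_upwards [eventually_ge_atTop s₀] with s hs
    rw [← sqrt_exp_div_eq (h.x_pos s hs)]

end IsLogSoliton
/-! ### Expanders -/

/-- The quantity `y⁴ / x²` in terms of `x` and `s = log (x y²)`. -/
noncomputable def quarticRatio (x : ℝ → ℝ) (s : ℝ) : ℝ := Real.exp s ^ 2 / x s ^ 4

section QuarticRatio

variable {x : ℝ → ℝ} {c s : ℝ}

theorem quarticRatio_pos (hx : 0 < x s) : 0 < quarticRatio x s := by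
  unfold quarticRatio; positivity

theorem quarticRatio_mul_pow_four (hx : 0 < x s) :
    quarticRatio x s * x s ^ 4 = Real.exp s ^ 2 :=
  div_mul_cancel₀ _ (by positivity)

theorem warp_le_div_cube (hx : 0 < x s) : warp x s ≤ 2 * Real.exp s / x s ^ 3 := by
  have := Real.exp_pos s
  unfold warp
  gcongr
  linarith

theorem warp_sq_le (hx : 0 < x s) : warp x s ^ 2 ≤ 4 * quarticRatio x s / x s ^ 2 := by
  have := warp_pos hx
  calc warp x s ^ 2 ≤ (2 * Real.exp s / x s ^ 3) ^ 2 := by gcongr; exact warp_le_div_cube hx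
    _ = 4 * quarticRatio x s / x s ^ 2 := by unfold quarticRatio; field_simp; ring

theorem le_warp_mul_exp (hx : 0 < x s) (hs : 0 ≤ s) (hc : 0 < c) (hle : c ≤ quarticRatio x s) :
    2 / (3 + 1 / c) ≤ warp x s * Real.exp s := by
  have hv : 1 ≤ Real.exp s := Real.one_le_exp hs
  have hfour : x s ^ 4 ≤ Real.exp s ^ 2 * (1 / c) := by
    rw [mul_one_div, le_div_iff₀ hc, mul_comm, ← quarticRatio_mul_pow_four hx]
    gcongr
  have hcube : x s ^ 3 ≤ 1 + x s ^ 4 := by nlinarith [sq_nonneg (x s ^ 2 - x s), sq_nonneg (x s)]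
  unfold warp
  rw [div_mul_eq_mul_div, div_le_div_iff₀ (by positivity) (by positivity)]
  nlinarith

end QuarticRatio

namespace IsLogSoliton

variable {lam s₀ s C M ε : ℝ} {x P t : ℝ → ℝ}

theorem hasDerivAt_quarticRatio (h : IsLogSoliton lam s₀ x P t) (hs : s₀ ≤ s) :
    HasDerivAt (quarticRatio x)
      (quarticRatio x s * (2 / 3 + 4 / 3 * ratioRate lam x P s)) s := by
  have hx := h.x_pos s hs
  refine (((Real.hasDerivAt_exp s).fun_pow 2).fun_div ((h.hasDerivAt_x hs).fun_pow 4)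
    (by positivity)).congr_deriv ?_
  rw [quarticRatio]
  field_simp
  push_cast
  ring

theorem ratioRate_nonneg_of_quarticRatio_le (hlam : 0 < lam) (hX : 4 * lam * C + 1 + 2 / lam ≤ x s)
    (hC : 0 ≤ C) (hmass : -C ≤ warpMass P s) (hratio : quarticRatio x s ≤ 1 / (8 * lam)) :
    0 ≤ ratioRate lam x P s := by
  have h4C : 0 ≤ 4 * lam * C := by positivity
  have h2lam : 0 < 2 / lam := by positivity
  have hx1 : 1 ≤ x s := by linarith
  have hx : 0 < x s := one_pos.trans_le hx1
  have hwarp : warp x s ≤ 1 / 2 := by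
    refine le_of_pow_le_pow_left₀ two_ne_zero (by norm_num) ((warp_sq_le hx).trans ?_)
    rw [div_le_iff₀ (by positivity)]
    calc 4 * quarticRatio x s ≤ 4 * (1 / (8 * lam)) := by gcongr
      _ = (1 / 2) ^ 2 * (2 / lam) := by field_simp; norm_num
      _ ≤ (1 / 2) ^ 2 * x s ^ 2 := by
        gcongr
        exact le_trans (by linarith) (le_self_pow₀ hx1 two_ne_zero)
  have hfirst : 2 * lam / x s * (warp x s * Real.exp s) ≤ 1 / 2 := by
    calc 2 * lam / x s * (warp x s * Real.exp s)
        ≤ 2 * lam / x s * (2 * Real.exp s / x s ^ 3 * Real.exp s) := by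
          gcongr; exact warp_le_div_cube hx
      _ = 4 * lam * quarticRatio x s := by unfold quarticRatio; field_simp; ring
      _ ≤ 4 * lam * (1 / (8 * lam)) := by gcongr
      _ = 1 / 2 := by field_simp; norm_num
  have hsecond : 2 * lam / x s * -warpMass P s ≤ 1 / 2 := by
    calc 2 * lam / x s * -warpMass P s ≤ 2 * lam / x s * C := by gcongr; linarith
      _ ≤ 1 / 2 := by rw [div_mul_eq_mul_div, div_le_iff₀ hx]; linarith
  rw [ratioRate, mul_sub]
  linarith

theorem exists_quarticRatio_ge (h : IsLogSoliton lam s₀ x P t) (hlam : 0 < lam) (hC : 0 ≤ C)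
    (hmass : ∀ s, s₀ ≤ s → -C ≤ warpMass P s) :
    ∃ c > 0, ∀ᶠ s in atTop, c ≤ quarticRatio x s := by
  set X := 4 * lam * C + 1 + 2 / lam
  have : 0 < X := by positivity
  obtain ⟨s₁, hs₁⟩ := eventually_atTop.1 <| (eventually_ge_atTop s₀).and <|
    (eventually_ge_atTop 0).and <|
      Real.tendsto_exp_atTop.eventually_ge_atTop (1 / (8 * lam) * X ^ 4)
  refine ⟨min (quarticRatio x s₁) (1 / (8 * lam)),
    lt_min (quarticRatio_pos (h.x_pos s₁ (hs₁ s₁ le_rfl).1)) (by positivity),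
    eventually_atTop.2 ⟨s₁, le_image_of_deriv_pos_of_eq
      (fun s hs => h.hasDerivAt_quarticRatio (hs₁ s hs).1) (min_le_left _ _)
      fun s hs _ heq => ?_⟩⟩
  obtain ⟨hs0, hspos, hexp⟩ := hs₁ s hs
  have hx := h.x_pos s hs0
  have hb : quarticRatio x s ≤ 1 / (8 * lam) := heq ▸ min_le_right _ _
  have hXx : X ≤ x s := by
    refine le_of_pow_le_pow_left₀ four_ne_zero hx.le
      (le_of_mul_le_mul_left ?_ (by positivity : 0 < 1 / (8 * lam)))
    calc 1 / (8 * lam) * X ^ 4 ≤ Real.exp s := hexp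
      _ ≤ Real.exp s ^ 2 := le_self_pow₀ (Real.one_le_exp hspos) two_ne_zero
      _ = quarticRatio x s * x s ^ 4 := (quarticRatio_mul_pow_four hx).symm
      _ ≤ 1 / (8 * lam) * x s ^ 4 := by gcongr
  have := ratioRate_nonneg_of_quarticRatio_le hlam hXx hC (hmass s hs0) hb
  have := quarticRatio_pos hx
  positivity

theorem exists_warpMass_pos (h : IsLogSoliton lam s₀ x P t) (hlam : 0 < lam) :
    ∃ s, s₀ ≤ s ∧ 0 < warpMass P s := by
  by_contra! hneg
  obtain ⟨c, hc, hle⟩ := h.exists_quarticRatio_ge (C := -warpMass P s₀) hlam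
    (by linarith [hneg s₀ le_rfl]) fun s hs => by
      rw [neg_neg]; exact h.monotoneOn_warpMass Set.self_mem_Ici hs hs
  obtain ⟨s₁, hs₁⟩ := eventually_atTop.1
    (hle.and ((eventually_ge_atTop s₀).and (eventually_ge_atTop 0)))
  have htop : Tendsto (warpMass P) atTop atTop :=
    tendsto_atTop_of_le_hasDerivAt (by positivity : 0 < 2 / (3 + 1 / c))
      (fun s hs => h.hasDerivAt_warpMass (hs₁ s hs).2.1) fun s hs =>
        le_warp_mul_exp (h.x_pos s (hs₁ s hs).2.1) (hs₁ s hs).2.2 hc (hs₁ s hs).1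
  obtain ⟨s, hpos, hs⟩ := ((htop.eventually_gt_atTop 0).and (eventually_ge_atTop s₀)).exists
  exact (hneg s hs).not_gt hpos

theorem exists_le_warp_of_warpMass_pos (h : IsLogSoliton lam s₀ x P t) (hlam : 0 < lam)
    (hmass : 0 < warpMass P s₀) : ∃ ε > 0, ∀ s, s₀ ≤ s → ε ≤ warp x s := by
  set ε := min (warp x s₀) (min (warpMass P s₀ / Real.exp s₀) (1 / 2))
  have hε : 0 < ε := lt_min (warp_pos (h.x_pos s₀ le_rfl))
    (lt_min (div_pos hmass (Real.exp_pos _)) (by norm_num))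
  have hε_half : ε ≤ 1 / 2 := (min_le_right _ _).trans (min_le_right _ _)
  have hε_mass : ε * Real.exp s₀ ≤ warpMass P s₀ := by
    rw [← le_div_iff₀ (Real.exp_pos _)]
    exact (min_le_right _ _).trans (min_le_left _ _)
  refine ⟨ε, hε, le_image_of_deriv_pos_of_eq (fun s hs => h.hasDerivAt_warp hs) (min_le_left _ _)
    fun s hs hist heq => ?_⟩
  have hx := h.x_pos s hs
  have hmono : MonotoneOn (fun σ => warpMass P σ - ε * Real.exp σ) (Set.Icc s₀ s) :=
    monotoneOn_of_hasDerivAt_nonneg (convex_Icc s₀ s)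
      (fun σ hσ => (h.hasDerivAt_warpMass hσ.1).fun_sub ((Real.hasDerivAt_exp σ).const_mul ε))
      fun σ hσ => by
        rw [← sub_mul]
        exact mul_nonneg (sub_nonneg.2 (hist σ hσ.1 hσ.2)) (Real.exp_pos σ).le
  have hle := hmono ⟨le_rfl, hs⟩ ⟨hs, le_rfl⟩ hs
  have hforce : 2 * lam / x s * (warp x s * Real.exp s - warpMass P s) ≤ 0 :=
    mul_nonpos_of_nonneg_of_nonpos (by positivity) (by rw [heq]; linarith)
  have hrate : 0 < ratioRate lam x P s := by rw [ratioRate]; linarith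
  exact mul_pos (mul_pos (warp_pos hx) (sub_pos.2 (warp_lt_one hx))) hrate

theorem exists_warp_le_of_P_pos (h : IsLogSoliton lam s₀ x P t) (hlam : 0 < lam)
    (hP : 0 < P s₀) : ∃ ε > 0, ∀ s, s₀ ≤ s → warp x s ≤ 1 - ε := by
  set ε := min (1 - warp x s₀) (min (P s₀ / (2 * Real.exp s₀)) (1 / 4))
  have hε : 0 < ε := lt_min (sub_pos.2 (warp_lt_one (h.x_pos s₀ le_rfl)))
    (lt_min (by positivity) (by norm_num))
  have hε_quarter : ε ≤ 1 / 4 := (min_le_right _ _).trans (min_le_right _ _)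
  have hε_P : ε * (2 * Real.exp s₀) ≤ P s₀ := by
    rw [← le_div_iff₀ (by positivity)]
    exact (min_le_right _ _).trans (min_le_left _ _)
  refine ⟨ε, hε, image_le_of_deriv_neg_of_eq (fun s hs => h.hasDerivAt_warp hs)
    (le_sub_comm.1 (min_le_left _ _)) fun s hs hist heq => ?_⟩
  have hx := h.x_pos s hs
  have hmono : MonotoneOn (fun σ => P σ - 2 * ε * Real.exp σ) (Set.Icc s₀ s) :=
    monotoneOn_of_hasDerivAt_nonneg (convex_Icc s₀ s)
      (fun σ hσ => (h.deriv_P σ hσ.1).fun_sub ((Real.hasDerivAt_exp σ).const_mul (2 * ε)))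
      fun σ hσ => by
        rw [warp_mul_cube (h.x_pos σ hσ.1), ← sub_mul]
        exact mul_nonneg (by linarith [hist σ hσ.1 hσ.2]) (Real.exp_pos σ).le
  have hle := hmono ⟨le_rfl, hs⟩ ⟨hs, le_rfl⟩ hs
  have hforce : 0 ≤ 2 * lam / x s * (warp x s * Real.exp s - warpMass P s) :=
    mul_nonneg (by positivity) (by rw [heq, warpMass]; linarith)
  have hrate : ratioRate lam x P s < 0 := by rw [ratioRate]; linarith
  exact mul_neg_of_pos_of_neg (mul_pos (warp_pos hx) (sub_pos.2 (warp_lt_one hx))) hrate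

theorem exists_x_le (h : IsLogSoliton lam s₀ x P t) (hlam : 0 < lam)
    (hP : ∀ s, s₀ ≤ s → P s ≤ 0) (hε : 0 < ε) (hw : ∀ s, s₀ ≤ s → ε ≤ warp x s) :
    ∃ M, 0 < M ∧ ∀ s, s₀ ≤ s → x s ≤ M := by
  set M := max (x s₀) (3 / (lam * ε) + 1)
  have hMge : 3 / (lam * ε) + 1 ≤ M := le_max_right _ _
  have hquot : 0 < 3 / (lam * ε) := by positivity
  have hM0 : 0 < M := by linarith
  have hMsq : 3 < lam * ε * M ^ 2 := by
    rw [← div_lt_iff₀' (by positivity)]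
    exact lt_of_lt_of_le (by linarith) (le_self_pow₀ (by linarith : 1 ≤ M) two_ne_zero)
  refine ⟨M, hM0, image_le_of_deriv_neg_of_eq h.deriv_x (le_max_left _ _) fun s hs _ heq => ?_⟩
  have hforce : lam / 3 * (P s - warp x s * x s ^ 3) ≤ lam / 3 * (0 - ε * x s ^ 3) := by
    have := h.x_pos s hs
    gcongr
    exacts [hP s hs, hw s hs]
  have hdamp : 0 ≤ 2 * (1 - warp x s) * x s :=
    mul_nonneg (by linarith [warp_lt_one (h.x_pos s hs)]) (h.x_pos s hs).le
  rw [heq] at hforce hdamp ⊢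
  have : M * 3 < M * (lam * ε * M ^ 2) := by gcongr
  linarith

theorem one_sub_warp_le_of_x_le (hx : 0 < x s) (hM : x s ≤ M) :
    1 - warp x s ≤ M ^ 3 / 2 * Real.exp (-s) := by
  refine (one_sub_warp_le hx).trans ?_
  rw [Real.exp_neg, ← div_eq_mul_inv, div_div]
  gcongr

theorem tendsto_warp_one (h : IsLogSoliton lam s₀ x P t) (hM : ∀ s, s₀ ≤ s → x s ≤ M) :
    Tendsto (warp x) atTop (𝓝 1) := by
  have hlow : Tendsto (fun s => 1 - M ^ 3 / 2 * Real.exp (-s)) atTop (𝓝 1) := by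
    simpa using (Real.tendsto_exp_neg_atTop_nhds_zero.const_mul (M ^ 3 / 2)).const_sub 1
  refine tendsto_of_tendsto_of_tendsto_of_le_of_le' hlow tendsto_const_nhds ?_ ?_ <;>
    filter_upwards [eventually_ge_atTop s₀] with s hs
  · linarith [one_sub_warp_le_of_x_le (h.x_pos s hs) (hM s hs)]
  · exact (warp_lt_one (h.x_pos s hs)).le

theorem abs_deriv_x_le (h : IsLogSoliton lam s₀ x P t) (hlam : 0 < lam)
    (hP : ∀ s, s₀ ≤ s → P s ≤ 0) (hM : ∀ s, s₀ ≤ s → x s ≤ M) (hs : s₀ ≤ s) :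
    |x s - 2 * (1 - warp x s) * x s + lam / 3 * (P s - warp x s * x s ^ 3)| ≤
      M + lam / 3 * (|P s₀| + M ^ 3) := by
  have hx := h.x_pos s hs
  have hw := warp_pos hx
  have hw1 := warp_lt_one hx
  have hlin : |x s - 2 * (1 - warp x s) * x s| ≤ 1 * M := by
    rw [show x s - 2 * (1 - warp x s) * x s = (2 * warp x s - 1) * x s by ring, abs_mul,
      abs_of_pos hx]
    gcongr
    exacts [abs_le.2 ⟨by linarith, by linarith⟩, hM s hs]
  have hPle : |P s| ≤ |P s₀| := by
    rw [abs_of_nonpos (hP s hs), abs_of_nonpos (hP s₀ le_rfl)]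
    exact neg_le_neg (h.monotoneOn_P Set.self_mem_Ici hs hs)
  have hcube : |warp x s * x s ^ 3| ≤ 1 * M ^ 3 := by
    rw [abs_of_pos (by positivity)]
    gcongr
    exact hM s hs
  rw [one_mul] at hlin hcube
  refine (abs_add_le _ _).trans (add_le_add hlin ?_)
  rw [abs_mul, abs_of_pos (by positivity : 0 < lam / 3)]
  gcongr
  exact (abs_sub _ _).trans (add_le_add hPle hcube)

theorem tendsto_x_zero (h : IsLogSoliton lam s₀ x P t) (hlam : 0 < lam)
    (hP : ∀ s, s₀ ≤ s → P s ≤ 0) (hε : 0 < ε) (hw : ∀ s, s₀ ≤ s → ε ≤ warp x s)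
    (hM : ∀ s, s₀ ≤ s → x s ≤ M) : Tendsto x atTop (𝓝 0) := by
  obtain ⟨L, hL, -⟩ := exists_tendsto_of_monotoneOn_Ici h.monotoneOn_P hP
  refine tendsto_zero_of_deriv_ge_of_tendsto h.deriv_P hL h.deriv_x
    (fun s hs => h.abs_deriv_x_le hlam hP hM hs) fun e he => ⟨ε * e ^ 3, by positivity, ?_⟩
  filter_upwards [eventually_ge_atTop s₀] with s hs hge
  rw [abs_of_pos (h.x_pos s hs)] at hge
  have := warp_pos (h.x_pos s hs)
  gcongr
  exact hw s hs

theorem tendsto_P_zero (h : IsLogSoliton lam s₀ x P t) (hlam : 0 < lam)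
    (hP : ∀ s, s₀ ≤ s → P s ≤ 0) (hx0 : Tendsto x atTop (𝓝 0))
    (hw1 : Tendsto (warp x) atTop (𝓝 1)) : Tendsto P atTop (𝓝 0) := by
  obtain ⟨L, hL, -⟩ := exists_tendsto_of_monotoneOn_Ici h.monotoneOn_P hP
  have hderiv : Tendsto (fun s => x s - 2 * (1 - warp x s) * x s +
      lam / 3 * (P s - warp x s * x s ^ 3)) atTop (𝓝 (lam / 3 * L)) := by
    simpa using (hx0.sub (((hw1.const_sub 1).const_mul 2).mul hx0)).add
      ((hL.sub (hw1.mul (hx0.pow 3))).const_mul (lam / 3))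
  have hzero : lam / 3 * L = 0 := eq_zero_of_tendsto_deriv h.deriv_x hx0 hderiv
  obtain rfl : L = 0 := by
    simpa [hlam.ne'] using hzero
  exact hL

theorem hasDerivAt_x_add_P (h : IsLogSoliton lam s₀ x P t) (hs : s₀ ≤ s) :
    HasDerivAt (fun s => x s + lam / 3 * P s)
      (x s + lam / 3 * P s - 2 * (1 - warp x s) * x s) s := by
  refine ((h.deriv_x s hs).fun_add ((h.deriv_P s hs).const_mul (lam / 3))).congr_deriv ?_
  ring

theorem hasDerivAt_x_add_P_mul_exp_neg (h : IsLogSoliton lam s₀ x P t) (hs : s₀ ≤ s) :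
    HasDerivAt (fun s => (x s + lam / 3 * P s) * Real.exp (-s))
      (-(2 * (1 - warp x s) * (x s * Real.exp (-s)))) s :=
  ((h.hasDerivAt_x_add_P hs).fun_mul (hasDerivAt_neg s).exp).congr_deriv (by ring)

theorem deriv_x_add_P_mul_exp_neg_nonpos (hx : 0 < x s) :
    -(2 * (1 - warp x s) * (x s * Real.exp (-s))) ≤ 0 := by
  have : 0 < 1 - warp x s := sub_pos.2 (warp_lt_one hx)
  exact neg_nonpos.2 (by positivity)

theorem x_add_P_nonneg (h : IsLogSoliton lam s₀ x P t)
    (hlim : Tendsto (fun s => (x s + lam / 3 * P s) * Real.exp (-s)) atTop (𝓝 0)) (hs : s₀ ≤ s) :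
    0 ≤ x s + lam / 3 * P s :=
  nonneg_of_mul_nonneg_left (nonneg_of_hasDerivAt_nonpos_of_tendsto_zero
    (fun _ hs => h.hasDerivAt_x_add_P_mul_exp_neg hs)
    (fun s hs => deriv_x_add_P_mul_exp_neg_nonpos (h.x_pos s hs)) hlim hs) (Real.exp_pos _)

theorem x_add_P_le (h : IsLogSoliton lam s₀ x P t) (hlam : 0 < lam)
    (hM0 : 0 < M) (hM : ∀ s, s₀ ≤ s → x s ≤ M) (hlate : ∀ s, s₀ ≤ s → M ^ 3 * Real.exp (-s) ≤ 1)
    (hx0 : Tendsto x atTop (𝓝 0)) (hlim : Tendsto (fun s => x s + lam / 3 * P s) atTop (𝓝 0))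
    (hs : s₀ ≤ s) : x s + lam / 3 * P s ≤ M ^ 3 * Real.exp (-s) * x s := by
  have hderiv : ∀ s, s₀ ≤ s → HasDerivAt
      (fun s => M ^ 3 * Real.exp (-s) * x s - (x s + lam / 3 * P s))
      (M ^ 3 * Real.exp (-s) * (lam / 3 * P s - 2 * (1 - warp x s) * x s -
        lam / 3 * (warp x s * x s ^ 3)) -
          (x s + lam / 3 * P s - 2 * (1 - warp x s) * x s)) s := fun s hs =>
    ((((hasDerivAt_neg s).exp.const_mul (M ^ 3)).fun_mul (h.deriv_x s hs)).fun_sub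
      (h.hasDerivAt_x_add_P hs)).congr_deriv (by ring)
  have hnonneg := nonneg_of_hasDerivAt_nonpos_of_tendsto_zero hderiv (fun s hs => ?_)
    (by simpa using ((Real.tendsto_exp_neg_atTop_nhds_zero.const_mul (M ^ 3)).mul hx0).sub hlim) hs
  · linarith
  have hx := h.x_pos s hs
  have hwp := warp_pos hx
  have hgap : 0 < 1 - warp x s := sub_pos.2 (warp_lt_one hx)
  have hw := h.x_add_P_nonneg (by simpa using hlim.mul Real.tendsto_exp_neg_atTop_nhds_zero) hs
  have hgap_le : 2 * (1 - warp x s) * x s ≤ M ^ 3 * Real.exp (-s) * x s :=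
    mul_le_mul_of_nonneg_right (by linarith [one_sub_warp_le_of_x_le hx (hM s hs)]) hx.le
  have : 0 ≤ M ^ 3 * Real.exp (-s) := by positivity
  have hdrop : M ^ 3 * Real.exp (-s) * (lam / 3 * P s - 2 * (1 - warp x s) * x s -
      lam / 3 * (warp x s * x s ^ 3)) ≤ M ^ 3 * Real.exp (-s) * (lam / 3 * P s) := by
    gcongr
    have h1 : 0 ≤ 2 * (1 - warp x s) * x s := by positivity
    have h2 : 0 ≤ lam / 3 * (warp x s * x s ^ 3) := by positivity
    linarith
  nlinarith [mul_le_mul_of_nonneg_right (hlate s hs) hw]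

theorem tendsto_x_div_P (h : IsLogSoliton lam s₀ x P t) (hlam : 0 < lam) (hM0 : 0 < M)
    (hM : ∀ s, s₀ ≤ s → x s ≤ M) (hx0 : Tendsto x atTop (𝓝 0)) (hP0 : Tendsto P atTop (𝓝 0)) :
    Tendsto (fun s => x s / P s) atTop (𝓝 (-(lam / 3))) := by
  have hK : Tendsto (fun s => M ^ 3 * Real.exp (-s)) atTop (𝓝 0) := by
    simpa using Real.tendsto_exp_neg_atTop_nhds_zero.const_mul (M ^ 3)
  have hlim : Tendsto (fun s => x s + lam / 3 * P s) atTop (𝓝 0) := by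
    simpa using hx0.add (hP0.const_mul (lam / 3))
  obtain ⟨s₁, hs₁⟩ := eventually_atTop.1
    ((eventually_ge_atTop s₀).and (hK.eventually (ge_mem_nhds one_pos)))
  have h₁ := h.mono (hs₁ s₁ le_rfl).1
  have hdefect : Tendsto (fun s => (x s + lam / 3 * P s) / x s) atTop (𝓝 0) := by
    refine tendsto_of_tendsto_of_tendsto_of_le_of_le' tendsto_const_nhds hK ?_ ?_ <;>
      filter_upwards [eventually_ge_atTop s₁] with s hs
    · exact div_nonneg (h₁.x_add_P_nonneg
        (by simpa using hlim.mul Real.tendsto_exp_neg_atTop_nhds_zero) hs) (h₁.x_pos s hs).le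
    · rw [div_le_iff₀ (h₁.x_pos s hs)]
      exact h₁.x_add_P_le hlam hM0 (fun s hs => hM s (hs₁ s hs).1) (fun s hs => (hs₁ s hs).2)
        hx0 hlim hs
  have hquot : Tendsto (fun s => (3 / lam * ((x s + lam / 3 * P s) / x s - 1))⁻¹) atTop
      (𝓝 (-(lam / 3))) := by
    have hinv := ((hdefect.sub_const 1).const_mul (3 / lam)).inv₀ (by simp [hlam.ne'])
    rwa [zero_sub, mul_neg_one, inv_neg, inv_div] at hinv
  refine hquot.congr' ?_
  filter_upwards [eventually_ge_atTop s₁] with s hs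
  have := (h₁.x_pos s hs).ne'
  have : 3 / lam * ((x s + lam / 3 * P s) / x s - 1) = P s / x s := by field_simp; ring
  rw [this, inv_div]

/-- `-1 / P` has derivative `(x / P)² t'`, so it is comparable to `t`. -/
theorem tendsto_mul_P (h : IsLogSoliton lam s₀ x P t) (hlam : 0 < lam)
    (hP0 : Tendsto P atTop (𝓝 0)) (hquot : Tendsto (fun s => x s / P s) atTop (𝓝 (-(lam / 3)))) :
    Tendsto t atTop atTop ∧ Tendsto (fun s => t s * P s) atTop (𝓝 (-(9 / lam ^ 2))) := by
  obtain ⟨s₁, hs₁⟩ := eventually_atTop.1 ((eventually_ge_atTop s₀).and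
    (hquot.eventually (gt_mem_nhds (by linarith : -(lam / 3) < 0))))
  have hneg : ∀ s, s₁ ≤ s → P s < 0 := fun s hs =>
    (div_neg_iff.1 (hs₁ s hs).2).resolve_right
      (fun hcon => (h.x_pos s (hs₁ s hs).1).not_gt hcon.1) |>.2
  have hspeed : ∀ s, s₁ ≤ s → 0 < warp x s * x s := fun s hs =>
    mul_pos (warp_pos (h.x_pos s (hs₁ s hs).1)) (h.x_pos s (hs₁ s hs).1)
  have hderiv : ∀ s, s₁ ≤ s →
      HasDerivAt (fun s => -(P s)⁻¹) ((x s / P s) ^ 2 * (warp x s * x s)) s := fun s hs =>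
    ((h.deriv_P s (hs₁ s hs).1).fun_inv (hneg s hs).ne).fun_neg.congr_deriv (by ring)
  have htop : Tendsto (fun s => -(P s)⁻¹) atTop atTop := by
    refine tendsto_neg_atBot_atTop.comp (tendsto_nhdsWithin_iff.2
      ⟨hP0, eventually_atTop.2 ⟨s₁, hneg⟩⟩).inv_tendsto_nhdsLT_zero
  have hlim : Tendsto (fun s => t s / -(P s)⁻¹) atTop (𝓝 (9 / lam ^ 2)) := by
    refine tendsto_div_of_tendsto_deriv_div (fun s hs => h.deriv_t s (hs₁ s hs).1) hderiv
      (fun s hs => mul_pos (sq_pos_of_neg (hs₁ s hs).2) (hspeed s hs)) htop ?_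
    have hinv := (hquot.pow 2).inv₀ (by have := hlam.ne'; simp [this])
    rw [show ((-(lam / 3)) ^ 2)⁻¹ = 9 / lam ^ 2 by rw [neg_sq, div_pow, inv_div]; norm_num] at hinv
    refine hinv.congr' ?_
    filter_upwards [eventually_ge_atTop s₁] with s hs
    rw [div_mul_cancel_right₀ (hspeed s hs).ne']
  constructor
  · refine (htop.atTop_mul_pos (by positivity) hlim).congr' ?_
    filter_upwards [eventually_ge_atTop s₁] with s hs
    exact mul_div_cancel₀ _ (neg_ne_zero.2 (inv_ne_zero (hneg s hs).ne))
  · refine hlim.neg.congr fun s => ?_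
    rw [div_neg, neg_neg, div_inv_eq_mul]

theorem tendsto_div_sq (h : IsLogSoliton lam s₀ x P t) (hlam : 0 < lam)
    (hw1 : Tendsto (warp x) atTop (𝓝 1)) (ht : Tendsto t atTop atTop)
    (htx : Tendsto (fun s => t s * x s) atTop (𝓝 (3 / lam))) :
    Tendsto (fun s => s / t s ^ 2) atTop (𝓝 (lam / 6)) := by
  obtain ⟨s₁, hs₁⟩ := eventually_atTop.1 ((eventually_ge_atTop s₀).and (ht.eventually_gt_atTop 0))
  have hderiv : ∀ s, s₁ ≤ s →
      HasDerivAt (fun s => t s ^ 2) (2 * warp x s * (t s * x s)) s := fun s hs =>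
    ((h.deriv_t s (hs₁ s hs).1).fun_pow 2).congr_deriv (by push_cast; ring)
  refine tendsto_div_of_tendsto_deriv_div (fun s _ => hasDerivAt_id s) hderiv (fun s hs => ?_)
    ((tendsto_pow_atTop two_ne_zero).comp ht) ?_
  · have hx := h.x_pos s (hs₁ s hs).1
    have := warp_pos hx
    have := (hs₁ s hs).2
    positivity
  · have hinv := ((hw1.const_mul 2).mul htx).inv₀ (by positivity)
    rw [show (2 * 1 * (3 / lam))⁻¹ = lam / 6 by field_simp; norm_num] at hinv
    simpa only [one_div] using hinv

theorem expander_asymptotics (h : IsLogSoliton lam s₀ x P t) (hlam : 0 < lam)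
    (hP : ∀ s, s₀ ≤ s → P s ≤ 0) (hε : 0 < ε) (hw : ∀ s, s₀ ≤ s → ε ≤ warp x s) :
    Tendsto t atTop atTop ∧ Tendsto (fun s => Real.exp s / x s ^ 3) atTop atTop ∧
      Tendsto (fun s => t s * x s) atTop (𝓝 (3 / lam)) ∧
      Tendsto (fun s => s / t s ^ 2) atTop (𝓝 (lam / 6)) ∧ Tendsto x atTop (𝓝 0) := by
  obtain ⟨M, hM0, hM⟩ := h.exists_x_le hlam hP hε hw
  have hw1 := h.tendsto_warp_one hM
  have hx0 := h.tendsto_x_zero hlam hP hε hw hM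
  have hP0 := h.tendsto_P_zero hlam hP hx0 hw1
  have hquot := h.tendsto_x_div_P hlam hM0 hM hx0 hP0
  obtain ⟨ht, htP⟩ := h.tendsto_mul_P hlam hP0 hquot
  have htx : Tendsto (fun s => t s * x s) atTop (𝓝 (3 / lam)) := by
    have hmul := htP.mul hquot
    rw [show -(9 / lam ^ 2) * -(lam / 3) = 3 / lam by field_simp; norm_num] at hmul
    refine hmul.congr' ?_
    filter_upwards [hquot.eventually_ne (by simp [hlam.ne'] : -(lam / 3) ≠ 0)] with s hs
    rw [mul_assoc, mul_div_cancel₀ _ (div_ne_zero_iff.1 hs).2]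
  refine ⟨ht, ?_, htx, h.tendsto_div_sq hlam hw1 ht htx, hx0⟩
  refine tendsto_atTop_mono' _ ?_ (Real.tendsto_exp_atTop.atTop_div_const (pow_pos hM0 3))
  filter_upwards [eventually_ge_atTop s₀] with s hs
  have := h.x_pos s hs
  gcongr
  exact hM s hs

end IsLogSoliton

/-! ### The planar system of collapsing shrinkers -/

/-- The right-hand side of the equation for `a` in `IsCollapsing`. -/
noncomputable def collapseField (a n z : ℝ) : ℝ :=
  9 / 2 * n * (1 - z) ^ 2 * a - 6 * z * (1 - z) * a - (a + 1 / 3) * (a + 4 / 3 - 2 * z)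

/-- The system satisfied on a shrinker end with `r = y² / x² → 0`, in logarithmic volume time, by
`a = -(log r)' / 3`, the multiple `n` of `y⁴ / x²` that tends to `1`, and `z = warp x`. It tends to
an autonomous system for `(a, n)` as `z → 0`. -/
structure IsCollapsing (s₀ : ℝ) (a n z : ℝ → ℝ) : Prop where
  a_pos : ∀ s, s₀ ≤ s → 0 < a s
  n_pos : ∀ s, s₀ ≤ s → 0 < n s
  z_pos : ∀ s, s₀ ≤ s → 0 < z s
  z_le : ∀ s, s₀ ≤ s → z s ≤ 1 / 36
  z_lim : Tendsto z atTop (𝓝 0)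
  deriv_a : ∀ s, s₀ ≤ s → HasDerivAt a (collapseField (a s) (n s) (z s)) s
  deriv_n : ∀ s, s₀ ≤ s → HasDerivAt n (n s * (2 / 3 - 4 * a s)) s
  deriv_z : ∀ s, s₀ ≤ s → HasDerivAt z (-3 * a s * (z s * (1 - z s))) s

section CollapseField

variable {a n z A N : ℝ}

theorem collapseField_le (ha : 0 < a) (hn : n ≤ 1 / 3) (hz : 0 < z) (hz' : z ≤ 1 / 36) :
    collapseField a n z ≤ -(5 / 12) := by
  have hgrowth : 9 / 2 * n * (1 - z) ^ 2 * a ≤ 9 / 2 * (1 / 3) * 1 * a := by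
    gcongr
    exact pow_le_one₀ (by linarith) (by linarith)
  have hdamp : 0 ≤ 6 * z * (1 - z) * a := by
    have : 0 ≤ 1 - z := by linarith
    positivity
  have hza : z * a ≤ 1 / 36 * a := by gcongr
  unfold collapseField
  nlinarith [sq_nonneg a]

theorem collapseField_ge (ha : 0 < a) (ha' : a < 1 / 6) (hn : 8 ≤ n) (hz : 0 < z)
    (hz' : z ≤ 1 / 36) : 3 * (n * a) - 3 / 4 ≤ collapseField a n z := by
  have hgrowth : n * a * (35 / 36) ^ 2 ≤ n * a * (1 - z) ^ 2 := by
    gcongr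
    linarith
  have hdamp : 6 * z * (1 - z) * a ≤ 1 / 6 * a := by
    gcongr
    nlinarith
  have hquad : (a + 1 / 3) * (a + 4 / 3 - 2 * z) ≤ 1 / 2 * (3 / 2) := by
    apply mul_le_mul <;> linarith
  have hna : 8 * a ≤ n * a := by gcongr
  unfold collapseField
  nlinarith

theorem abs_collapseField_le (ha : 0 < a) (hn : 0 < n) (hz : 0 < z) (hz' : z ≤ 1 / 36)
    (hA : a ≤ A) (hN : n ≤ N) :
    |collapseField a n z| ≤ 9 / 2 * N * A + A + (A + 1 / 3) * (A + 4 / 3) := by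
  have : 0 < A := ha.trans_le hA
  have : 0 < N := hn.trans_le hN
  have hgap : 0 < 1 - z := by linarith
  have hgrowth : 9 / 2 * n * (1 - z) ^ 2 * a ≤ 9 / 2 * N * 1 * A := by
    gcongr
    exact pow_le_one₀ (by linarith) (by linarith)
  have hdamp : 6 * z * (1 - z) * a ≤ 1 * A := by
    gcongr
    nlinarith
  have hquad : (a + 1 / 3) * (a + 4 / 3 - 2 * z) ≤ (A + 1 / 3) * (A + 4 / 3) := by
    apply mul_le_mul <;> linarith
  have hquad0 : 0 ≤ (a + 1 / 3) * (a + 4 / 3 - 2 * z) := by apply mul_nonneg <;> linarith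
  have : 0 ≤ 9 / 2 * n * (1 - z) ^ 2 * a := by positivity
  have : 0 ≤ 6 * z * (1 - z) * a := by positivity
  unfold collapseField
  rw [abs_le]
  constructor <;> linarith

end CollapseField

/-- The convex function `m - 1 - log m` of `m > 0`, with minimum `0` at `m = 1`. -/
noncomputable def logGap (m : ℝ) : ℝ := m - 1 - Real.log m

section LogGap

variable {m K : ℝ}

theorem logGap_nonneg (hm : 0 < m) : 0 ≤ logGap m := by
  unfold logGap; linarith [Real.log_le_sub_one_of_pos hm]

theorem logGap_one : logGap 1 = 0 := by simp [logGap]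

theorem le_of_logGap_le (hm : 0 < m) (h : logGap m ≤ K) : m ≤ 2 * K + 2 := by
  have hhalf := Real.log_le_sub_one_of_pos (half_pos hm)
  rw [Real.log_div hm.ne' two_ne_zero] at hhalf
  unfold logGap at h
  linarith [Real.log_two_lt_d9]

theorem exp_le_of_logGap_le (hm : 0 < m) (h : logGap m ≤ K) : Real.exp (-(K + 1)) ≤ m := by
  unfold logGap at h
  rw [← Real.le_log_iff_exp_le hm]
  linarith

theorem logGap_lt (hm : 1 / 4 ≤ m) (hm' : m ≤ 1) : logGap m < 2 / 3 := by
  have hm0 : 0 < m := by linarith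
  have hlog : Real.log (4 * m) = 2 * Real.log 2 + Real.log m := by
    rw [Real.log_mul four_ne_zero hm0.ne', show (4 : ℝ) = 2 ^ 2 by norm_num, Real.log_pow]
    push_cast; ring
  have hinv := Real.one_sub_inv_le_log_of_pos (show 0 < 4 * m by linarith)
  have hsum : m + (4 * m)⁻¹ ≤ 5 / 4 := by
    have hfac : 5 / 4 - (m + (4 * m)⁻¹) = (1 - m) * (4 * m - 1) / (4 * m) := by field_simp; ring
    rw [← sub_nonneg, hfac]
    apply div_nonneg (mul_nonneg _ _) <;> linarith
  unfold logGap
  linarith [Real.log_two_lt_d9]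

theorem le_of_le_logGap (hm : 1 / 4 ≤ m) (h : 2 / 3 ≤ logGap m) : 5 / 3 ≤ m := by
  have hm1 : 1 < m := by
    by_contra! hle
    exact (logGap_lt hm hle).not_ge h
  unfold logGap at h
  linarith [Real.log_pos hm1]

theorem hasDerivAt_logGap (hm : m ≠ 0) : HasDerivAt logGap (1 - m⁻¹) m :=
  ((hasDerivAt_id m).sub_const 1).fun_sub (Real.hasDerivAt_log hm)

end LogGap

/-- A Lyapunov function of the limiting planar system, with minimum `0` at the equilibrium
`a = 1 / 6`, `n = 1`. It increases, since the equilibrium is a source. -/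
noncomputable def collapseEnergy (a n : ℝ) : ℝ := 9 / 2 * logGap n + 2 / 3 * logGap (6 * a)

/-- The derivative of `collapseEnergy` along `IsCollapsing`. -/
noncomputable def collapseEnergyRate (a n z : ℝ) : ℝ :=
  9 / 2 * ((1 - n⁻¹) * (n * (2 / 3 - 4 * a))) +
    2 / 3 * ((1 - (6 * a)⁻¹) * (6 * collapseField a n z))

section CollapseEnergy

variable {a n z : ℝ}

theorem collapseEnergy_bounds (ha : 0 < a) (hn : 0 < n) (h : collapseEnergy a n ≤ 4) :
    n ≤ 4 ∧ a ≤ 7 / 3 ∧ Real.exp (-7) / 6 ≤ a := by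
  have ha6 : 0 < 6 * a := by positivity
  have hgap_n := logGap_nonneg hn
  have hgap_a := logGap_nonneg ha6
  unfold collapseEnergy at h
  have hn_le := le_of_logGap_le hn (show logGap n ≤ 1 by linarith)
  have hgap_a' : logGap (6 * a) ≤ 6 := by linarith
  have ha_le := le_of_logGap_le ha6 hgap_a'
  have ha_ge := exp_le_of_logGap_le ha6 hgap_a'
  norm_num at ha_ge
  exact ⟨by linarith, by linarith, by linarith⟩

theorem collapseEnergyRate_eq (ha : 0 < a) (hn : 0 < n) : collapseEnergyRate a n z =
    4 * (a - 1 / 6) ^ 2 * (8 / 3 - a) / a +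
      4 * (a - 1 / 6) * (z * (-(9 / 2 * n * (2 - z)) + 2 + 2 / (3 * a) - 6 * (1 - z))) := by
  unfold collapseEnergyRate collapseField
  field_simp
  ring

/-- The terms of order `z` in the derivative of the energy are absorbed by a multiple of `-z'`. -/
theorem exists_collapseEnergyRate_ge : ∃ C : ℝ, 0 ≤ C ∧ ∀ a n z : ℝ, 0 < a → 0 < n → 0 < z →
    z ≤ 1 / 36 → collapseEnergy a n ≤ 4 →
      (a - 1 / 6) ^ 2 / 2 + z ≤ collapseEnergyRate a n z - C * (-3 * a * (z * (1 - z))) := by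
  set a₀ := Real.exp (-7) / 6
  have ha₀ : 0 < a₀ := by positivity
  set E := 46 + 2 / (3 * a₀)
  have hE : 0 < E := by positivity
  refine ⟨(10 * E + 1) / a₀, by positivity, fun a n z ha hn hz hz' hen => ?_⟩
  obtain ⟨hn4, ha73, haa₀⟩ := collapseEnergy_bounds ha hn hen
  have hdefect : |-(9 / 2 * n * (2 - z)) + 2 + 2 / (3 * a) - 6 * (1 - z)| ≤ E := by
    have hinv : 2 / (3 * a) ≤ 2 / (3 * a₀) := by gcongr
    have hinv0 : 0 < 2 / (3 * a) := by positivity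
    rw [abs_le]
    constructor <;> nlinarith [mul_pos hn hz]
  rw [collapseEnergyRate_eq ha hn]
  generalize -(9 / 2 * n * (2 - z)) + 2 + 2 / (3 * a) - 6 * (1 - z) = e at hdefect ⊢
  have hlinear : |4 * (a - 1 / 6) * (z * e)| ≤ 10 * E * z := by
    rw [abs_mul, abs_mul, abs_mul, abs_of_pos hz, abs_of_pos four_pos]
    calc 4 * |a - 1 / 6| * (z * |e|) ≤ 4 * (5 / 2) * (z * E) := by
          gcongr
          exact abs_le.2 ⟨by linarith, by linarith⟩
      _ = 10 * E * z := by ring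
  have hmain : (a - 1 / 6) ^ 2 / 2 ≤ 4 * (a - 1 / 6) ^ 2 * (8 / 3 - a) / a := by
    rw [le_div_iff₀ ha]
    nlinarith [sq_nonneg (a - 1 / 6)]
  have habsorb : (10 * E + 1) * z ≤ (10 * E + 1) / a₀ * a * z := by
    gcongr
    rw [div_mul_eq_mul_div, le_div_iff₀ ha₀]
    gcongr
  have : 0 < (10 * E + 1) / a₀ * a * z := by positivity
  have := neg_abs_le (4 * (a - 1 / 6) * (z * e))
  nlinarith

end CollapseEnergy

theorem exp_four_div_fifteen_le : Real.exp (4 / 15) ≤ 4 / 3 := by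
  have hexp : Real.exp (2 / 15) ≤ 1 / (1 - 2 / 15) :=
    Real.exp_bound_div_one_sub_of_interval (by norm_num) (by norm_num)
  calc Real.exp (4 / 15) = Real.exp (2 / 15) ^ 2 := by rw [← Real.exp_nat_mul]; norm_num
    _ ≤ (1 / (1 - 2 / 15)) ^ 2 := by gcongr
    _ ≤ 4 / 3 := by norm_num

namespace IsCollapsing

variable {s₀ s A N C : ℝ} {a n z : ℝ → ℝ}

theorem mono (h : IsCollapsing s₀ a n z) {s₁ : ℝ} (hs : s₀ ≤ s₁) : IsCollapsing s₁ a n z where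
  a_pos s h1 := h.a_pos s (hs.trans h1)
  n_pos s h1 := h.n_pos s (hs.trans h1)
  z_pos s h1 := h.z_pos s (hs.trans h1)
  z_le s h1 := h.z_le s (hs.trans h1)
  z_lim := h.z_lim
  deriv_a s h1 := h.deriv_a s (hs.trans h1)
  deriv_n s h1 := h.deriv_n s (hs.trans h1)
  deriv_z s h1 := h.deriv_z s (hs.trans h1)

theorem not_forall_n_le (h : IsCollapsing s₀ a n z) : ¬ ∀ s, s₀ ≤ s → n s ≤ 1 / 3 := by
  intro hn
  have htop : Tendsto (fun s => -a s) atTop atTop :=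
    tendsto_atTop_of_le_hasDerivAt (by norm_num : (0 : ℝ) < 5 / 12)
      (fun s hs => (h.deriv_a s hs).neg) fun s hs => le_neg.1 <|
        collapseField_le (h.a_pos s hs) (hn s hs) (h.z_pos s hs) (h.z_le s hs)
  obtain ⟨s, hpos, hs⟩ := ((htop.eventually_gt_atTop 0).and (eventually_ge_atTop s₀)).exists
  linarith [h.a_pos s hs]

/-- While `n ≤ 1 / 3`, the quantity `n exp (8 a / 5)` decreases. -/
theorem n_mul_exp_le (h : IsCollapsing s₀ a n z) (h₀ : n s₀ * Real.exp (8 / 5 * a s₀) ≤ 1 / 3) :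
    ∀ s, s₀ ≤ s → n s * Real.exp (8 / 5 * a s) ≤ 1 / 3 := by
  have hderiv : ∀ s, s₀ ≤ s → HasDerivAt (fun s => n s * Real.exp (8 / 5 * a s))
      (n s * Real.exp (8 / 5 * a s) *
        (2 / 3 - 4 * a s + 8 / 5 * collapseField (a s) (n s) (z s))) s := fun s hs =>
    ((h.deriv_n s hs).fun_mul ((h.deriv_a s hs).const_mul (8 / 5)).exp).congr_deriv (by ring)
  refine image_le_of_deriv_neg_of_eq hderiv h₀ fun s hs _ heq => ?_
  have ha := h.a_pos s hs
  have hn := h.n_pos s hs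
  have hn3 : n s ≤ 1 / 3 :=
    heq ▸ le_mul_of_one_le_right hn.le (Real.one_le_exp (by positivity))
  have := collapseField_le ha hn3 (h.z_pos s hs) (h.z_le s hs)
  exact mul_neg_of_pos_of_neg (by positivity) (by linarith)

theorem n_ge (h : IsCollapsing s₀ a n z) (hs : s₀ ≤ s) (ha : a s ≤ 1 / 6) : 1 / 4 ≤ n s := by
  by_contra! hlt
  have h₀ : n s * Real.exp (8 / 5 * a s) ≤ 1 / 3 := by
    have := h.n_pos s hs
    calc n s * Real.exp (8 / 5 * a s) ≤ 1 / 4 * Real.exp (4 / 15) := by gcongr; linarith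
      _ ≤ 1 / 4 * (4 / 3) := by gcongr; exact exp_four_div_fifteen_le
      _ = 1 / 3 := by norm_num
  refine (h.mono hs).not_forall_n_le fun σ hσ => le_trans ?_ ((h.mono hs).n_mul_exp_le h₀ σ hσ)
  have ha := h.a_pos σ (hs.trans hσ)
  exact le_mul_of_one_le_right (h.n_pos σ (hs.trans hσ)).le (Real.one_le_exp (by positivity))

theorem abs_deriv_a_le (h : IsCollapsing s₀ a n z) (hA : ∀ s, s₀ ≤ s → a s ≤ A)
    (hN : ∀ s, s₀ ≤ s → n s ≤ N) (s : ℝ) (hs : s₀ ≤ s) : |collapseField (a s) (n s) (z s)| ≤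
      9 / 2 * N * A + A + (A + 1 / 3) * (A + 4 / 3) :=
  abs_collapseField_le (h.a_pos s hs) (h.n_pos s hs) (h.z_pos s hs) (h.z_le s hs) (hA s hs)
    (hN s hs)

theorem tendsto_collapseField_sub (h : IsCollapsing s₀ a n z) (hN : ∀ s, s₀ ≤ s → n s ≤ N)
    (ha : Tendsto a atTop (𝓝 (1 / 6))) :
    Tendsto (fun s => collapseField (a s) (n s) (z s) - 3 / 4 * (n s - 1)) atTop (𝓝 0) := by
  have hz := h.z_lim
  have hgrowth : Tendsto (fun s => 9 / 2 * (1 - z s) ^ 2 * a s - 3 / 4) atTop (𝓝 0) := by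
    have hlim := ((((hz.const_sub 1).pow 2).const_mul (9 / 2)).mul ha).sub_const (3 / 4)
    norm_num at hlim
    exact hlim
  have hdamp : Tendsto (fun s => 6 * z s * (1 - z s) * a s) atTop (𝓝 0) := by
    simpa using ((hz.const_mul 6).mul (hz.const_sub 1)).mul ha
  have hquad : Tendsto (fun s => (a s + 1 / 3) * (a s + 4 / 3 - 2 * z s) - 3 / 4) atTop (𝓝 0) := by
    have hlim := ((ha.add_const (1 / 3)).mul
      ((ha.add_const (4 / 3)).sub (hz.const_mul 2))).sub_const (3 / 4)
    norm_num at hlim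
    exact hlim
  have hbdd : IsBoundedUnder (· ≤ ·) atTop fun s => ‖n s‖ := by
    refine isBoundedUnder_of_eventually_le (a := N) ?_
    filter_upwards [eventually_ge_atTop s₀] with s hs
    rw [Real.norm_eq_abs, abs_of_pos (h.n_pos s hs)]
    exact hN s hs
  have hlim := ((isBoundedUnder_le_mul_tendsto_zero hbdd hgrowth).sub hdamp).sub hquad
  simp only [sub_zero] at hlim
  refine hlim.congr fun s => ?_
  unfold collapseField
  ring

theorem tendsto_n_one (h : IsCollapsing s₀ a n z) (hA : ∀ s, s₀ ≤ s → a s ≤ A)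
    (hN : ∀ s, s₀ ≤ s → n s ≤ N) (ha : Tendsto a atTop (𝓝 (1 / 6))) :
    Tendsto n atTop (𝓝 1) := by
  have hbound : ∀ s, s₀ ≤ s →
      |3 / 4 * (n s * (2 / 3 - 4 * a s))| ≤ 3 / 4 * (N * (2 / 3 + 4 * A)) := fun s hs => by
    have hpos := h.a_pos s hs
    have hn := h.n_pos s hs
    have := hn.trans_le (hN s hs)
    rw [abs_mul, abs_mul, abs_of_pos hn, abs_of_pos (by norm_num : (0 : ℝ) < 3 / 4)]
    gcongr
    exacts [hN s hs, abs_le.2 ⟨by linarith [hA s hs], by linarith [hA s hs]⟩]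
  have hzero : Tendsto (fun s => 3 / 4 * (n s - 1)) atTop (𝓝 0) :=
    tendsto_zero_of_deriv_sub_of_tendsto h.deriv_a ha
      (fun s hs => ((h.deriv_n s hs).sub_const 1).const_mul (3 / 4)) hbound
      (h.tendsto_collapseField_sub hN ha)
  have hlim := (hzero.const_mul (4 / 3)).add_const 1
  norm_num at hlim
  exact hlim.congr fun s => by ring

theorem n_mul_a_le (h : IsCollapsing s₀ a n z) (ha : ∀ s, s₀ ≤ s → a s < 1 / 6)
    (hn : ∀ s, s₀ ≤ s → 8 ≤ n s) (hs : s₀ ≤ s) : n s * a s ≤ 1 / 3 := by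
  by_contra! hgt
  have hfield : ∀ σ, s ≤ σ →
      3 * (n σ * a σ) - 3 / 4 ≤ collapseField (a σ) (n σ) (z σ) := fun σ hσ =>
    have hσ₀ := hs.trans hσ
    collapseField_ge (h.a_pos σ hσ₀) (ha σ hσ₀) (hn σ hσ₀) (h.z_pos σ hσ₀) (h.z_le σ hσ₀)
  have hstay : ∀ σ, s ≤ σ → 1 / 3 ≤ n σ * a σ := by
    refine le_image_of_deriv_pos_of_eq
      (fun σ hσ => (h.deriv_n σ (hs.trans hσ)).fun_mul (h.deriv_a σ (hs.trans hσ))) hgt.le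
      fun σ hσ _ heq => ?_
    have hn0 := h.n_pos σ (hs.trans hσ)
    have ha0 := h.a_pos σ (hs.trans hσ)
    have : 0 < 2 / 3 - 4 * a σ := by linarith [ha σ (hs.trans hσ)]
    have : 0 < collapseField (a σ) (n σ) (z σ) := by linarith [hfield σ hσ]
    positivity
  have htop : Tendsto a atTop atTop :=
    tendsto_atTop_of_le_hasDerivAt (by norm_num : (0 : ℝ) < 1 / 4)
      (fun σ hσ => h.deriv_a σ (hs.trans hσ)) fun σ hσ => by linarith [hfield σ hσ, hstay σ hσ]
  obtain ⟨σ, hbig, hσ⟩ := ((htop.eventually_gt_atTop (1 / 6)).and (eventually_ge_atTop s)).exists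
  exact (ha σ (hs.trans hσ)).not_gt hbig

/-- Otherwise `n` grows so fast that `log z` stays bounded below: `log z - 2 / n` is increasing. -/
theorem not_forall_n_ge (h : IsCollapsing s₀ a n z) (ha : ∀ s, s₀ ≤ s → a s < 1 / 6) :
    ¬ ∀ s, s₀ ≤ s → 8 ≤ n s := by
  intro hn
  have hderiv : ∀ s, s₀ ≤ s → HasDerivAt (fun s => Real.log (z s) - 2 * (n s)⁻¹)
      ((4 / 3 - 8 * a s - 3 * (n s * a s) * (1 - z s)) / n s) s := fun s hs => by
    have hz := h.z_pos s hs
    have hn := h.n_pos s hs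
    refine (((h.deriv_z s hs).log hz.ne').fun_sub
      (((h.deriv_n s hs).fun_inv hn.ne').const_mul 2)).congr_deriv ?_
    field_simp
    ring
  have hmono := monotoneOn_of_hasDerivAt_nonneg (convex_Ici s₀) hderiv fun s hs => by
    have hz := h.z_pos s hs
    have hn0 := h.n_pos s hs
    have ha0 := h.a_pos s hs
    have hna := h.n_mul_a_le ha hn hs
    have : 8 * a s ≤ n s * a s := by gcongr; exact hn s hs
    have : 0 < n s * a s * z s := by positivity
    exact div_nonneg (by linarith) hn0.le
  have hlow : ∀ s, s₀ ≤ s → Real.exp (Real.log (z s₀) - 2 * (n s₀)⁻¹) ≤ z s := fun s hs => by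
    rw [← Real.le_log_iff_exp_le (h.z_pos s hs)]
    have hle : Real.log (z s₀) - 2 * (n s₀)⁻¹ ≤ Real.log (z s) - 2 * (n s)⁻¹ :=
      hmono Set.self_mem_Ici hs hs
    linarith [inv_pos.2 (h.n_pos s hs)]
  exact (Real.exp_pos _).not_ge (ge_of_tendsto h.z_lim ((eventually_ge_atTop s₀).mono hlow))

theorem monotoneOn_n (h : IsCollapsing s₀ a n z) (ha : ∀ s, s₀ ≤ s → a s ≤ 1 / 6) :
    MonotoneOn n (Set.Ici s₀) :=
  monotoneOn_of_hasDerivAt_nonneg (convex_Ici s₀) h.deriv_n fun s hs =>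
    mul_nonneg (h.n_pos s hs).le (by linarith [ha s hs])

theorem antitoneOn_n (h : IsCollapsing s₀ a n z) (ha : ∀ s, s₀ ≤ s → 1 / 6 ≤ a s) :
    AntitoneOn n (Set.Ici s₀) :=
  antitoneOn_of_hasDerivAt_nonpos (convex_Ici s₀) h.deriv_n fun s hs =>
    mul_nonpos_of_nonneg_of_nonpos (h.n_pos s hs).le (by linarith [ha s hs])

theorem n_le_eight (h : IsCollapsing s₀ a n z) (ha : ∀ s, s₀ ≤ s → a s < 1 / 6) (hs : s₀ ≤ s) :
    n s ≤ 8 := by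
  by_contra! hgt
  have hmono := h.monotoneOn_n fun s hs => (ha s hs).le
  exact (h.mono hs).not_forall_n_ge (fun σ hσ => ha σ (hs.trans hσ)) fun σ hσ =>
    hgt.le.trans (hmono hs (hs.trans hσ) hσ)

theorem tendsto_a_of_a_le (h : IsCollapsing s₀ a n z) (ha : ∀ s, s₀ ≤ s → a s ≤ 1 / 6)
    (hN : ∀ s, s₀ ≤ s → n s ≤ N) : Tendsto a atTop (𝓝 (1 / 6)) := by
  have hmono := h.monotoneOn_n ha
  obtain ⟨L, hL, -⟩ := exists_tendsto_of_monotoneOn_Ici hmono hN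
  refine tendsto_sub_nhds_zero_iff.1 <| tendsto_zero_of_deriv_ge_of_tendsto h.deriv_n hL
    (fun s hs => (h.deriv_a s hs).sub_const (1 / 6)) (h.abs_deriv_a_le ha hN) fun ε hε =>
      ⟨n s₀ * (4 * ε), by have := h.n_pos s₀ le_rfl; positivity, ?_⟩
  filter_upwards [eventually_ge_atTop s₀] with s hs hge
  rw [abs_of_nonpos (by linarith [ha s hs])] at hge
  exact mul_le_mul (hmono Set.self_mem_Ici hs hs) (by linarith) (by positivity) (h.n_pos s hs).le

theorem a_le_max (h : IsCollapsing s₀ a n z) (hN : ∀ s, s₀ ≤ s → n s ≤ N) :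
    ∀ s, s₀ ≤ s → a s ≤ max (a s₀) (5 * N) := by
  refine image_le_of_deriv_neg_of_eq h.deriv_a (le_max_left _ _) fun s hs _ heq => ?_
  have ha := h.a_pos s hs
  have hz := h.z_pos s hs
  have hz' := h.z_le s hs
  have hn := h.n_pos s hs
  have hn' := hN s hs
  have hN0 : 0 < N := hn.trans_le hn'
  have hgrowth : 9 / 2 * n s * (1 - z s) ^ 2 * a s ≤ 9 / 2 * N * 1 * a s := by
    gcongr
    exact pow_le_one₀ (by linarith) (by linarith)
  have hdamp : 0 ≤ 6 * z s * (1 - z s) * a s := by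
    have : 0 ≤ 1 - z s := by linarith
    positivity
  have hquad : a s * a s ≤ (a s + 1 / 3) * (a s + 4 / 3 - 2 * z s) := by
    apply mul_le_mul <;> linarith
  have hbig : 5 * N * a s ≤ a s * a s := by
    gcongr
    exact heq ▸ le_max_right _ _
  have : 0 < N * a s := by positivity
  unfold collapseField
  linarith

theorem tendsto_a_of_le_a (h : IsCollapsing s₀ a n z) (ha : ∀ s, s₀ ≤ s → 1 / 6 ≤ a s) :
    Tendsto a atTop (𝓝 (1 / 6)) := by
  have hanti := h.antitoneOn_n ha
  have hN : ∀ s, s₀ ≤ s → n s ≤ n s₀ := fun s hs => hanti Set.self_mem_Ici hs hs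
  have hlow : ∀ s, s₀ ≤ s → 1 / 3 ≤ n s := fun s hs => by
    by_contra! hlt
    exact (h.mono hs).not_forall_n_le fun σ hσ => (hanti hs (hs.trans hσ) hσ).trans hlt.le
  obtain ⟨L, hL, -⟩ := exists_tendsto_of_antitoneOn_Ici hanti hlow
  refine tendsto_sub_nhds_zero_iff.1 <| tendsto_zero_of_deriv_ge_of_tendsto
    (fun s hs => (h.deriv_n s hs).neg) hL.neg (fun s hs => (h.deriv_a s hs).sub_const (1 / 6))
    (h.abs_deriv_a_le (h.a_le_max hN) hN) fun ε hε => ⟨1 / 3 * (4 * ε), by positivity, ?_⟩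
  filter_upwards [eventually_ge_atTop s₀] with s hs hge
  rw [abs_of_nonneg (by linarith [ha s hs])] at hge
  rw [← mul_neg]
  exact mul_le_mul (hlow s hs) (by linarith) (by positivity) (h.n_pos s hs).le

theorem tendsto_collapseEnergy_zero (ha : Tendsto a atTop (𝓝 (1 / 6)))
    (hn : Tendsto n atTop (𝓝 1)) :
    Tendsto (fun s => collapseEnergy (a s) (n s)) atTop (𝓝 0) := by
  have hgap : Tendsto logGap (𝓝 1) (𝓝 0) := by
    simpa only [logGap_one] using (hasDerivAt_logGap one_ne_zero).continuousAt.tendsto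
  have ha6 : Tendsto (fun s => 6 * a s) atTop (𝓝 1) := by
    have hlim := ha.const_mul 6
    norm_num at hlim
    exact hlim
  simpa [collapseEnergy] using
    ((hgap.comp hn).const_mul (9 / 2)).add ((hgap.comp ha6).const_mul (2 / 3))

theorem hasDerivAt_collapseEnergy_sub (h : IsCollapsing s₀ a n z) (C : ℝ) (hs : s₀ ≤ s) :
    HasDerivAt (fun s => collapseEnergy (a s) (n s) - C * z s)
      (collapseEnergyRate (a s) (n s) (z s) - C * (-3 * a s * (z s * (1 - z s)))) s := by
  have ha := h.a_pos s hs
  have hgap_n := (hasDerivAt_logGap (h.n_pos s hs).ne').comp s (h.deriv_n s hs)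
  have hgap_a := (hasDerivAt_logGap (show 6 * a s ≠ 0 by positivity)).comp s
    ((h.deriv_a s hs).const_mul 6)
  exact ((hgap_n.const_mul (9 / 2)).fun_add (hgap_a.const_mul (2 / 3))).fun_sub
    ((h.deriv_z s hs).const_mul C)

theorem le_a_of_energy_ge (h : IsCollapsing s₀ a n z)
    (hen : ∀ s, s₀ ≤ s → 3 ≤ collapseEnergy (a s) (n s)) (ha : 1 / 6 ≤ a s₀) :
    ∀ s, s₀ ≤ s → 1 / 6 ≤ a s := by
  refine le_image_of_deriv_pos_of_eq h.deriv_a ha fun s hs _ heq => ?_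
  have hgap := hen s hs
  unfold collapseEnergy at hgap
  rw [heq, show (6 : ℝ) * (1 / 6) = 1 by norm_num, logGap_one] at hgap
  have hn := le_of_le_logGap (h.n_ge hs heq.le) (by linarith)
  have hz := h.z_pos s hs
  have hz' := h.z_le s hs
  have : 5 / 3 * (35 / 36 : ℝ) ^ 2 ≤ n s * (1 - z s) ^ 2 := by
    gcongr
    linarith
  unfold collapseField
  rw [heq]
  nlinarith

theorem not_forall_energy_ge (h : IsCollapsing s₀ a n z) :
    ¬ ∀ s, s₀ ≤ s → 3 ≤ collapseEnergy (a s) (n s) := by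
  intro hen
  have contra (ha : Tendsto a atTop (𝓝 (1 / 6))) (hn : Tendsto n atTop (𝓝 1)) : False := by
    have := ge_of_tendsto (tendsto_collapseEnergy_zero ha hn) ((eventually_ge_atTop s₀).mono hen)
    norm_num at this
  by_cases hup : ∃ s₁, s₀ ≤ s₁ ∧ 1 / 6 ≤ a s₁
  · obtain ⟨s₁, hs₁, ha₁⟩ := hup
    have h₁ := h.mono hs₁
    have hge := h₁.le_a_of_energy_ge (fun s hs => hen s (hs₁.trans hs)) ha₁
    have hN : ∀ s, s₁ ≤ s → n s ≤ n s₁ := fun s hs =>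
      h₁.antitoneOn_n hge Set.self_mem_Ici hs hs
    have ha := h₁.tendsto_a_of_le_a hge
    exact contra ha (h₁.tendsto_n_one (h₁.a_le_max hN) hN ha)
  · push Not at hup
    have hle : ∀ s, s₀ ≤ s → a s ≤ 1 / 6 := fun s hs => (hup s hs).le
    have ha := h.tendsto_a_of_a_le hle fun s hs => h.n_le_eight hup hs
    exact contra ha (h.tendsto_n_one hle (fun s hs => h.n_le_eight hup hs) ha)

theorem tendsto_equilibrium_of_energy_le (h : IsCollapsing s₀ a n z)
    (hrate : ∀ s, s₀ ≤ s → (a s - 1 / 6) ^ 2 / 2 + z s ≤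
      collapseEnergyRate (a s) (n s) (z s) - C * (-3 * a s * (z s * (1 - z s))))
    (hen : ∀ s, s₀ ≤ s → collapseEnergy (a s) (n s) ≤ 4)
    (henC : ∀ s, s₀ ≤ s → collapseEnergy (a s) (n s) - C * z s ≤ 3) :
    Tendsto a atTop (𝓝 (1 / 6)) ∧ Tendsto n atTop (𝓝 1) := by
  have hbounds := fun s hs => collapseEnergy_bounds (h.a_pos s hs) (h.n_pos s hs) (hen s hs)
  have hA : ∀ s, s₀ ≤ s → a s ≤ 7 / 3 := fun s hs => (hbounds s hs).2.1
  have hN : ∀ s, s₀ ≤ s → n s ≤ 4 := fun s hs => (hbounds s hs).1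
  have hmono := monotoneOn_of_hasDerivAt_nonneg (convex_Ici s₀)
    (fun s hs => h.hasDerivAt_collapseEnergy_sub C hs) fun s hs => le_trans
      (add_nonneg (by positivity) (h.z_pos s hs).le) (hrate s hs)
  obtain ⟨L, hL, -⟩ := exists_tendsto_of_monotoneOn_Ici hmono henC
  have ha : Tendsto a atTop (𝓝 (1 / 6)) := by
    refine tendsto_sub_nhds_zero_iff.1 <| tendsto_zero_of_deriv_ge_of_tendsto
      (fun s hs => h.hasDerivAt_collapseEnergy_sub C hs) hL
      (fun s hs => (h.deriv_a s hs).sub_const (1 / 6)) (h.abs_deriv_a_le hA hN)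
      fun ε hε => ⟨ε ^ 2 / 2, by positivity, ?_⟩
    filter_upwards [eventually_ge_atTop s₀] with s hs hge
    have hsq : ε ^ 2 ≤ (a s - 1 / 6) ^ 2 := by
      rw [← sq_abs (a s - 1 / 6)]
      gcongr
    linarith [hrate s hs, h.z_pos s hs]
  exact ⟨ha, h.tendsto_n_one hA hN ha⟩

theorem tendsto_equilibrium (h : IsCollapsing s₀ a n z) :
    Tendsto a atTop (𝓝 (1 / 6)) ∧ Tendsto n atTop (𝓝 1) := by
  obtain ⟨C, hC0, hC⟩ := exists_collapseEnergyRate_ge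
  have hCz : Tendsto (fun s => C * z s) atTop (𝓝 0) := by simpa using h.z_lim.const_mul C
  obtain ⟨s₁, hs₁⟩ := eventually_atTop.1
    ((eventually_ge_atTop s₀).and (hCz.eventually (ge_mem_nhds zero_lt_one)))
  replace h := h.mono (hs₁ s₁ le_rfl).1
  have hrate : ∀ s, s₁ ≤ s → collapseEnergy (a s) (n s) ≤ 4 → (a s - 1 / 6) ^ 2 / 2 + z s ≤
      collapseEnergyRate (a s) (n s) (z s) - C * (-3 * a s * (z s * (1 - z s))) := fun s hs =>
    hC _ _ _ (h.a_pos s hs) (h.n_pos s hs) (h.z_pos s hs) (h.z_le s hs)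
  have henC : ∀ s, s₁ ≤ s → collapseEnergy (a s) (n s) - C * z s ≤ 3 := fun s₂ hs₂ => by
    by_contra! hgt
    replace h := h.mono hs₂
    have hstay := le_image_of_deriv_pos_of_eq
      (fun s hs => h.hasDerivAt_collapseEnergy_sub C hs) hgt.le fun s hs _ heq =>
        (add_pos_of_nonneg_of_pos (by positivity) (h.z_pos s hs)).trans_le
          (hrate s (hs₂.trans hs) (by linarith [(hs₁ s (hs₂.trans hs)).2]))
    exact h.not_forall_energy_ge fun s hs => (hstay s hs).trans
      (sub_le_self _ (mul_nonneg hC0 (h.z_pos s hs).le))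
  have hen : ∀ s, s₁ ≤ s → collapseEnergy (a s) (n s) ≤ 4 := fun s hs => by
    linarith [henC s hs, (hs₁ s hs).2]
  exact h.tendsto_equilibrium_of_energy_le (fun s hs => hrate s hs (hen s hs)) hen henC

end IsCollapsing

namespace IsLogSoliton

variable {lam s₀ s l ε : ℝ} {x P t : ℝ → ℝ}

/-! ### Shrinkers -/

theorem x_add_P_mul_exp_neg_eq (lam : ℝ) (x P : ℝ → ℝ) (s : ℝ) :
    (x s + lam / 3 * P s) * Real.exp (-s) =
      x s * Real.exp (-s) + 2 * lam / 3 * (1 - warpMean P s) := by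
  rw [warpMean_eq]
  ring

theorem hasDerivAt_x_mul_exp_neg (h : IsLogSoliton lam s₀ x P t) (hs : s₀ ≤ s) :
    HasDerivAt (fun s => x s * Real.exp (-s))
      (2 * lam / 3 * (warp x s - warpMean P s) - 2 * (1 - warp x s) * (x s * Real.exp (-s))) s := by
  refine ((h.deriv_x s hs).fun_mul (hasDerivAt_neg s).exp).congr_deriv ?_
  have hexp : Real.exp s * Real.exp (-s) = 1 := by rw [← Real.exp_add]; simp
  rw [warp_mul_cube (h.x_pos s hs), warpMean_eq]
  linear_combination -(lam / 3 * (2 * (1 - warp x s))) * hexp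

theorem exists_abs_one_sub_warpMean_le (h : IsLogSoliton lam s₀ x P t) :
    ∃ K, ∀ s, s₀ ≤ s → |1 - warpMean P s| ≤ K := by
  obtain ⟨B, hB0, hB⟩ := h.exists_warpMean_bounds
  refine ⟨1 + B * Real.exp (-s₀), fun s hs => ?_⟩
  have hexp : B * Real.exp (-s) ≤ B * Real.exp (-s₀) := by gcongr
  have := hB s hs
  exact abs_le.2 ⟨by linarith, by linarith⟩

theorem exists_tendsto_x_add_P_mul_exp_neg (h : IsLogSoliton lam s₀ x P t) :
    ∃ L, Tendsto (fun s => (x s + lam / 3 * P s) * Real.exp (-s)) atTop (𝓝 L) := by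
  obtain ⟨K, hK⟩ := h.exists_abs_one_sub_warpMean_le
  have hanti := antitoneOn_of_hasDerivAt_nonpos (convex_Ici s₀)
    (fun _ hs => h.hasDerivAt_x_add_P_mul_exp_neg hs)
    fun s hs => deriv_x_add_P_mul_exp_neg_nonpos (h.x_pos s hs)
  obtain ⟨L, hL, -⟩ := exists_tendsto_of_antitoneOn_Ici (B := -(|2 * lam / 3| * K)) hanti
    fun s hs => by
      have := h.x_pos s hs
      have : 0 ≤ x s * Real.exp (-s) := by positivity
      have : |2 * lam / 3 * (1 - warpMean P s)| ≤ |2 * lam / 3| * K := by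
        rw [abs_mul]; gcongr; exact hK s hs
      rw [x_add_P_mul_exp_neg_eq]
      linarith [neg_le_of_abs_le this]
  exact ⟨L, hL⟩

theorem exists_x_mul_exp_neg_le (h : IsLogSoliton lam s₀ x P t) :
    ∃ C, ∀ s, s₀ ≤ s → x s * Real.exp (-s) ≤ C := by
  obtain ⟨K, hK⟩ := h.exists_abs_one_sub_warpMean_le
  have hanti := antitoneOn_of_hasDerivAt_nonpos (convex_Ici s₀)
    (fun _ hs => h.hasDerivAt_x_add_P_mul_exp_neg hs)
    fun s hs => deriv_x_add_P_mul_exp_neg_nonpos (h.x_pos s hs)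
  refine ⟨(x s₀ + lam / 3 * P s₀) * Real.exp (-s₀) + |2 * lam / 3| * K, fun s hs => ?_⟩
  have hle := hanti Set.self_mem_Ici hs hs
  simp only [x_add_P_mul_exp_neg_eq lam x P s] at hle
  have : |2 * lam / 3 * (1 - warpMean P s)| ≤ |2 * lam / 3| * K := by
    rw [abs_mul]; gcongr; exact hK s hs
  linarith [neg_le_of_abs_le this]

theorem eventually_one_half_le_one_sub_warp (hε : 0 < ε) :
    ∀ᶠ s in atTop, ε ≤ x s * Real.exp (-s) → 1 / 2 ≤ 1 - warp x s := by
  filter_upwards [Real.tendsto_exp_atTop.eventually_ge_atTop (2 / ε ^ 3 + 1)] with s hs hle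
  have hlarge : ε * Real.exp s ≤ x s := by
    rwa [Real.exp_neg, ← div_eq_mul_inv, le_div_iff₀ (Real.exp_pos s)] at hle
  have hx : 0 < x s := lt_of_lt_of_le (by positivity) hlarge
  have : 0 < 2 / ε ^ 3 := by positivity
  have hcube : 2 * Real.exp s ≤ x s ^ 3 := by
    calc 2 * Real.exp s = ε ^ 3 * (2 / ε ^ 3) * Real.exp s := by field_simp
      _ ≤ ε ^ 3 * Real.exp s * Real.exp s := by gcongr; linarith
      _ ≤ ε ^ 3 * Real.exp s * Real.exp s * Real.exp s :=
        le_mul_of_one_le_right (by positivity) (by linarith)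
      _ = (ε * Real.exp s) ^ 3 := by ring
      _ ≤ x s ^ 3 := by gcongr
  rw [one_sub_warp hx, le_div_iff₀ (by positivity)]
  linarith

theorem tendsto_x_mul_exp_neg_zero (h : IsLogSoliton lam s₀ x P t) :
    Tendsto (fun s => x s * Real.exp (-s)) atTop (𝓝 0) := by
  obtain ⟨L, hL⟩ := h.exists_tendsto_x_add_P_mul_exp_neg
  obtain ⟨K, hK⟩ := h.exists_abs_one_sub_warpMean_le
  obtain ⟨C, hC⟩ := h.exists_x_mul_exp_neg_le
  have hbound : ∀ s, s₀ ≤ s → |2 * lam / 3 * (warp x s - warpMean P s) -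
      2 * (1 - warp x s) * (x s * Real.exp (-s))| ≤ |2 * lam / 3| * (1 + K) + 2 * 1 * C := by
    intro s hs
    have hx := h.x_pos s hs
    have hgap : 0 < 1 - warp x s := sub_pos.2 (warp_lt_one hx)
    have hgap' : 1 - warp x s ≤ 1 := sub_le_self _ (warp_pos hx).le
    refine (abs_sub _ _).trans (add_le_add ?_ ?_)
    · rw [abs_mul]
      gcongr
      have := abs_le.1 (hK s hs)
      exact abs_le.2 ⟨by linarith, by linarith⟩
    · rw [abs_of_nonneg (by positivity)]
      have := hC s hs
      gcongr
  refine tendsto_zero_of_deriv_ge_of_tendsto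
    (fun s hs => (h.hasDerivAt_x_add_P_mul_exp_neg hs).neg) hL.neg
    (fun s hs => h.hasDerivAt_x_mul_exp_neg hs) hbound fun ε hε => ⟨ε, hε, ?_⟩
  filter_upwards [eventually_ge_atTop s₀, eventually_one_half_le_one_sub_warp hε]
    with s hs hhalf hle
  have := h.x_pos s hs
  rw [abs_of_pos (by positivity)] at hle
  rw [neg_neg]
  have : 0 ≤ x s * Real.exp (-s) := by positivity
  nlinarith [hhalf hle]

theorem exists_tendsto_warpMean (h : IsLogSoliton lam s₀ x P t) (hlam : lam ≠ 0) :
    ∃ l, 0 ≤ l ∧ l ≤ 1 ∧ Tendsto (warpMean P) atTop (𝓝 l) := by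
  obtain ⟨L, hL⟩ := h.exists_tendsto_x_add_P_mul_exp_neg
  obtain ⟨B, -, hB⟩ := h.exists_warpMean_bounds
  have hlim : Tendsto (warpMean P) atTop (𝓝 (1 - 3 / (2 * lam) * (L - 0))) := by
    refine (((hL.sub h.tendsto_x_mul_exp_neg_zero).const_mul (3 / (2 * lam))).const_sub 1).congr
      fun s => ?_
    rw [x_add_P_mul_exp_neg_eq]
    field_simp
    ring
  have hexp : Tendsto (fun s => B * Real.exp (-s)) atTop (𝓝 0) := by
    simpa using Real.tendsto_exp_neg_atTop_nhds_zero.const_mul B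
  refine ⟨_, le_of_tendsto_of_tendsto (by simpa using hexp.neg) hlim ?_,
    le_of_tendsto_of_tendsto hlim (by simpa using hexp.const_add 1) ?_, hlim⟩ <;>
  filter_upwards [eventually_ge_atTop s₀] with s hs
  exacts [(hB s hs).1, (hB s hs).2]

theorem x_mul_exp_neg_mul_ratioRate (hx : x s ≠ 0) :
    x s * Real.exp (-s) * ratioRate lam x P s =
      (4 - 6 * warp x s) * (x s * Real.exp (-s)) - 2 * lam * (warp x s - warpMean P s) := by
  have hexp : Real.exp s * Real.exp (-s) = 1 := by rw [← Real.exp_add]; simp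
  rw [ratioRate_eq]
  field_simp
  linear_combination -(2 * lam * (warp x s - warpMean P s)) * hexp

theorem warp_lt_add_of_warpMean_le (h : IsLogSoliton lam s₀ x P t) (hlam : lam < 0) (hε : 0 < ε)
    (hmean : ∀ s, s₀ ≤ s → warpMean P s ≤ l + ε / 2)
    (hsmall : ∀ s, s₀ ≤ s → 12 * (x s * Real.exp (-s)) ≤ -lam * ε) : warp x s₀ < l + ε := by
  by_contra! hge
  have hlam_ε : 0 < -lam * ε := mul_pos (neg_pos.2 hlam) hε
  have hscaled : ∀ s, s₀ ≤ s → 0 < x s * Real.exp (-s) := fun s hs =>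
    mul_pos (h.x_pos s hs) (Real.exp_pos _)
  have hforce : ∀ s, s₀ ≤ s → l + ε ≤ warp x s →
      lam * (warp x s - warpMean P s) ≤ lam * (ε / 2) := fun s hs hw =>
    mul_le_mul_of_nonpos_left (by linarith [hmean s hs]) hlam.le
  have hstay := le_image_of_deriv_pos_of_eq (fun s hs => h.hasDerivAt_warp hs) hge
    fun s hs _ heq => by
      have hx := h.x_pos s hs
      have := hscaled s hs
      have hw := warp_lt_one hx
      refine mul_pos (mul_pos (warp_pos hx) (sub_pos.2 hw)) (pos_of_mul_pos_right ?_ this.le)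
      rw [x_mul_exp_neg_mul_ratioRate hx.ne']
      nlinarith [hforce s hs heq.ge, hsmall s hs]
  have htop : Tendsto (fun s => -(x s * Real.exp (-s))) atTop atTop :=
    tendsto_atTop_of_le_hasDerivAt (by positivity : 0 < -lam * ε / 3)
      (fun s hs => (h.hasDerivAt_x_mul_exp_neg hs).neg) fun s hs => by
        have : 0 ≤ 2 * (1 - warp x s) * (x s * Real.exp (-s)) :=
          mul_nonneg (by linarith [warp_lt_one (h.x_pos s hs)]) (hscaled s hs).le
        linarith [hforce s hs (hstay s hs)]
  obtain ⟨s, hpos, hs⟩ := ((htop.eventually_gt_atTop 0).and (eventually_ge_atTop s₀)).exists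
  linarith [hscaled s hs]

theorem sub_lt_warp_of_le_warpMean (h : IsLogSoliton lam s₀ x P t) (hlam : lam < 0) (hε : 0 < ε)
    (hmean : ∀ s, s₀ ≤ s → l - ε / 2 ≤ warpMean P s)
    (hsmall : ∀ s, s₀ ≤ s → 12 * (x s * Real.exp (-s)) ≤ -lam * ε) : l - ε < warp x s₀ := by
  by_contra! hle
  have hlam_ε : 0 < -lam * ε := mul_pos (neg_pos.2 hlam) hε
  have hscaled : ∀ s, s₀ ≤ s → 0 < x s * Real.exp (-s) := fun s hs =>
    mul_pos (h.x_pos s hs) (Real.exp_pos _)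
  have hforce : ∀ s, s₀ ≤ s → warp x s ≤ l - ε →
      lam * (-ε / 2) ≤ lam * (warp x s - warpMean P s) := fun s hs hw =>
    mul_le_mul_of_nonpos_left (by linarith [hmean s hs]) hlam.le
  have hstay := image_le_of_deriv_neg_of_eq (fun s hs => h.hasDerivAt_warp hs) hle
    fun s hs _ heq => by
      have hx := h.x_pos s hs
      have := hscaled s hs
      have hw := warp_pos hx
      refine mul_neg_of_pos_of_neg (mul_pos hw (sub_pos.2 (warp_lt_one hx)))
        (neg_of_mul_neg_right ?_ this.le)
      rw [x_mul_exp_neg_mul_ratioRate hx.ne']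
      nlinarith [hforce s hs heq.le, hsmall s hs]
  have htop : Tendsto (fun s => x s * Real.exp (-s)) atTop atTop :=
    tendsto_atTop_of_le_hasDerivAt (by positivity : 0 < -lam * ε / 6)
      (fun s hs => h.hasDerivAt_x_mul_exp_neg hs) fun s hs => by
        have := hscaled s hs
        have := warp_pos (h.x_pos s hs)
        nlinarith [hforce s hs (hstay s hs), hsmall s hs]
  obtain ⟨s, hlarge, hs⟩ :=
    ((htop.eventually_gt_atTop (-lam * ε)).and (eventually_ge_atTop s₀)).exists
  linarith [hsmall s hs]

theorem tendsto_warp_of_tendsto_warpMean (h : IsLogSoliton lam s₀ x P t) (hlam : lam < 0)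
    (hmean : Tendsto (warpMean P) atTop (𝓝 l)) : Tendsto (warp x) atTop (𝓝 l) := by
  refine Metric.tendsto_nhds.2 fun ε hε => ?_
  have hsmall : ∀ᶠ s in atTop, 12 * (x s * Real.exp (-s)) ≤ -lam * ε := by
    have hlim : Tendsto (fun s => 12 * (x s * Real.exp (-s))) atTop (𝓝 0) := by
      simpa using h.tendsto_x_mul_exp_neg_zero.const_mul 12
    exact hlim.eventually (ge_mem_nhds (mul_pos (neg_pos.2 hlam) hε))
  filter_upwards [eventually_ge_atTop s₀, eventually_forall_ge_atTop.2 hsmall,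
    eventually_forall_ge_atTop.2
      (hmean.eventually (Icc_mem_nhds (sub_lt_self l (half_pos hε))
        (lt_add_of_pos_right l (half_pos hε))))] with s hs hsmall hmean
  rw [Real.dist_eq, abs_sub_lt_iff]
  constructor
  · linarith [(h.mono hs).warp_lt_add_of_warpMean_le hlam hε (fun s hs => (hmean s hs).2) hsmall]
  · linarith [(h.mono hs).sub_lt_warp_of_le_warpMean hlam hε (fun s hs => (hmean s hs).1) hsmall]

theorem le_deriv_x (hlam : lam < 0) (hx : 0 < x s) (hsum : 0 ≤ x s + lam / 3 * P s)
    (hw : 1 / 2 ≤ warp x s) (hsmall : x s * Real.exp (-s) ≤ -lam / 12) :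
    -lam / 12 * x s ^ 3 ≤
      x s - 2 * (1 - warp x s) * x s + lam / 3 * (P s - warp x s * x s ^ 3) := by
  have hgap : 2 * (1 - warp x s) * x s ≤ x s ^ 3 * (-lam / 12) := by
    calc 2 * (1 - warp x s) * x s ≤ 2 * (x s ^ 3 / (2 * Real.exp s)) * x s := by
          gcongr; exact one_sub_warp_le hx
      _ = x s ^ 3 * (x s * Real.exp (-s)) := by rw [Real.exp_neg]; field_simp
      _ ≤ x s ^ 3 * (-lam / 12) := by gcongr
  have hdrift : -lam / 3 * (1 / 2 * x s ^ 3) ≤ -lam / 3 * (warp x s * x s ^ 3) := by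
    have : 0 ≤ -lam / 3 := by linarith
    gcongr
  linarith

/-- If `warp → 1`, then `x' ≥ c x³` for some `c > 0`, so that `x` blows up in finite time. -/
theorem not_tendsto_warpMean_one (h : IsLogSoliton lam s₀ x P t) (hlam : lam < 0) :
    ¬Tendsto (warpMean P) atTop (𝓝 1) := by
  intro hmean
  have hscaled := h.tendsto_x_mul_exp_neg_zero
  have hsum : Tendsto (fun s => (x s + lam / 3 * P s) * Real.exp (-s)) atTop (𝓝 0) := by
    simpa [x_add_P_mul_exp_neg_eq] using
      hscaled.add ((hmean.const_sub 1).const_mul (2 * lam / 3))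
  obtain ⟨s₁, hs₁⟩ := eventually_atTop.1 <| (eventually_ge_atTop s₀).and <|
    ((h.tendsto_warp_of_tendsto_warpMean hlam hmean).eventually
      (le_mem_nhds (by norm_num : (1 / 2 : ℝ) < 1))).and
    (hscaled.eventually (ge_mem_nhds (by linarith : 0 < -lam / 12)))
  have htop : Tendsto (fun s => -(x s ^ 2)⁻¹) atTop atTop := by
    refine tendsto_atTop_of_le_hasDerivAt (by linarith : 0 < -lam / 6)
      (fun s hs => (((h.deriv_x s (hs₁ s hs).1).fun_pow 2).fun_inv
        (pow_pos (h.x_pos s (hs₁ s hs).1) 2).ne').neg) fun s hs => ?_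
    obtain ⟨hs0, hw, hsmall⟩ := hs₁ s hs
    have hx := h.x_pos s hs0
    have hle := le_deriv_x hlam hx (h.x_add_P_nonneg hsum hs0) hw hsmall
    rw [← neg_div, neg_neg, le_div_iff₀ (by positivity)]
    calc -lam / 6 * (x s ^ 2) ^ 2 = 2 * x s * (-lam / 12 * x s ^ 3) := by ring
      _ ≤ 2 * x s * (x s - 2 * (1 - warp x s) * x s + lam / 3 * (P s - warp x s * x s ^ 3)) := by
        gcongr
      _ = _ := by push_cast; ring
  obtain ⟨s, hpos, hs⟩ := ((htop.eventually_gt_atTop 0).and (eventually_ge_atTop s₁)).exists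
  have := h.x_pos s (hs₁ s hs).1
  exact hpos.not_ge (neg_nonpos.2 (by positivity))

theorem hasDerivAt_ratioRate (h : IsLogSoliton lam s₀ x P t) (hs : s₀ ≤ s) :
    HasDerivAt (ratioRate lam x P)
      (-6 * (warp x s * (1 - warp x s) * ratioRate lam x P s) -
        2 * lam / x s * (warp x s * (1 - warp x s) * ratioRate lam x P s * Real.exp s) -
        (ratioRate lam x P s - 4 + 6 * warp x s) * (1 - ratioRate lam x P s) / 3) s := by
  have hx := (h.x_pos s hs).ne'
  have hw := h.hasDerivAt_warp hs
  have hcoef : HasDerivAt (fun s => 2 * lam / x s)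
      (-(2 * lam / x s) * (1 - ratioRate lam x P s) / 3) s := by
    refine ((hasDerivAt_const s (2 * lam)).fun_div (h.hasDerivAt_x hs) hx).congr_deriv ?_
    field_simp
    ring
  refine (((hw.const_mul 6).const_sub 4).fun_sub (hcoef.fun_mul ((hw.fun_mul
    (Real.hasDerivAt_exp s)).fun_sub (h.hasDerivAt_warpMass hs)))).congr_deriv ?_
  have hforce : ratioRate lam x P s - 4 + 6 * warp x s =
      -(2 * lam / x s * (warp x s * Real.exp s - warpMass P s)) := by rw [ratioRate]; ring
  rw [hforce]
  ring

theorem hasDerivAt_collapseRate (h : IsLogSoliton lam s₀ x P t) (hs : s₀ ≤ s) :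
    HasDerivAt (fun s => -ratioRate lam x P s / 3) (collapseField (-ratioRate lam x P s / 3)
      (-(8 * lam / 9) * quarticRatio x s) (warp x s)) s := by
  have hx := h.x_pos s hs
  refine ((h.hasDerivAt_ratioRate hs).neg.div_const 3).congr_deriv ?_
  have hgrowth : 9 / 2 * (-(8 * lam / 9) * quarticRatio x s) * (1 - warp x s) =
      -(2 * lam) * warp x s * Real.exp s / x s := by
    rw [quarticRatio]
    field_simp
    linear_combination 4 * lam * warp_mul_cube hx
  generalize ratioRate lam x P s = R at *
  rw [collapseField]
  linear_combination (norm := skip) (1 - warp x s) * (R / 3) * hgrowth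
  field_simp
  ring

theorem ratioRate_neg (h : IsLogSoliton lam s₀ x P t) (hw0 : Tendsto (warp x) atTop (𝓝 0))
    (hw : ∀ s, s₀ ≤ s → warp x s ≤ 1 / 36) : ratioRate lam x P s₀ < 0 := by
  by_contra! hge
  have hstay := image_le_of_deriv_neg_of_eq (c := 0) (fun s hs => h.hasDerivAt_collapseRate hs)
    (by linarith) fun s hs _ heq => by
      rw [heq, collapseField]
      linarith [hw s hs]
  have hmono := monotoneOn_of_hasDerivAt_nonneg (convex_Ici s₀)
    (fun s hs => h.hasDerivAt_warp hs) fun s hs => by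
      have hx := h.x_pos s hs
      have := hstay s hs
      exact mul_nonneg (mul_nonneg (warp_pos hx).le (sub_nonneg.2 (warp_lt_one hx).le))
        (by linarith)
  have hle : warp x s₀ ≤ 0 := ge_of_tendsto hw0 <| by
    filter_upwards [eventually_ge_atTop s₀] with s hs
    exact hmono Set.self_mem_Ici hs hs
  exact hle.not_gt (warp_pos (h.x_pos s₀ le_rfl))

theorem exists_isCollapsing (h : IsLogSoliton lam s₀ x P t) (hlam : lam < 0)
    (hw0 : Tendsto (warp x) atTop (𝓝 0)) :
    ∃ s₁, IsCollapsing s₁ (fun s => -ratioRate lam x P s / 3)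
      (fun s => -(8 * lam / 9) * quarticRatio x s) (warp x) := by
  obtain ⟨s₁, hs₁⟩ := eventually_atTop.1 ((eventually_ge_atTop s₀).and
    (hw0.eventually (ge_mem_nhds (by norm_num : (0 : ℝ) < 1 / 36))))
  have h₁ := h.mono (hs₁ s₁ le_rfl).1
  refine ⟨s₁, fun s hs => ?_, fun s hs => ?_, fun s hs => warp_pos (h₁.x_pos s hs),
    fun s hs => (hs₁ s hs).2, hw0, fun s hs => h₁.hasDerivAt_collapseRate hs,
    fun s hs => ?_, fun s hs => ?_⟩
  · have := (h₁.mono hs).ratioRate_neg hw0 fun σ hσ => (hs₁ σ (hs.trans hσ)).2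
    linarith
  · exact mul_pos (by linarith) (quarticRatio_pos (h₁.x_pos s hs))
  · exact ((h₁.hasDerivAt_quarticRatio hs).const_mul _).congr_deriv (by ring)
  · exact (h₁.hasDerivAt_warp hs).congr_deriv (by ring)

theorem tendsto_quarticRatio_and_ratioRate (h : IsLogSoliton lam s₀ x P t) (hlam : lam < 0)
    (hw0 : Tendsto (warp x) atTop (𝓝 0)) :
    Tendsto (quarticRatio x) atTop (𝓝 (-9 / (8 * lam))) ∧
      Tendsto (ratioRate lam x P) atTop (𝓝 (-(1 / 2))) := by
  obtain ⟨s₁, hcol⟩ := h.exists_isCollapsing hlam hw0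
  obtain ⟨ha, hn⟩ := hcol.tendsto_equilibrium
  have := hlam.ne
  constructor
  · convert hn.const_mul (-9 / (8 * lam)) using 2
    · field_simp
    · rw [mul_one]
  · convert ha.const_mul (-3) using 2
    · ring
    · norm_num

theorem tendsto_warp_mul_x (h : IsLogSoliton lam s₀ x P t) (hlam : lam < 0)
    (hw0 : Tendsto (warp x) atTop (𝓝 0)) :
    Tendsto (fun s => warp x s * x s) atTop (𝓝 (1 / (2 * √(-lam / 18)))) := by
  have hq : 0 < √(-lam / 18) := Real.sqrt_pos.2 (by linarith)
  have hlam_eq : lam = -(18 * √(-lam / 18) ^ 2) := by rw [Real.sq_sqrt (by linarith)]; ring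
  have hroot : √(-9 / (8 * lam)) = 1 / (4 * √(-lam / 18)) := by
    rw [Real.sqrt_eq_iff_mul_self_eq_of_pos (by positivity)]
    generalize √(-lam / 18) = q at *
    rw [hlam_eq]
    field_simp
    norm_num
  have hlim := ((hw0.const_sub 1).const_mul 2).mul
    (h.tendsto_quarticRatio_and_ratioRate hlam hw0).1.sqrt
  rw [hroot, show 2 * (1 - 0) * (1 / (4 * √(-lam / 18))) = 1 / (2 * √(-lam / 18)) by
    field_simp; norm_num] at hlim
  refine hlim.congr' ?_
  filter_upwards [eventually_ge_atTop s₀] with s hs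
  have hx := h.x_pos s hs
  have hsqrt : √(quarticRatio x s) = Real.exp s / x s ^ 2 := by
    rw [Real.sqrt_eq_iff_mul_self_eq_of_pos (by positivity), quarticRatio]
    field_simp
  rw [hsqrt, ← mul_div_assoc, ← warp_mul_cube hx]
  field_simp

theorem tendsto_exp_div_cube_zero (h : IsLogSoliton lam s₀ x P t)
    (hw0 : Tendsto (warp x) atTop (𝓝 0)) :
    Tendsto (fun s => Real.exp s / x s ^ 3) atTop (𝓝 0) := by
  have hlim := hw0.div ((hw0.const_sub 1).const_mul 2) (by norm_num)
  rw [zero_div] at hlim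
  refine hlim.congr' ?_
  filter_upwards [eventually_ge_atTop s₀] with s hs
  have hx := h.x_pos s hs
  have : 0 < 1 - warp x s := sub_pos.2 (warp_lt_one hx)
  rw [Pi.div_apply, div_eq_div_iff (by positivity) (by positivity), warp_mul_cube hx]
  ring

theorem shrinker_asymptotics (h : IsLogSoliton lam s₀ x P t) (hlam : lam < 0)
    (hw0 : Tendsto (warp x) atTop (𝓝 0)) :
    Tendsto t atTop atTop ∧ Tendsto (fun s => Real.exp s / x s ^ 3) atTop (𝓝 0) ∧
      Tendsto (fun s => Real.log (x s) / t s) atTop (𝓝 √(-lam / 18)) ∧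
      Tendsto (quarticRatio x) atTop (𝓝 (-9 / (8 * lam))) ∧
      Tendsto (fun s => s / t s) atTop (𝓝 (2 * √(-lam / 18))) := by
  obtain ⟨hquartic, hrate⟩ := h.tendsto_quarticRatio_and_ratioRate hlam hw0
  have hspeed := h.tendsto_warp_mul_x hlam hw0
  have hspeed_pos : ∀ s, s₀ ≤ s → 0 < warp x s * x s := fun s hs =>
    mul_pos (warp_pos (h.x_pos s hs)) (h.x_pos s hs)
  have hq : 0 < √(-lam / 18) := Real.sqrt_pos.2 (by linarith)
  have htop : Tendsto t atTop atTop := by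
    obtain ⟨s₁, hs₁⟩ := eventually_atTop.1 ((eventually_ge_atTop s₀).and
      (hspeed.eventually (le_mem_nhds (half_lt_self (by positivity)))))
    exact tendsto_atTop_of_le_hasDerivAt (by positivity)
      (fun s hs => h.deriv_t s (hs₁ s hs).1) fun s hs => (hs₁ s hs).2
  have hlog : ∀ s, s₀ ≤ s → HasDerivAt (fun s => Real.log (x s))
      ((1 - ratioRate lam x P s) / 3) s := fun s hs => by
    have hx := (h.x_pos s hs).ne'
    exact ((h.hasDerivAt_x hs).log hx).congr_deriv (by field_simp)
  refine ⟨htop, h.tendsto_exp_div_cube_zero hw0, ?_, hquartic, ?_⟩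
  · refine tendsto_div_of_tendsto_deriv_div hlog h.deriv_t hspeed_pos htop ?_
    have hlim := ((hrate.const_sub 1).div_const 3).div hspeed (by positivity)
    rwa [show (1 - -(1 / 2)) / 3 / (1 / (2 * √(-lam / 18))) = √(-lam / 18) by
      field_simp; norm_num] at hlim
  · refine tendsto_div_of_tendsto_deriv_div (fun s _ => hasDerivAt_id s) h.deriv_t hspeed_pos
      htop ?_
    simpa using hspeed.inv₀ (by positivity)

/-! ### The dichotomy for ends of infinite volume -/

theorem ratio_bounds (hx : 0 < x s) (hε : 0 < ε) (hw : ε ≤ warp x s ∧ warp x s ≤ 1 - ε) :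
    ε / 2 ≤ Real.exp s / x s ^ 3 ∧ Real.exp s / x s ^ 3 ≤ 1 / (2 * ε) := by
  have hmul := warp_mul_cube hx
  have hcube : 0 < x s ^ 3 := by positivity
  have hexp := Real.exp_pos s
  rw [le_div_iff₀ hcube, div_le_div_iff₀ hcube (by positivity)]
  constructor
  · have : ε * x s ^ 3 ≤ warp x s * x s ^ 3 := by gcongr; exact hw.1
    have : 0 ≤ warp x s * Real.exp s := mul_nonneg (warp_pos hx).le hexp.le
    linarith
  · have : ε * Real.exp s ≤ (1 - warp x s) * Real.exp s := by gcongr; linarith [hw.2]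
    have : warp x s * x s ^ 3 ≤ 1 * x s ^ 3 := by gcongr; exact (warp_lt_one hx).le
    linarith

theorem shrinker_dichotomy (h : IsLogSoliton lam s₀ x P t) (hlam : lam < 0) :
    (∃ s₁ ε, s₀ ≤ s₁ ∧ 0 < ε ∧ ∀ s, s₁ ≤ s → ε ≤ warp x s ∧ warp x s ≤ 1 - ε) ∨
      Tendsto (warp x) atTop (𝓝 0) := by
  obtain ⟨l, hl0, hl1, hmean⟩ := h.exists_tendsto_warpMean hlam.ne
  have hl1 : l < 1 := hl1.lt_of_ne fun hl => h.not_tendsto_warpMean_one hlam (hl ▸ hmean)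
  have hw := h.tendsto_warp_of_tendsto_warpMean hlam hmean
  refine hl0.eq_or_lt.elim (fun hl => .inr (hl ▸ hw)) fun hl0 => .inl ?_
  have hmin_le := min_le_left (l / 2) ((1 - l) / 2)
  have hmin_le' := min_le_right (l / 2) ((1 - l) / 2)
  obtain ⟨s₁, hs₁⟩ := eventually_atTop.1 ((eventually_ge_atTop s₀).and
    (hw.eventually (Icc_mem_nhds (a := min (l / 2) ((1 - l) / 2))
      (b := 1 - min (l / 2) ((1 - l) / 2)) (by linarith) (by linarith))))
  exact ⟨s₁, _, (hs₁ s₁ le_rfl).1, lt_min (by linarith) (by linarith), fun s hs => (hs₁ s hs).2⟩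

theorem expander_dichotomy (h : IsLogSoliton lam s₀ x P t) (hlam : 0 < lam) :
    ∃ s₁ ε, s₀ ≤ s₁ ∧ 0 < ε ∧ (∀ s, s₁ ≤ s → ε ≤ warp x s) ∧
      ((∀ s, s₁ ≤ s → warp x s ≤ 1 - ε) ∨ ∀ s, s₁ ≤ s → P s ≤ 0) := by
  obtain ⟨s₁, h01, hmass⟩ := h.exists_warpMass_pos hlam
  have h₁ := h.mono h01
  obtain ⟨ε₁, hε₁, hge⟩ := h₁.exists_le_warp_of_warpMass_pos hlam hmass
  by_cases hP : ∃ s₂, s₁ ≤ s₂ ∧ 0 < P s₂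
  · obtain ⟨s₂, h12, hP⟩ := hP
    obtain ⟨ε₂, hε₂, hle⟩ := (h₁.mono h12).exists_warp_le_of_P_pos hlam hP
    exact ⟨s₂, min ε₁ ε₂, h01.trans h12, lt_min hε₁ hε₂,
      fun s hs => (min_le_left _ _).trans (hge s (h12.trans hs)),
      .inl fun s hs => (hle s hs).trans (sub_le_sub_left (min_le_right _ _) 1)⟩
  · push Not at hP
    exact ⟨s₁, ε₁, h01, hε₁, hge, .inr hP⟩

theorem dichotomy (h : IsLogSoliton lam s₀ x P t) (hlam : lam ≠ 0) :
    Tendsto t atTop atTop ∧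
    ((∃ s₁ ε, s₀ ≤ s₁ ∧ 0 < ε ∧ (∀ s, s₁ ≤ s → ε ≤ warp x s ∧ warp x s ≤ 1 - ε)) ∨
    (0 < lam ∧ Tendsto (fun s => Real.exp s / x s ^ 3) atTop atTop ∧
      Tendsto (fun s => t s * x s) atTop (𝓝 (3 / lam)) ∧
      Tendsto (fun s => s / t s ^ 2) atTop (𝓝 (lam / 6)) ∧
      Tendsto x atTop (𝓝 0)) ∨
    (lam < 0 ∧ Tendsto (fun s => Real.exp s / x s ^ 3) atTop (𝓝 0) ∧
      Tendsto (fun s => Real.log (x s) / t s) atTop (𝓝 √(-lam / 18)) ∧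
      Tendsto (quarticRatio x) atTop (𝓝 (-9 / (8 * lam))) ∧
      Tendsto (fun s => s / t s) atTop (𝓝 (2 * √(-lam / 18))))) := by
  rcases lt_or_gt_of_ne hlam with hneg | hpos
  · obtain ⟨s₁, ε, h01, hε, hw⟩ | hw0 := h.shrinker_dichotomy hneg
    · exact ⟨((h.mono h01).conical hlam hε hw).1, .inl ⟨s₁, ε, h01, hε, hw⟩⟩
    · obtain ⟨ht, hasym⟩ := h.shrinker_asymptotics hneg hw0
      exact ⟨ht, .inr (.inr ⟨hneg, hasym⟩)⟩
  · obtain ⟨s₁, ε, h01, hε, hge, hle | hP⟩ := h.expander_dichotomy hpos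
    · have hw : ∀ s, s₁ ≤ s → ε ≤ warp x s ∧ warp x s ≤ 1 - ε := fun s hs => ⟨hge s hs, hle s hs⟩
      exact ⟨((h.mono h01).conical hlam hε hw).1, .inl ⟨s₁, ε, h01, hε, hw⟩⟩
    · obtain ⟨ht, hasym⟩ := (h.mono h01).expander_asymptotics hpos hP hε hge
      exact ⟨ht, .inr (.inl ⟨hpos, hasym⟩)⟩

end IsLogSoliton

/-! ### The reduced system and its extension property -/

/-- The torsion component `τ₁` in terms of `x`, `v = x y²` and `p = τ₁ - u x²`. -/
noncomputable def reducedTorsion₁ (lam x v p : ℝ) : ℝ :=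
  2 * p / 3 - (2 * lam * v - p) * x ^ 3 / (3 * v)

/-- The torsion component `τ₂` in terms of `x`, `v = x y²` and `p = τ₁ - u x²`. -/
noncomputable def reducedTorsion₂ (lam x v p : ℝ) : ℝ :=
  (2 * lam * v - p) / 6 - p * v / (3 * x ^ 3)

/-- The soliton vector field in terms of `x`, `v = x y²` and `p = τ₁ - u x²`. -/
noncomputable def reducedField (lam x v p : ℝ) : ℝ :=
  -(p / x ^ 2 + (2 * lam * v - p) * x / v) / 3

/-- The derivative `(x²)' = τ₁ + 2x - x³/y²` in terms of `x`, `v = x y²` and `p = τ₁ - u x²`.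
Unlike `x'`, it stays regular as `x → 0`. -/
noncomputable def reducedSqSlope (lam x v p : ℝ) : ℝ :=
  reducedTorsion₁ lam x v p + 2 * x - x ^ 4 / v

/-- The soliton system written in terms of `x`, `v = x y²` and `p = τ₁ - u x²`. -/
structure IsReducedSoliton (lam a : ℝ) (T : EReal) (x v p : ℝ → ℝ) : Prop where
  x_pos : ∀ t : ℝ, a < t → (t : EReal) < T → 0 < x t
  v_pos : ∀ t : ℝ, a < t → (t : EReal) < T → 0 < v t
  deriv_x : ∀ t : ℝ, a < t → (t : EReal) < T →
    HasDerivAt x (reducedSqSlope lam (x t) (v t) (p t) / (2 * x t)) t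
  deriv_v : ∀ t : ℝ, a < t → (t : EReal) < T → HasDerivAt v (x t ^ 2 / 2 + v t / x t) t
  deriv_p : ∀ t : ℝ, a < t → (t : EReal) < T → HasDerivAt p (lam * x t ^ 2) t

section ReducedAlgebra

variable {lam x v p : ℝ}

theorem reducedTorsion₁_sub_field (hx : 0 < x) (hv : 0 < v) :
    reducedTorsion₁ lam x v p - reducedField lam x v p * x ^ 2 = p := by
  unfold reducedTorsion₁ reducedField
  field_simp
  ring

theorem reducedTorsion₂_sub_field (hx : 0 < x) (hv : 0 < v) :
    reducedTorsion₂ lam x v p - reducedField lam x v p * (v / x) = (2 * lam * v - p) / 2 := by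
  unfold reducedTorsion₂ reducedField
  field_simp
  ring

theorem reduced_conserved (hx : 0 < x) (hv : 0 < v) :
    reducedTorsion₁ lam x v p + 2 * reducedTorsion₂ lam x v p =
      reducedField lam x v p * (x ^ 2 + 2 * (v / x)) + 2 * lam * v := by
  linarith [reducedTorsion₁_sub_field (lam := lam) (p := p) hx hv,
    reducedTorsion₂_sub_field (lam := lam) (p := p) hx hv]

end ReducedAlgebra

/-- The time interval `(a, T)` as a set of reals, with `T = ∞` allowed. -/
def lifespan (a : ℝ) (T : EReal) : Set ℝ := {t | a < t ∧ (t : EReal) < T}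

theorem isOpen_lifespan (a : ℝ) (T : EReal) : IsOpen (lifespan a T) :=
  (isOpen_lt continuous_const continuous_id).inter
    (isOpen_lt continuous_coe_real_ereal continuous_const)

theorem ordConnected_lifespan (a : ℝ) (T : EReal) : (lifespan a T).OrdConnected :=
  Set.ordConnected_Ioi.inter (Set.ordConnected_Iio.preimage_mono EReal.coe_strictMono.monotone)

theorem lifespan_coe (a b : ℝ) : lifespan a b = Set.Ioo a b := by
  ext t
  exact and_congr_right' EReal.coe_lt_coe_iff

theorem eventually_mem_lifespan {a t : ℝ} {T : EReal} (ha : a < t) (hT : (t : EReal) < T) :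
    ∀ᶠ s in 𝓝 t, s ∈ lifespan a T :=
  (isOpen_lifespan a T).mem_nhds ⟨ha, hT⟩

theorem hasDerivAt_of_sq {f : ℝ → ℝ} {d t : ℝ} (hf : ∀ᶠ s in 𝓝 t, 0 < f s)
    (h : HasDerivAt (fun s => f s ^ 2) d t) : HasDerivAt f (d / (2 * f t)) t := by
  have h0 : 0 < f t := hf.self_of_nhds
  have hsqrt := h.sqrt (pow_pos h0 2).ne'
  rw [Real.sqrt_sq h0.le] at hsqrt
  refine hsqrt.congr_of_eventuallyEq ?_
  filter_upwards [hf] with s hs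
  rw [Real.sqrt_sq hs.le]

namespace IsSp2Soliton

variable {lam a t : ℝ} {T : EReal} {x y τ₁ τ₂ u : ℝ → ℝ}

theorem hasDerivAt_x (h : IsSp2Soliton lam a T x y τ₁ τ₂ u) (ha : a < t) (hT : (t : EReal) < T) :
    HasDerivAt x ((τ₁ t + 2 * x t - x t ^ 3 / y t ^ 2) / (2 * x t)) t :=
  hasDerivAt_of_sq ((eventually_mem_lifespan ha hT).mono fun s hs => h.x_pos s hs.1 hs.2)
    (h.torsion₁ t ha hT)

/-- This says `τ ∧ φ = 0`; it is what makes the system for `(x, v, p)` autonomous. -/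
theorem torsion_orthogonal (h : IsSp2Soliton lam a T x y τ₁ τ₂ u) (ha : a < t)
    (hT : (t : EReal) < T) : y t ^ 2 * τ₁ t + 2 * x t ^ 2 * τ₂ t = 0 := by
  have hx := h.x_pos t ha hT
  have hy := h.y_pos t ha hT
  have hprod := ((h.hasDerivAt_x ha hT).fun_mul (h.torsion₂ t ha hT)).unique (h.closure t ha hT)
  field_simp at hprod
  linarith

theorem field_eq (h : IsSp2Soliton lam a T x y τ₁ τ₂ u) (ha : a < t) (hT : (t : EReal) < T) :
    u t = reducedField lam (x t) (x t * y t ^ 2) (τ₁ t - u t * x t ^ 2) := by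
  have hx := h.x_pos t ha hT
  have hy := h.y_pos t ha hT
  rw [reducedField, mul_assoc 2, ← mul_assoc 2, ← sub_eq_iff_eq_add'.2 (h.conserved t ha hT)]
  field_simp
  linear_combination h.torsion_orthogonal ha hT

theorem torsion₁_eq (h : IsSp2Soliton lam a T x y τ₁ τ₂ u) (ha : a < t) (hT : (t : EReal) < T) :
    τ₁ t = reducedTorsion₁ lam (x t) (x t * y t ^ 2) (τ₁ t - u t * x t ^ 2) := by
  have hx := h.x_pos t ha hT
  have hy := h.y_pos t ha hT
  have halg := reducedTorsion₁_sub_field (lam := lam) (p := τ₁ t - u t * x t ^ 2) hx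
    (by positivity : 0 < x t * y t ^ 2)
  rw [← h.field_eq ha hT] at halg
  linarith

theorem torsion₂_eq (h : IsSp2Soliton lam a T x y τ₁ τ₂ u) (ha : a < t) (hT : (t : EReal) < T) :
    τ₂ t = reducedTorsion₂ lam (x t) (x t * y t ^ 2) (τ₁ t - u t * x t ^ 2) := by
  have hx := h.x_pos t ha hT
  have hy := h.y_pos t ha hT
  have halg := reducedTorsion₂_sub_field (lam := lam) (p := τ₁ t - u t * x t ^ 2) hx
    (by positivity : 0 < x t * y t ^ 2)
  rw [← h.field_eq ha hT, mul_div_cancel_left₀ _ hx.ne'] at halg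
  linarith [h.conserved t ha hT]

theorem reduced (h : IsSp2Soliton lam a T x y τ₁ τ₂ u) :
    IsReducedSoliton lam a T x (fun t => x t * y t ^ 2) (fun t => τ₁ t - u t * x t ^ 2) where
  x_pos := h.x_pos
  v_pos t ha hT := mul_pos (h.x_pos t ha hT) (pow_pos (h.y_pos t ha hT) 2)
  deriv_x t ha hT := by
    have hx := h.x_pos t ha hT
    have hy := h.y_pos t ha hT
    refine (h.hasDerivAt_x ha hT).congr_deriv ?_
    rw [reducedSqSlope, ← h.torsion₁_eq ha hT]
    field_simp
  deriv_v t ha hT := by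
    have hx := h.x_pos t ha hT
    refine (h.closure t ha hT).congr_deriv ?_
    field_simp
  deriv_p := h.soliton₁

end IsSp2Soliton

namespace IsReducedSoliton

variable {lam a t : ℝ} {T : EReal} {x v p : ℝ → ℝ}

theorem hasDerivAt_sq (h : IsReducedSoliton lam a T x v p) (ha : a < t) (hT : (t : EReal) < T) :
    HasDerivAt (fun s => x s ^ 2) (reducedSqSlope lam (x t) (v t) (p t)) t := by
  have hx := h.x_pos t ha hT
  refine ((h.deriv_x t ha hT).fun_pow 2).congr_deriv ?_
  norm_num
  field_simp

theorem hasDerivAt_v_div_x (h : IsReducedSoliton lam a T x v p) (ha : a < t)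
    (hT : (t : EReal) < T) :
    HasDerivAt (fun s => v s / x s) (reducedTorsion₂ lam (x t) (v t) (p t) + x t) t := by
  have hx := h.x_pos t ha hT
  have hv := h.v_pos t ha hT
  refine ((h.deriv_v t ha hT).fun_div (h.deriv_x t ha hT) hx.ne').congr_deriv ?_
  unfold reducedTorsion₂ reducedSqSlope reducedTorsion₁
  field_simp
  ring

theorem sq_sqrt_div (h : IsReducedSoliton lam a T x v p) (ha : a < t) (hT : (t : EReal) < T) :
    √(v t / x t) ^ 2 = v t / x t :=
  Real.sq_sqrt (div_pos (h.v_pos t ha hT) (h.x_pos t ha hT)).le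

theorem isSp2Soliton (h : IsReducedSoliton lam a T x v p) :
    IsSp2Soliton lam a T x (fun t => √(v t / x t))
      (fun t => reducedTorsion₁ lam (x t) (v t) (p t))
      (fun t => reducedTorsion₂ lam (x t) (v t) (p t))
      (fun t => reducedField lam (x t) (v t) (p t)) where
  x_pos := h.x_pos
  y_pos t ha hT := Real.sqrt_pos.2 (div_pos (h.v_pos t ha hT) (h.x_pos t ha hT))
  torsion₁ t ha hT := by
    refine (h.hasDerivAt_sq ha hT).congr_deriv ?_
    rw [h.sq_sqrt_div ha hT, reducedSqSlope, div_div_eq_mul_div, ← pow_succ]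
  torsion₂ t ha hT := by
    refine (h.hasDerivAt_v_div_x ha hT).congr_of_eventuallyEq ?_
    exact (eventually_mem_lifespan ha hT).mono fun s hs => h.sq_sqrt_div hs.1 hs.2
  closure t ha hT := by
    rw [h.sq_sqrt_div ha hT]
    refine (h.deriv_v t ha hT).congr_of_eventuallyEq ?_
    filter_upwards [eventually_mem_lifespan ha hT] with s hs
    rw [h.sq_sqrt_div hs.1 hs.2, mul_div_cancel₀ _ (h.x_pos s hs.1 hs.2).ne']
  soliton₁ t ha hT := by
    refine (h.deriv_p t ha hT).congr_of_eventuallyEq ?_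
    filter_upwards [eventually_mem_lifespan ha hT] with s hs
    exact reducedTorsion₁_sub_field (h.x_pos s hs.1 hs.2) (h.v_pos s hs.1 hs.2)
  soliton₂ t ha hT := by
    have hderiv := (((h.deriv_v t ha hT).const_mul (2 * lam)).fun_sub
      (h.deriv_p t ha hT)).div_const 2
    refine (hderiv.congr_of_eventuallyEq ?_).congr_deriv ?_
    · filter_upwards [eventually_mem_lifespan ha hT] with s hs
      rw [h.sq_sqrt_div hs.1 hs.2]
      exact reducedTorsion₂_sub_field (h.x_pos s hs.1 hs.2) (h.v_pos s hs.1 hs.2)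
    · rw [h.sq_sqrt_div ha hT]
      ring
  conserved t ha hT := by
    have hx := h.x_pos t ha hT
    rw [h.sq_sqrt_div ha hT, mul_div_cancel₀ _ hx.ne']
    exact reduced_conserved hx (h.v_pos t ha hT)

end IsReducedSoliton

section Gluing

variable {f f' g g' : ℝ → ℝ} {a b c e t : ℝ}

theorem hasDerivAt_glue_of_lt (hf : HasDerivAt f e t) (ht : t < b) :
    HasDerivAt (fun s => if s < b then f s else g s) e t :=
  hf.congr_of_eventuallyEq <| (gt_mem_nhds ht).mono fun _ hs => if_pos hs

theorem hasDerivAt_glue_of_gt (hg : HasDerivAt g e t) (ht : b < t) :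
    HasDerivAt (fun s => if s < b then f s else g s) e t :=
  hg.congr_of_eventuallyEq <| (lt_mem_nhds ht).mono fun _ hs => if_neg (not_lt.2 (le_of_lt hs))

theorem hasDerivAt_glue_self (hab : a < b) (hf : ∀ t, a < t → t < b → HasDerivAt f (f' t) t)
    (hlim : Tendsto f (𝓝[<] b) (𝓝 (g b))) (hlim' : Tendsto f' (𝓝[<] b) (𝓝 e))
    (hg : HasDerivAt g e b) : HasDerivAt (fun t => if t < b then f t else g t) e b := by
  have hmem : Set.Ioo a b ∈ 𝓝[<] b := Ioo_mem_nhdsLT hab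
  have hglue : ∀ t ∈ Set.Ioo a b, HasDerivAt (fun t => if t < b then f t else g t) (f' t) t :=
    fun t ht => hasDerivAt_glue_of_lt (hf t ht.1 ht.2) ht.2
  have hleft : HasDerivWithinAt (fun t => if t < b then f t else g t) e (Set.Iic b) b := by
    refine hasDerivWithinAt_Iic_of_tendsto_deriv (s := Set.Ioo a b)
      (fun t ht => (hglue t ht).differentiableAt.differentiableWithinAt) ?_ hmem ?_
    · rw [ContinuousWithinAt, if_neg (lt_irrefl b)]
      refine (hlim.mono_left (nhdsWithin_mono b fun t ht => ht.2)).congr' ?_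
      filter_upwards [self_mem_nhdsWithin] with t ht
      exact (if_pos ht.2).symm
    · refine hlim'.congr' ?_
      filter_upwards [hmem] with t ht
      exact (hglue t ht).deriv.symm
  have hright : HasDerivWithinAt (fun t => if t < b then f t else g t) e (Set.Ici b) b :=
    hg.hasDerivWithinAt.congr (fun t ht => if_neg (not_lt.2 ht)) (if_neg (lt_irrefl b))
  have hunion := hleft.union hright
  rwa [Set.Iic_union_Ici, hasDerivWithinAt_univ] at hunion

theorem hasDerivAt_glue (hab : a < b) (hcb : c < b) {T : EReal} (hbT : (b : EReal) < T)
    (hf : ∀ t : ℝ, a < t → (t : EReal) < b → HasDerivAt f (f' t) t)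
    (hlim : Tendsto f (𝓝[<] b) (𝓝 (g b))) (hlim' : Tendsto f' (𝓝[<] b) (𝓝 (g' b)))
    (hg : ∀ t : ℝ, c < t → (t : EReal) < T → HasDerivAt g (g' t) t)
    (ha : a < t) (hT : (t : EReal) < T) :
    HasDerivAt (fun t => if t < b then f t else g t) (if t < b then f' t else g' t) t := by
  rcases lt_trichotomy t b with htb | rfl | htb
  · rw [if_pos htb]
    exact hasDerivAt_glue_of_lt (hf t ha (EReal.coe_lt_coe_iff.2 htb)) htb
  · rw [if_neg (lt_irrefl t)]
    exact hasDerivAt_glue_self hab (fun s hs hst => hf s hs (EReal.coe_lt_coe_iff.2 hst)) hlim hlim'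
      (hg t hcb hbT)
  · rw [if_neg htb.not_gt]
    exact hasDerivAt_glue_of_gt (hg t (hcb.trans htb) hT) htb

end Gluing

/-- The vector field of the autonomous system for `(x, v, p)` that `IsReducedSoliton` encodes. -/
noncomputable def reducedVectorField (lam : ℝ) (w : ℝ × ℝ × ℝ) : ℝ × ℝ × ℝ :=
  (reducedSqSlope lam w.1 w.2.1 w.2.2 / (2 * w.1), w.1 ^ 2 / 2 + w.2.1 / w.1, lam * w.1 ^ 2)

theorem contDiffAt_reducedVectorField (lam : ℝ) {w : ℝ × ℝ × ℝ} (hx : 0 < w.1) (hv : 0 < w.2.1) :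
    ContDiffAt ℝ 1 (reducedVectorField lam) w := by
  unfold reducedVectorField reducedSqSlope reducedTorsion₁
  fun_prop (disch := positivity)

theorem isReducedSoliton_of_hasDerivAt {lam a b : ℝ} {w : ℝ → ℝ × ℝ × ℝ}
    (hpos : ∀ t ∈ Set.Ioo a b, 0 < (w t).1 ∧ 0 < (w t).2.1)
    (hw : ∀ t ∈ Set.Ioo a b, HasDerivAt w (reducedVectorField lam (w t)) t) :
    IsReducedSoliton lam a b (fun t => (w t).1) (fun t => (w t).2.1) (fun t => (w t).2.2) where
  x_pos t ha hb := (hpos t ⟨ha, EReal.coe_lt_coe_iff.1 hb⟩).1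
  v_pos t ha hb := (hpos t ⟨ha, EReal.coe_lt_coe_iff.1 hb⟩).2
  deriv_x t ha hb := by
    simpa [reducedVectorField] using
      (hw t ⟨ha, EReal.coe_lt_coe_iff.1 hb⟩).hasFDerivAt.fst.hasDerivAt
  deriv_v t ha hb := by
    simpa [reducedVectorField] using
      (hw t ⟨ha, EReal.coe_lt_coe_iff.1 hb⟩).hasFDerivAt.snd.fst.hasDerivAt
  deriv_p t ha hb := by
    simpa [reducedVectorField] using
      (hw t ⟨ha, EReal.coe_lt_coe_iff.1 hb⟩).hasFDerivAt.snd.snd.hasDerivAt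

theorem exists_local_reducedSoliton (lam t₀ : ℝ) {x₀ v₀ : ℝ} (p₀ : ℝ) (hx : 0 < x₀)
    (hv : 0 < v₀) :
    ∃ ε > 0, ∃ x v p : ℝ → ℝ, x t₀ = x₀ ∧ v t₀ = v₀ ∧ p t₀ = p₀ ∧
      IsReducedSoliton lam (t₀ - ε) ((t₀ + ε : ℝ) : EReal) x v p := by
  obtain ⟨w, hw₀, ε, hε, hw⟩ :=
    (contDiffAt_reducedVectorField lam (w := (x₀, v₀, p₀)) hx
      hv).exists_forall_mem_closedBall_exists_eq_forall_mem_Ioo_hasDerivAt₀ t₀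
  have hpos : ∀ᶠ t in 𝓝 t₀, 0 < (w t).1 ∧ 0 < (w t).2.1 := by
    have hc : ContinuousAt w t₀ := (hw t₀ ⟨by linarith, by linarith⟩).continuousAt
    refine (hc.fst.eventually (lt_mem_nhds ?_)).and (hc.snd.fst.eventually (lt_mem_nhds ?_)) <;>
      simpa only [hw₀]
  obtain ⟨δ, hδ, hball⟩ := Metric.eventually_nhds_iff_ball.1 hpos
  rw [Real.ball_eq_Ioo] at hball
  have hle_ε := min_le_left ε δ
  have hle_δ := min_le_right ε δ
  refine ⟨min ε δ, lt_min hε hδ, _, _, _, by rw [hw₀], by rw [hw₀], by rw [hw₀],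
    isReducedSoliton_of_hasDerivAt (fun t ht => hball t ?_) fun t ht => hw t ?_⟩
  all_goals exact Set.Ioo_subset_Ioo (by linarith) (by linarith) ht

section Limits

variable {α : Type*} {F : Filter α} {lam x₀ v₀ p₀ : ℝ} {x v p : α → ℝ}

theorem tendsto_reducedSqSlope (lam : ℝ) (hv₀ : v₀ ≠ 0) (hx : Tendsto x F (𝓝 x₀))
    (hv : Tendsto v F (𝓝 v₀)) (hp : Tendsto p F (𝓝 p₀)) :
    Tendsto (fun t => reducedSqSlope lam (x t) (v t) (p t)) F
      (𝓝 (reducedSqSlope lam x₀ v₀ p₀)) :=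
  ((((hp.const_mul 2).div_const 3).sub ((((hv.const_mul (2 * lam)).sub hp).mul (hx.pow 3)).div
    (hv.const_mul 3) (mul_ne_zero three_ne_zero hv₀))).add (hx.const_mul 2)).sub
      ((hx.pow 4).div hv hv₀)

end Limits

theorem IsReducedSoliton.exists_extension {lam a b x₀ v₀ p₀ : ℝ} {x v p : ℝ → ℝ} (hab : a < b)
    (h : IsReducedSoliton lam a b x v p) (hx₀ : 0 < x₀) (hv₀ : 0 < v₀)
    (hx : Tendsto x (𝓝[<] b) (𝓝 x₀)) (hv : Tendsto v (𝓝[<] b) (𝓝 v₀))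
    (hp : Tendsto p (𝓝[<] b) (𝓝 p₀)) :
    ∃ b' : ℝ, b < b' ∧ ∃ x' v' p' : ℝ → ℝ, IsReducedSoliton lam a b' x' v' p' ∧
      ∀ t, t < b → x' t = x t ∧ v' t = v t ∧ p' t = p t := by
  obtain ⟨ε, hε, X, V, Q, rfl, rfl, rfl, hS⟩ := exists_local_reducedSoliton lam b p₀ hx₀ hv₀
  have hbε : b - ε < b := sub_lt_self b hε
  have hbε' : (b : EReal) < ((b + ε : ℝ) : EReal) :=
    EReal.coe_lt_coe_iff.2 (lt_add_of_pos_right b hε)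
  refine ⟨b + ε, lt_add_of_pos_right b hε, fun t => if t < b then x t else X t,
    fun t => if t < b then v t else V t, fun t => if t < b then p t else Q t,
    ⟨fun t ha hT => ?_, fun t ha hT => ?_, fun t ha hT => ?_, fun t ha hT => ?_,
      fun t ha hT => ?_⟩,
    fun t ht => by simp only [ht, if_true, and_self]⟩
  · split_ifs with ht
    · exact h.x_pos t ha (EReal.coe_lt_coe_iff.2 ht)
    · exact hS.x_pos t (hbε.trans_le (not_lt.1 ht)) hT
  · split_ifs with ht
    · exact h.v_pos t ha (EReal.coe_lt_coe_iff.2 ht)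
    · exact hS.v_pos t (hbε.trans_le (not_lt.1 ht)) hT
  · refine (hasDerivAt_glue hab hbε hbε' h.deriv_x hx ?_ hS.deriv_x ha hT).congr_deriv
      (by split_ifs <;> rfl)
    exact (tendsto_reducedSqSlope lam hv₀.ne' hx hv hp).div (hx.const_mul 2) (by positivity)
  · refine (hasDerivAt_glue hab hbε hbε' h.deriv_v hv ?_ hS.deriv_v ha hT).congr_deriv
      (by split_ifs <;> rfl)
    exact ((hx.pow 2).div_const 2).add (hv.div hx hx₀.ne')
  · refine (hasDerivAt_glue hab hbε hbε' h.deriv_p hp ?_ hS.deriv_p ha hT).congr_deriv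
      (by split_ifs <;> rfl)
    exact (hx.pow 2).const_mul lam

theorem IsSp2SolitonEnd.not_tendsto {lam a b x₀ v₀ p₀ : ℝ} {x y τ₁ τ₂ u : ℝ → ℝ}
    (h : IsSp2SolitonEnd lam a b x y τ₁ τ₂ u) (hx₀ : 0 < x₀) (hv₀ : 0 < v₀)
    (hx : Tendsto x (𝓝[<] b) (𝓝 x₀)) (hv : Tendsto (fun t => x t * y t ^ 2) (𝓝[<] b) (𝓝 v₀)) :
    ¬ Tendsto (fun t => τ₁ t - u t * x t ^ 2) (𝓝[<] b) (𝓝 p₀) := by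
  intro hp
  obtain ⟨b', hb', x', v', p', hR, heq⟩ := h.soliton.reduced.exists_extension
    (EReal.coe_lt_coe_iff.1 h.lt) hx₀ hv₀ hx hv hp
  refine h.inextensible b' _ _ _ _ _ (EReal.coe_lt_coe_iff.2 hb') hR.isSp2Soliton
    fun t ha hT => ?_
  obtain ⟨hx', hv', hp'⟩ := heq t (EReal.coe_lt_coe_iff.1 hT)
  simp only [hx', hv', hp']
  refine ⟨trivial, ?_, (h.soliton.torsion₁_eq ha hT).symm, (h.soliton.torsion₂_eq ha hT).symm,
    (h.soliton.field_eq ha hT).symm⟩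
  rw [mul_div_cancel_left₀ _ (h.soliton.x_pos t ha hT).ne',
    Real.sqrt_sq (h.soliton.y_pos t ha hT).le]

/-! ### Change of time -/

theorem image_mem_nhds_of_strictMonoOn {w : ℝ → ℝ} {D : Set ℝ} {t : ℝ} (hconn : D.OrdConnected)
    (hmono : StrictMonoOn w D) (hcont : ContinuousOn w D) (hD : D ∈ 𝓝 t) : w '' D ∈ 𝓝 (w t) := by
  obtain ⟨r₁, r₂, htr, hr⟩ := mem_nhds_iff_exists_Ioo_subset.1 hD
  obtain ⟨q₁, hq₁⟩ := exists_between htr.1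
  obtain ⟨q₂, hq₂⟩ := exists_between htr.2
  have hmem := mem_of_mem_nhds hD
  have hmem₁ := hr ⟨hq₁.1, hq₁.2.trans htr.2⟩
  have hmem₂ := hr ⟨htr.1.trans hq₂.1, hq₂.2⟩
  exact mem_of_superset (Icc_mem_nhds (hmono hmem₁ hmem hq₁.2) (hmono hmem hmem₂ hq₂.1))
    (hconn.isPreconnected.intermediate_value hmem₁ hmem₂ hcont)

theorem exists_inverse_of_hasDerivAt_pos {w w' : ℝ → ℝ} {D : Set ℝ} (hD : IsOpen D)
    (hconn : D.OrdConnected) (hw : ∀ t ∈ D, HasDerivAt w (w' t) t) (hpos : ∀ t ∈ D, 0 < w' t)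
    {t₀ : ℝ} (ht₀ : t₀ ∈ D) (hunb : ¬ BddAbove (w '' D)) :
    ∃ θ : ℝ → ℝ, (∀ s, w t₀ ≤ s → θ s ∈ D ∧ w (θ s) = s ∧ HasDerivAt θ (w' (θ s))⁻¹ s) ∧
      ∀ t ∈ D, θ (w t) = t := by
  have hcont : ContinuousOn w D := fun t ht => (hw t ht).continuousAt.continuousWithinAt
  have hmono : StrictMonoOn w D := strictMonoOn_of_deriv_pos hconn.convex hcont fun t ht => by
    rw [(hw t (interior_subset ht)).deriv]
    exact hpos t (interior_subset ht)
  have hnhds : ∀ t ∈ D, w '' D ∈ 𝓝 (w t) :=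
    fun t ht => image_mem_nhds_of_strictMonoOn hconn hmono hcont (hD.mem_nhds ht)
  have hinv : ∀ t ∈ D, Function.invFunOn w D (w t) = t := hmono.injOn.leftInvOn_invFunOn
  have hmono' : StrictMonoOn (Function.invFunOn w D) (w '' D) := by
    rintro _ ⟨r, hr, rfl⟩ _ ⟨t, ht, rfl⟩ hrt
    rw [hinv r hr, hinv t ht]
    exact (hmono.lt_iff_lt hr ht).1 hrt
  refine ⟨Function.invFunOn w D, fun s hs => ?_, hinv⟩
  obtain ⟨_, ⟨t₁, ht₁, rfl⟩, hst⟩ := not_bddAbove_iff.1 hunb s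
  obtain ⟨t, ht, rfl⟩ := hconn.isPreconnected.intermediate_value ht₀ ht₁ hcont
    ⟨hs, hst.le⟩
  rw [hinv t ht]
  refine ⟨ht, rfl, ?_⟩
  have hcont' : ContinuousAt (Function.invFunOn w D) (w t) := by
    refine hmono'.continuousAt_of_image_mem_nhds (hnhds t ht) ?_
    rw [hmono.injOn.invFunOn_image subset_rfl, hinv t ht]
    exact hD.mem_nhds ht
  refine HasDerivAt.of_local_left_inverse (f := w) hcont' ?_ (hpos t ht).ne' ?_
  · rw [hinv t ht]
    exact hw t ht
  · filter_upwards [hnhds t ht] with _ ⟨r, hr, hrs⟩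
    rw [← hrs, hinv r hr]

namespace IsReducedSoliton

variable {lam a b : ℝ} {T : EReal} {x v p : ℝ → ℝ}

theorem deriv_v_pos (h : IsReducedSoliton lam a T x v p) {t : ℝ} (ha : a < t)
    (hT : (t : EReal) < T) : 0 < x t ^ 2 / 2 + v t / x t := by
  have := h.x_pos t ha hT
  have := h.v_pos t ha hT
  positivity

theorem v_monotoneOn (h : IsReducedSoliton lam a T x v p) : MonotoneOn v (lifespan a T) :=
  monotoneOn_of_hasDerivAt_nonneg (ordConnected_lifespan a T).convex
    (fun t ht => h.deriv_v t ht.1 ht.2) (fun _ ht => (h.deriv_v_pos ht.1 ht.2).le)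

theorem v_tendsto_atTop (h : IsReducedSoliton lam a ⊤ x v p) : Tendsto v atTop atTop := by
  have ha : a < a + 1 := lt_add_one a
  have hv₀ := h.v_pos (a + 1) ha (EReal.coe_lt_top _)
  refine tendsto_atTop_of_le_hasDerivAt (c := min (v (a + 1)) (1 / 2)) (s₀ := a + 1)
    (lt_min hv₀ one_half_pos)
    (fun t ht => h.deriv_v t (ha.trans_le ht) (EReal.coe_lt_top _)) fun t ht => ?_
  have hx := h.x_pos t (ha.trans_le ht) (EReal.coe_lt_top _)
  have hv : v (a + 1) ≤ v t :=
    h.v_monotoneOn ⟨ha, EReal.coe_lt_top _⟩ ⟨ha.trans_le ht, EReal.coe_lt_top _⟩ ht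
  rcases le_total (x t) 1 with hx1 | hx1
  · have : v t ≤ v t / x t := le_div_self (hv₀.le.trans hv) hx hx1
    exact (min_le_left _ _).trans (by linarith [sq_nonneg (x t)])
  · have : 0 ≤ v t / x t := div_nonneg (hv₀.le.trans hv) hx.le
    exact (min_le_right _ _).trans (by linarith [one_le_pow₀ (n := 2) hx1])

theorem not_bddAbove_log_v (h : IsReducedSoliton lam a T x v p)
    (hunb : ¬ BddAbove (v '' lifespan a T)) :
    ¬ BddAbove ((fun t => Real.log (v t)) '' lifespan a T) := by
  refine not_bddAbove_iff.2 fun L => ?_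
  obtain ⟨_, ⟨t, ht, rfl⟩, hlt⟩ := not_bddAbove_iff.1 hunb (Real.exp L)
  exact ⟨_, ⟨t, ht, rfl⟩, (Real.lt_log_iff_exp_lt (h.v_pos t ht.1 ht.2)).2 hlt⟩

theorem isLogSoliton_of_inverse (h : IsReducedSoliton lam a T x v p) (hlam : lam ≠ 0) {s₀ : ℝ}
    {θ : ℝ → ℝ} (hθ : ∀ s, s₀ ≤ s → θ s ∈ lifespan a T ∧ v (θ s) = Real.exp s ∧
      HasDerivAt θ (warp (fun s => x (θ s)) s * x (θ s)) s) :
    IsLogSoliton lam s₀ (fun s => x (θ s)) (fun s => p (θ s) / lam) θ where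
  x_pos s hs := h.x_pos _ (hθ s hs).1.1 (hθ s hs).1.2
  deriv_x s hs := by
    obtain ⟨⟨ha, hT⟩, hv, hderiv⟩ := hθ s hs
    have hx := h.x_pos _ ha hT
    refine (HasDerivAt.comp s (h.deriv_x _ ha hT) hderiv).congr_deriv ?_
    unfold warp reducedSqSlope reducedTorsion₁
    rw [hv]
    field_simp
    ring
  deriv_P s hs := by
    obtain ⟨⟨ha, hT⟩, -, hderiv⟩ := hθ s hs
    refine ((HasDerivAt.comp s (h.deriv_p _ ha hT) hderiv).div_const lam).congr_deriv ?_
    field_simp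
  deriv_t s hs := (hθ s hs).2.2

theorem exists_isLogSoliton (h : IsReducedSoliton lam a T x v p) (hlam : lam ≠ 0)
    (hunb : ¬ BddAbove (v '' lifespan a T)) :
    ∃ (s₀ : ℝ) (θ : ℝ → ℝ),
      IsLogSoliton lam s₀ (fun s => x (θ s)) (fun s => p (θ s) / lam) θ ∧
      (∀ s, s₀ ≤ s → (θ s : EReal) < T) ∧ ∀ t ∈ lifespan a T, θ (Real.log (v t)) = t := by
  obtain ⟨_, ⟨t₀, ht₀, rfl⟩, -⟩ := not_bddAbove_iff.1 hunb 0
  obtain ⟨θ, hθ, hinv⟩ := exists_inverse_of_hasDerivAt_pos (isOpen_lifespan a T)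
    (ordConnected_lifespan a T)
    (fun t ht => (h.deriv_v t ht.1 ht.2).log (h.v_pos t ht.1 ht.2).ne')
    (fun t ht => div_pos (h.deriv_v_pos ht.1 ht.2) (h.v_pos t ht.1 ht.2)) ht₀
    (h.not_bddAbove_log_v hunb)
  refine ⟨Real.log (v t₀), θ, h.isLogSoliton_of_inverse hlam fun s hs => ?_,
    fun s hs => (hθ s hs).1.2, hinv⟩
  obtain ⟨hmem, hlog, hderiv⟩ := hθ s hs
  have hx := h.x_pos _ hmem.1 hmem.2
  have hv : v (θ s) = Real.exp s := by rw [← hlog, Real.exp_log (h.v_pos _ hmem.1 hmem.2), hlog]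
  refine ⟨hmem, hv, hderiv.congr_deriv ?_⟩
  unfold warp
  rw [hv]
  field_simp

theorem bddAbove_v (h : IsReducedSoliton lam a b x v p) (hlam : lam ≠ 0) :
    BddAbove (v '' lifespan a b) := by
  by_contra hunb
  obtain ⟨s₀, θ, hL, hθ, -⟩ := h.exists_isLogSoliton hlam hunb
  obtain ⟨s, hsb, hs⟩ := (((hL.dichotomy hlam).1.eventually_ge_atTop b).and
    (eventually_ge_atTop s₀)).exists
  exact absurd (EReal.coe_lt_coe_iff.1 (hθ s hs)) hsb.not_gt

end IsReducedSoliton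

/-! ### Finite existence time -/

theorem exists_isMaxOn_Ico_deriv_nonpos {f f' : ℝ → ℝ} {l b : ℝ} (hlb : l < b)
    (hf : ∀ t ∈ Set.Ico l b, HasDerivAt f (f' t) t) (hl : 0 < f l)
    (hlim : Tendsto f (𝓝[<] b) (𝓝 0)) :
    ∃ m ∈ Set.Ico l b, IsMaxOn f (Set.Ico l b) m ∧ f' m ≤ 0 := by
  obtain ⟨r, hrb, hr⟩ := mem_nhdsLT_iff_exists_Ico_subset.1
    ((hlim.eventually (gt_mem_nhds hl)).and (Ioo_mem_nhdsLT hlb))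
  have hlr : l ≤ r := (hr ⟨le_rfl, hrb⟩).2.1.le
  have hIcc : ∀ t ∈ Set.Icc l r, t ∈ Set.Ico l b := fun t ht => ⟨ht.1, ht.2.trans_lt hrb⟩
  obtain ⟨m, hm, hmax⟩ := isCompact_Icc.exists_isMaxOn (Set.nonempty_Icc.2 hlr)
    fun t ht => (hf t (hIcc t ht)).continuousAt.continuousWithinAt
  have hmax' : IsMaxOn f (Set.Ico l b) m := by
    intro t ht
    rcases le_total t r with htr | hrt
    · exact hmax ⟨ht.1, htr⟩
    · exact (hr ⟨hrt, ht.2⟩).1.le.trans (hmax (Set.left_mem_Icc.2 hlr))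
  refine ⟨m, hIcc m hm, hmax', ?_⟩
  have hcone : (1 : ℝ) ∈ posTangentConeAt (Set.Ico l b) m := by
    refine one_mem_posTangentConeAt_iff_frequently.2 (Eventually.frequently ?_)
    filter_upwards [Ioo_mem_nhdsGT (hIcc m hm).2] with t ht
    exact ⟨hm.1.trans ht.1.le, ht.2⟩
  simpa using hmax'.localize.hasFDerivWithinAt_nonpos
    (hf m (hIcc m hm)).hasFDerivAt.hasFDerivWithinAt hcone

theorem mul_pow_three_le {k V x : ℝ} (hk : 0 ≤ k) (hV : 0 < V) (hx : 0 ≤ x) :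
    k * x ^ 3 ≤ x ^ 4 / V + k * (k * V) ^ 3 := by
  rcases le_total x (k * V) with hle | hge
  · have := mul_le_mul_of_nonneg_left (pow_le_pow_left₀ hx hle 3) hk
    have : 0 ≤ x ^ 4 / V := by positivity
    linarith
  · have : k * x ^ 3 ≤ x ^ 4 / V := by
      rw [le_div_iff₀ hV]
      nlinarith [mul_le_mul_of_nonneg_right hge (pow_nonneg hx 3)]
    have : 0 ≤ k * (k * V) ^ 3 := by positivity
    linarith

namespace IsReducedSoliton

variable {lam a b v₁ p₁ : ℝ} {x v p : ℝ → ℝ}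

theorem exists_tendsto_v (h : IsReducedSoliton lam a b x v p) (hab : a < b)
    (hbdd : BddAbove (v '' lifespan a b)) : ∃ v₁ > 0, Tendsto v (𝓝[<] b) (𝓝 v₁) := by
  have hmono := h.v_monotoneOn
  rw [lifespan_coe] at hmono hbdd
  have hlim := hmono.tendsto_nhdsWithin_Ioo_left (Set.nonempty_Ioo.2 hab) hbdd
  obtain ⟨c, hc⟩ := exists_between hab
  refine ⟨_, (h.v_pos c hc.1 (EReal.coe_lt_coe_iff.2 hc.2)).trans_le (ge_of_tendsto hlim ?_), hlim⟩
  filter_upwards [Ico_mem_nhdsLT hc.2] with t ht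
  exact hmono hc ⟨hc.1.trans_le ht.1, ht.2⟩ ht.1

theorem exists_tendsto_p (h : IsReducedSoliton lam a b x v p) (hab : a < b)
    (hv : Tendsto v (𝓝[<] b) (𝓝 v₁)) : ∃ p₁, Tendsto p (𝓝[<] b) (𝓝 p₁) := by
  refine exists_tendsto_of_abs_deriv_le (g := fun t => 2 * |lam| * v t) (convex_Ioo a b)
    (Ioo_mem_nhdsLT hab) (fun t ht => h.deriv_p t ht.1 (EReal.coe_lt_coe_iff.2 ht.2))
    (fun t ht => (h.deriv_v t ht.1 (EReal.coe_lt_coe_iff.2 ht.2)).const_mul _)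
    (fun t ht => ?_) (hv.const_mul _)
  have hx := h.x_pos t ht.1 (EReal.coe_lt_coe_iff.2 ht.2)
  have hv := h.v_pos t ht.1 (EReal.coe_lt_coe_iff.2 ht.2)
  have : 0 ≤ |lam| * (v t / x t) := by positivity
  rw [abs_mul, abs_of_nonneg (sq_nonneg (x t))]
  linarith

theorem exists_reducedSqSlope_le (h : IsReducedSoliton lam a b x v p) (hab : a < b) (hv₁ : 0 < v₁)
    (hv : Tendsto v (𝓝[<] b) (𝓝 v₁)) (hp : Tendsto p (𝓝[<] b) (𝓝 p₁)) :
    ∃ C, ∀ᶠ t in 𝓝[<] b, reducedSqSlope lam (x t) (v t) (p t) ≤ C := by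
  have hq : Tendsto (fun t => |2 * lam * v t - p t| / (3 * v t)) (𝓝[<] b)
      (𝓝 (|2 * lam * v₁ - p₁| / (3 * v₁))) :=
    ((hv.const_mul _).sub hp).abs.div (hv.const_mul 3) (by positivity)
  set k := |2 * lam * v₁ - p₁| / (3 * v₁) + 1
  refine ⟨2 * (p₁ + 1) / 3 + 2 + (k + 2) * ((k + 2) * (2 * v₁)) ^ 3, ?_⟩
  filter_upwards [Ioo_mem_nhdsLT hab, hq.eventually_lt_const (lt_add_one _),
    hp.eventually_lt_const (lt_add_one p₁), hv.eventually_lt_const (lt_two_mul_self hv₁)]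
    with t ht hqt hpt hvt
  have hxpos := h.x_pos t ht.1 (EReal.coe_lt_coe_iff.2 ht.2)
  have hvpos := h.v_pos t ht.1 (EReal.coe_lt_coe_iff.2 ht.2)
  have hk0 : 0 ≤ k := by positivity
  have hcubic : -((2 * lam * v t - p t) * x t ^ 3 / (3 * v t)) ≤ k * x t ^ 3 := by
    rw [mul_div_right_comm, ← neg_mul, ← neg_div]
    gcongr
    exact (div_le_div_of_nonneg_right (neg_le_abs _) (by positivity)).trans hqt.le
  have hlin : x t ≤ 1 + x t ^ 3 := by
    rcases le_total (x t) 1 with hx1 | hx1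
    · linarith [pow_pos hxpos 3]
    · linarith [le_self_pow₀ hx1 three_ne_zero]
  have hquartic : x t ^ 4 / (2 * v₁) ≤ x t ^ 4 / v t := by gcongr
  have hdom := mul_pow_three_le (by linarith : 0 ≤ k + 2) (by positivity : 0 < 2 * v₁) hxpos.le
  rw [reducedSqSlope, reducedTorsion₁]
  linarith

theorem exists_tendsto_sq_x (h : IsReducedSoliton lam a b x v p) (hab : a < b) (hv₁ : 0 < v₁)
    (hv : Tendsto v (𝓝[<] b) (𝓝 v₁)) (hp : Tendsto p (𝓝[<] b) (𝓝 p₁)) :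
    ∃ X, Tendsto (fun t => x t ^ 2) (𝓝[<] b) (𝓝 X) := by
  obtain ⟨C, hC⟩ := h.exists_reducedSqSlope_le hab hv₁ hv hp
  obtain ⟨l, hl, hlC⟩ := mem_nhdsLT_iff_exists_Ico_subset.1 (hC.and (Ioo_mem_nhdsLT hab))
  have hmono : MonotoneOn (fun t => C * t - x t ^ 2) (Set.Ioo l b) :=
    (monotoneOn_of_hasDerivAt_nonneg (convex_Ico l b)
      (fun t ht => ((hasDerivAt_id t).const_mul C).fun_sub
        (h.hasDerivAt_sq (hlC ht).2.1 (EReal.coe_lt_coe_iff.2 ht.2)))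
      fun t ht => by linarith [(hlC ht).1]).mono Set.Ioo_subset_Ico_self
  have hbdd : BddAbove ((fun t => C * t - x t ^ 2) '' Set.Ioo l b) := by
    refine ⟨max (C * l) (C * b), ?_⟩
    rintro _ ⟨t, ht, rfl⟩
    have : C * t ≤ max (C * l) (C * b) := by
      rcases le_total 0 C with hC | hC
      · exact le_max_of_le_right (mul_le_mul_of_nonneg_left ht.2.le hC)
      · exact le_max_of_le_left (mul_le_mul_of_nonpos_left ht.1.le hC)
    linarith [sq_nonneg (x t)]
  have hlin : Tendsto (fun t => C * t) (𝓝[<] b) (𝓝 (C * b)) :=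
    (tendsto_id.const_mul C).mono_left nhdsWithin_le_nhds
  refine ⟨_, (hlin.sub (hmono.tendsto_nhdsWithin_Ioo_left (Set.nonempty_Ioo.2 hl) hbdd)).congr
    fun t => ?_⟩
  ring

theorem neg_le_p_of_isMaxOn_sq {m : ℝ} (h : IsReducedSoliton lam a b x v p) (ha : a < m)
    (hb : m < b) (hmax : ∀ t ∈ Set.Ico m b, x t ^ 2 ≤ x m ^ 2)
    (hp : Tendsto p (𝓝[<] b) (𝓝 p₁)) (hp₁ : 0 ≤ p₁) :
    -(|lam| * x m ^ 2 * (b - m)) ≤ p m := by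
  have hclose : ∀ t ∈ Set.Ico m b, p t - p m ≤ |lam| * x m ^ 2 * (b - m) := by
    intro t ht
    have hdist := abs_sub_le_sub_of_abs_deriv_le (g := fun s => |lam| * x m ^ 2 * s)
      (convex_Ico m b)
      (fun s hs => h.deriv_p s (ha.trans_le hs.1) (EReal.coe_lt_coe_iff.2 hs.2))
      (fun s _ => (hasDerivAt_id s).const_mul (|lam| * x m ^ 2))
      (fun s hs => by
        rw [abs_mul, abs_of_nonneg (sq_nonneg (x s)), mul_one]
        exact mul_le_mul_of_nonneg_left (hmax s hs) (abs_nonneg lam))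
      (Set.left_mem_Ico.2 hb) ht ht.1
    rw [← mul_sub] at hdist
    refine (le_abs_self _).trans (hdist.trans ?_)
    gcongr
    exact ht.2.le
  have hlim : p₁ - p m ≤ |lam| * x m ^ 2 * (b - m) := by
    refine le_of_tendsto (hp.sub_const (p m)) ?_
    filter_upwards [Ico_mem_nhdsLT hb] with t ht using hclose t ht
  linarith

theorem reducedSqSlope_pos {K x v p : ℝ} (hx : 0 < x) (hv : 0 < v) (hp : -(K * x ^ 2) ≤ p)
    (h : 0 < 2 - 2 * K * x / 3 - (2 * lam * v - p) * x ^ 2 / (3 * v) - x ^ 3 / v) :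
    0 < reducedSqSlope lam x v p := by
  have hprod := mul_pos hx h
  have : x * (2 - 2 * K * x / 3 - (2 * lam * v - p) * x ^ 2 / (3 * v) - x ^ 3 / v) =
      -(2 * (K * x ^ 2) / 3) - (2 * lam * v - p) * x ^ 3 / (3 * v) + 2 * x - x ^ 4 / v := by
    field_simp
    ring
  rw [reducedSqSlope, reducedTorsion₁]
  linarith

/-- If the limit were nonnegative, then `p ≥ -O(x²)` at late maxima of `x²`, so the term `2 x` would
dominate `(x²)'` there and make it positive. -/
theorem limit_p_neg (h : IsReducedSoliton lam a b x v p) (hab : a < b) (hv₁ : 0 < v₁)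
    (hx : Tendsto x (𝓝[<] b) (𝓝 0)) (hv : Tendsto v (𝓝[<] b) (𝓝 v₁))
    (hp : Tendsto p (𝓝[<] b) (𝓝 p₁)) : p₁ < 0 := by
  by_contra! hp₁
  have hlim : Tendsto (fun t => 2 - 2 * (|lam| * (b - a)) * x t / 3 -
      (2 * lam * v t - p t) * x t ^ 2 / (3 * v t) - x t ^ 3 / v t) (𝓝[<] b) (𝓝 2) := by
    simpa using (((hx.const_mul (2 * (|lam| * (b - a)))).div_const 3).const_sub 2).sub
      ((((hv.const_mul (2 * lam)).sub hp).mul (hx.pow 2)).div (hv.const_mul 3) (by positivity))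
      |>.sub ((hx.pow 3).div hv hv₁.ne')
  obtain ⟨l, hl, hlate⟩ := mem_nhdsLT_iff_exists_Ico_subset.1
    ((hlim.eventually_const_lt two_pos).and (Ioo_mem_nhdsLT hab))
  have hdom : ∀ t ∈ Set.Ico l b, a < t ∧ (t : EReal) < b := fun t ht =>
    ⟨(hlate ht).2.1, EReal.coe_lt_coe_iff.2 ht.2⟩
  have hxl := h.x_pos l (hdom l (Set.left_mem_Ico.2 hl)).1 (hdom l (Set.left_mem_Ico.2 hl)).2
  obtain ⟨m, hm, hmax, hslope⟩ := exists_isMaxOn_Ico_deriv_nonpos hl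
    (fun t ht => h.hasDerivAt_sq (hdom t ht).1 (hdom t ht).2) (pow_pos hxl 2)
    (by simpa using hx.pow 2)
  obtain ⟨ham, hmb⟩ := hdom m hm
  have hpm := h.neg_le_p_of_isMaxOn_sq ham hm.2 (fun t ht => hmax ⟨hm.1.trans ht.1, ht.2⟩) hp hp₁
  refine hslope.not_gt (reducedSqSlope_pos (K := |lam| * (b - a)) (h.x_pos m ham hmb)
    (h.v_pos m ham hmb) (le_trans (neg_le_neg ?_) hpm) (hlate hm).1)
  rw [mul_right_comm]
  gcongr

theorem tendsto_sq_div (h : IsReducedSoliton lam a b x v p) (hab : a < b) (hv₁ : 0 < v₁)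
    (hx : Tendsto x (𝓝[<] b) (𝓝 0)) (hv : Tendsto v (𝓝[<] b) (𝓝 v₁))
    (hp : Tendsto p (𝓝[<] b) (𝓝 p₁)) :
    Tendsto (fun t => x t ^ 2 / (b - t)) (𝓝[<] b) (𝓝 (-(2 * p₁ / 3))) := by
  have hslope : Tendsto (fun t => reducedSqSlope lam (x t) (v t) (p t) / -1) (𝓝[<] b)
      (𝓝 (-(2 * p₁ / 3))) := by
    simpa [reducedSqSlope, reducedTorsion₁, div_neg] using
      (tendsto_reducedSqSlope lam hv₁.ne' hx hv hp).div_const (-1)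
  have hsub : Tendsto (fun t => b - t) (𝓝[<] b) (𝓝 0) := by
    simpa using (tendsto_id.const_sub b).mono_left (nhdsWithin_le_nhds (a := b))
  refine HasDerivAt.lhopital_zero_nhdsLT ?_
    (Eventually.of_forall fun t => (hasDerivAt_id t).const_sub b)
    (Eventually.of_forall fun _ => by norm_num) (by simpa using hx.pow 2) hsub hslope
  filter_upwards [Ioo_mem_nhdsLT hab] with t ht
  exact h.hasDerivAt_sq ht.1 (EReal.coe_lt_coe_iff.2 ht.2)

theorem isBigO_x (h : IsReducedSoliton lam a b x v p) (hab : a < b) (hv₁ : 0 < v₁)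
    (hx : Tendsto x (𝓝[<] b) (𝓝 0)) (hv : Tendsto v (𝓝[<] b) (𝓝 v₁))
    (hp : Tendsto p (𝓝[<] b) (𝓝 p₁)) : x =O[𝓝[<] b] fun t => √(b - t) := by
  refine IsBigO.of_pow two_ne_zero ((isBigO_of_div_tendsto_nhds ?_ _
    (h.tendsto_sq_div hab hv₁ hx hv hp)).congr' .rfl ?_)
  · filter_upwards [self_mem_nhdsWithin] with t ht hzero
    exact absurd hzero (sub_pos.2 ht).ne'
  · filter_upwards [self_mem_nhdsWithin] with t ht
    exact (Real.sq_sqrt (sub_pos.2 ht).le).symm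

theorem isBigO_sq_v_div_x (h : IsReducedSoliton lam a b x v p) (hab : a < b) (hv₁ : 0 < v₁)
    (hx : Tendsto x (𝓝[<] b) (𝓝 0)) (hv : Tendsto v (𝓝[<] b) (𝓝 v₁))
    (hp : Tendsto p (𝓝[<] b) (𝓝 p₁)) :
    (fun t => (v t / x t) ^ 2) =O[𝓝[<] b] fun t => (b - t)⁻¹ := by
  have hp₁ := h.limit_p_neg hab hv₁ hx hv hp
  have hratio : Tendsto (fun t => (v t / x t) ^ 2 / (b - t)⁻¹) (𝓝[<] b)
      (𝓝 (v₁ ^ 2 / -(2 * p₁ / 3))) := by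
    refine ((hv.pow 2).div (h.tendsto_sq_div hab hv₁ hx hv hp) (by linarith)).congr fun t => ?_
    rw [div_pow, div_inv_eq_mul, Pi.div_apply, div_div_eq_mul_div, div_mul_eq_mul_div]
  refine isBigO_of_div_tendsto_nhds ?_ _ hratio
  filter_upwards [self_mem_nhdsWithin] with t ht hzero
  exact absurd hzero (inv_pos.2 (sub_pos.2 ht)).ne'

end IsReducedSoliton

theorem IsSp2SolitonEnd.exists_limits {lam a b : ℝ} {x y τ₁ τ₂ u : ℝ → ℝ}
    (h : IsSp2SolitonEnd lam a b x y τ₁ τ₂ u) (hlam : lam ≠ 0) :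
    ∃ v₁ > 0, ∃ p₁, Tendsto x (𝓝[<] b) (𝓝 0) ∧
      Tendsto (fun t => x t * y t ^ 2) (𝓝[<] b) (𝓝 v₁) ∧
      Tendsto (fun t => τ₁ t - u t * x t ^ 2) (𝓝[<] b) (𝓝 p₁) := by
  have hab : a < b := EReal.coe_lt_coe_iff.1 h.lt
  have hR := h.soliton.reduced
  obtain ⟨v₁, hv₁, hv⟩ := hR.exists_tendsto_v hab (hR.bddAbove_v hlam)
  obtain ⟨p₁, hp⟩ := hR.exists_tendsto_p hab hv
  obtain ⟨X, hX⟩ := hR.exists_tendsto_sq_x hab hv₁ hv hp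
  have hx : Tendsto x (𝓝[<] b) (𝓝 √X) := by
    refine hX.sqrt.congr' ?_
    filter_upwards [Ioo_mem_nhdsLT hab] with t ht
    exact Real.sqrt_sq (hR.x_pos t ht.1 (EReal.coe_lt_coe_iff.2 ht.2)).le
  rcases (Real.sqrt_nonneg X).eq_or_lt with hzero | hpos
  · exact ⟨v₁, hv₁, p₁, hzero ▸ hx, hv, hp⟩
  · exact absurd hp (h.not_tendsto hpos hv₁ hx hv)

theorem tendsto_div_atTop_of_tendsto_mul_sq {α : Type*} {F : Filter α} {x y : α → ℝ} {v₁ : ℝ}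
    (hv₁ : 0 < v₁) (hpos : ∀ᶠ t in F, 0 < x t ∧ 0 < y t) (hx : Tendsto x F (𝓝 0))
    (hv : Tendsto (fun t => x t * y t ^ 2) F (𝓝 v₁)) :
    Tendsto (fun t => y t / x t) F atTop := by
  have hcube : Tendsto (fun t => x t ^ 3) F (𝓝[>] 0) :=
    tendsto_nhdsWithin_iff.2 ⟨by simpa using hx.pow 3, hpos.mono fun t ht => pow_pos ht.1 3⟩
  refine (Real.tendsto_sqrt_atTop.comp
    (hv.pos_mul_atTop hv₁ hcube.inv_tendsto_nhdsGT_zero)).congr' ?_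
  filter_upwards [hpos] with t ht
  obtain ⟨hxt, hyt⟩ := ht
  have hsq : x t * y t ^ 2 * (x t ^ 3)⁻¹ = (y t / x t) ^ 2 := by field_simp
  rw [Function.comp_apply, Pi.inv_apply, hsq, Real.sqrt_sq (by positivity)]

theorem IsSp2SolitonEnd.finite_time_rates {lam a b : ℝ} {x y τ₁ τ₂ u : ℝ → ℝ}
    (h : IsSp2SolitonEnd lam a b x y τ₁ τ₂ u) (hlam : lam ≠ 0) :
    Tendsto (fun t => y t / x t) (𝓝[<] b) atTop ∧
      x =O[𝓝[<] b] (fun t => √(b - t)) ∧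
      y =O[𝓝[<] b] (fun t => (b - t) ^ (-(1 / 4) : ℝ)) := by
  have hab : a < b := EReal.coe_lt_coe_iff.1 h.lt
  have hR := h.soliton.reduced
  obtain ⟨v₁, hv₁, p₁, hx, hv, hp⟩ := h.exists_limits hlam
  have hpos : ∀ᶠ t in 𝓝[<] b, 0 < x t ∧ 0 < y t := by
    filter_upwards [Ioo_mem_nhdsLT hab] with t ht
    have hT : (t : EReal) < b := EReal.coe_lt_coe_iff.2 ht.2
    exact ⟨h.soliton.x_pos t ht.1 hT, h.soliton.y_pos t ht.1 hT⟩
  refine ⟨tendsto_div_atTop_of_tendsto_mul_sq hv₁ hpos hx hv, hR.isBigO_x hab hv₁ hx hv hp,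
    IsBigO.of_pow four_ne_zero ((hR.isBigO_sq_v_div_x hab hv₁ hx hv hp).congr' ?_ ?_)⟩
  · filter_upwards [hpos] with t ht
    rw [mul_div_cancel_left₀ _ ht.1.ne', Pi.pow_apply, ← pow_mul]
  · filter_upwards [self_mem_nhdsWithin] with t ht
    rw [Pi.pow_apply, ← Real.rpow_natCast, ← Real.rpow_mul (sub_pos.2 ht).le, ← Real.rpow_neg_one]
    norm_num

/-! ### Forward complete ends -/

namespace IsReducedSoliton

variable {lam a ε s₁ : ℝ} {x v p θ : ℝ → ℝ}

theorem tendsto_log_v (h : IsReducedSoliton lam a ⊤ x v p) :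
    Tendsto (fun t => Real.log (v t)) atTop atTop :=
  Real.tendsto_log_atTop.comp h.v_tendsto_atTop

theorem not_bddAbove_v (h : IsReducedSoliton lam a ⊤ x v p) :
    ¬ BddAbove (v '' lifespan a ⊤) := by
  refine not_bddAbove_iff.2 fun V => ?_
  obtain ⟨t, hV, hat⟩ := ((h.v_tendsto_atTop.eventually_gt_atTop V).and
    (eventually_gt_atTop a)).exists
  exact ⟨v t, ⟨t, ⟨hat, EReal.coe_lt_top t⟩, rfl⟩, hV⟩

theorem conical_of_warp_bounds (h : IsReducedSoliton lam a ⊤ x v p) (hlam : lam ≠ 0)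
    (hL : IsLogSoliton lam s₁ (fun s => x (θ s)) (fun s => p (θ s) / lam) θ)
    (hθ : ∀ᶠ t in atTop, θ (Real.log (v t)) = t ∧ Real.exp (Real.log (v t)) = v t) (hε : 0 < ε)
    (hw : ∀ s, s₁ ≤ s →
      ε ≤ warp (fun s => x (θ s)) s ∧ warp (fun s => x (θ s)) s ≤ 1 - ε) :
    (∀ᶠ t in atTop, ε / 2 ≤ v t / x t ^ 3 ∧ v t / x t ^ 3 ≤ 1 / (2 * ε)) ∧
      ∃ c₁ c₂ k : ℝ, IsClosedSp2Cone c₁ c₂ ∧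
        (fun t => x t - c₁ * (t + k)) =O[atTop] (fun t => t⁻¹) ∧
        (fun t => √(v t / x t) - c₂ * (t + k)) =O[atTop] (fun t => t⁻¹) := by
  obtain ⟨-, c₁, c₂, k, hcone, hxO, hyO⟩ := hL.conical hlam hε hw
  constructor
  · filter_upwards [hθ, h.tendsto_log_v.eventually_ge_atTop s₁] with t ht hs
    have hbounds := IsLogSoliton.ratio_bounds (x := fun s => x (θ s)) (hL.x_pos _ hs) hε (hw _ hs)
    simpa only [ht.1, ht.2] using hbounds
  · refine ⟨c₁, c₂, k, hcone, (hxO.comp_tendsto h.tendsto_log_v).congr' ?_ ?_,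
      (hyO.comp_tendsto h.tendsto_log_v).congr' ?_ ?_⟩
    all_goals
      filter_upwards [hθ] with t ht
      simp only [Function.comp_apply, ht.1, ht.2]

theorem asymptotics (h : IsReducedSoliton lam a ⊤ x v p) (hlam : lam ≠ 0) :
    ((∃ ε > 0, ∀ᶠ t in atTop, ε / 2 ≤ v t / x t ^ 3 ∧ v t / x t ^ 3 ≤ 1 / (2 * ε)) ∧
      ∃ c₁ c₂ k : ℝ, IsClosedSp2Cone c₁ c₂ ∧
        (fun t => x t - c₁ * (t + k)) =O[atTop] (fun t => t⁻¹) ∧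
        (fun t => √(v t / x t) - c₂ * (t + k)) =O[atTop] (fun t => t⁻¹)) ∨
    (0 < lam ∧ Tendsto (fun t => v t / x t ^ 3) atTop atTop ∧
      Tendsto (fun t => t * x t) atTop (𝓝 (3 / lam)) ∧
      Tendsto (fun t => Real.log (v t) / t ^ 2) atTop (𝓝 (lam / 6)) ∧
      Tendsto x atTop (𝓝 0)) ∨
    (lam < 0 ∧ Tendsto (fun t => v t / x t ^ 3) atTop (𝓝 0) ∧
      Tendsto (fun t => Real.log (x t) / t) atTop (𝓝 √(-lam / 18)) ∧
      Tendsto (fun t => v t ^ 2 / x t ^ 4) atTop (𝓝 (-9 / (8 * lam))) ∧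
      Tendsto (fun t => Real.log (v t) / t) atTop (𝓝 (2 * √(-lam / 18)))) := by
  obtain ⟨s₀, θ, hL, -, hinv⟩ := h.exists_isLogSoliton hlam h.not_bddAbove_v
  have hθ : ∀ᶠ t in atTop, θ (Real.log (v t)) = t ∧ Real.exp (Real.log (v t)) = v t := by
    filter_upwards [eventually_gt_atTop a] with t ht
    exact ⟨hinv t ⟨ht, EReal.coe_lt_top t⟩, Real.exp_log (h.v_pos t ht (EReal.coe_lt_top t))⟩
  have hlog := h.tendsto_log_v
  obtain ⟨-, ⟨s₁, ε, hs₁, hε, hw⟩ | ⟨hpos, h₁, h₂, h₃, h₄⟩ | ⟨hneg, h₁, h₂, h₃, h₄⟩⟩ :=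
    hL.dichotomy hlam
  · obtain ⟨hratio, hcone⟩ := h.conical_of_warp_bounds hlam (hL.mono hs₁) hθ hε hw
    exact .inl ⟨⟨ε, hε, hratio⟩, hcone⟩
  · refine .inr (.inl ⟨hpos, (h₁.comp hlog).congr' ?_, (h₂.comp hlog).congr' ?_,
      (h₃.comp hlog).congr' ?_, (h₄.comp hlog).congr' ?_⟩)
    all_goals
      filter_upwards [hθ] with t ht
      simp only [Function.comp_apply, ht.1, ht.2]
  · refine .inr (.inr ⟨hneg, (h₁.comp hlog).congr' ?_, (h₂.comp hlog).congr' ?_,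
      (h₃.comp hlog).congr' ?_, (h₄.comp hlog).congr' ?_⟩)
    all_goals
      filter_upwards [hθ] with t ht
      simp only [Function.comp_apply, quarticRatio, ht.1, ht.2]

end IsReducedSoliton

/-! ### Classification of soliton ends -/

theorem tendsto_mul_inv_of_isBigO_inv {f : ℝ → ℝ} {c k : ℝ}
    (h : (fun t => f t - c * (t + k)) =O[atTop] (fun t => t⁻¹)) :
    Tendsto (fun t => f t * t⁻¹) atTop (𝓝 c) := by
  have hlim := (((h.trans_tendsto tendsto_inv_atTop_zero).add_const (c * k)).mul
    tendsto_inv_atTop_zero).const_add c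
  rw [mul_zero, add_zero] at hlim
  refine hlim.congr' ?_
  filter_upwards [eventually_gt_atTop 0] with t ht
  field_simp
  ring

theorem IsAsymptoticRateNegTwo.unique {x y : ℝ → ℝ} {c₁ c₂ d₁ d₂ : ℝ}
    (hc : IsAsymptoticRateNegTwo x y c₁ c₂) (hd : IsAsymptoticRateNegTwo x y d₁ d₂) :
    (c₁, c₂) = (d₁, d₂) := by
  obtain ⟨k, hx, hy⟩ := hc
  obtain ⟨l, hx', hy'⟩ := hd
  exact Prod.ext
    (tendsto_nhds_unique (tendsto_mul_inv_of_isBigO_inv hx) (tendsto_mul_inv_of_isBigO_inv hx'))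
    (tendsto_nhds_unique (tendsto_mul_inv_of_isBigO_inv hy) (tendsto_mul_inv_of_isBigO_inv hy'))

theorem tendsto_log_div_sq_of_tendsto_mul {f : ℝ → ℝ} {c : ℝ} (hc : 0 < c)
    (h : Tendsto (fun t => t * f t) atTop (𝓝 c)) :
    Tendsto (fun t => Real.log (f t) / t ^ 2) atTop (𝓝 0) := by
  have hmul : Tendsto (fun t => Real.log (t * f t) / t ^ 2) atTop (𝓝 0) :=
    (h.log hc.ne').div_atTop (tendsto_pow_atTop two_ne_zero)
  have hlog : Tendsto (fun t : ℝ => Real.log t / t * t⁻¹) atTop (𝓝 0) := by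
    have hdiv := Real.tendsto_pow_log_div_mul_add_atTop 1 0 1 one_ne_zero
    simp only [pow_one, one_mul, add_zero] at hdiv
    simpa using hdiv.mul tendsto_inv_atTop_zero
  have hsub := hmul.sub hlog
  rw [sub_zero] at hsub
  refine hsub.congr' ?_
  filter_upwards [eventually_gt_atTop 0, h.eventually (lt_mem_nhds hc)] with t ht htf
  rw [Real.log_mul ht.ne' (pos_of_mul_pos_right htf ht.le).ne']
  field_simp
  ring

section Logarithms

variable {x y : ℝ}

theorem log_div_eq_half_log (hx : 0 < x) (hy : 0 < y) :
    Real.log (y / x) = Real.log (x * y ^ 2 / x ^ 3) / 2 := by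
  have hsq : x * y ^ 2 / x ^ 3 = (y / x) ^ 2 := by field_simp
  rw [hsq, Real.log_pow]
  push_cast
  ring

theorem log_eq_half_log_sub_log (hx : 0 < x) (hy : 0 < y) :
    Real.log y = (Real.log (x * y ^ 2) - Real.log x) / 2 := by
  rw [Real.log_mul hx.ne' (pow_pos hy 2).ne', Real.log_pow]
  push_cast
  ring

end Logarithms

section Warping

variable {x y : ℝ → ℝ}

theorem isBoundedWarpingEnd_of_ratio_bounds {c C : ℝ} (hc : 0 < c)
    (hpos : ∀ᶠ t in atTop, 0 < x t ∧ 0 < y t)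
    (hratio : ∀ᶠ t in atTop, c ≤ x t * y t ^ 2 / x t ^ 3 ∧ x t * y t ^ 2 / x t ^ 3 ≤ C) :
    IsBoundedWarpingEnd ⊤ x y := by
  refine ⟨rfl, max |Real.log c / 2| |Real.log C / 2|, ?_⟩
  filter_upwards [hpos, hratio] with t ht hbounds
  rw [log_div_eq_half_log ht.1 ht.2]
  refine abs_le_max_abs_abs ?_ ?_
  · exact div_le_div_of_nonneg_right (Real.log_le_log hc hbounds.1) zero_le_two
  · exact div_le_div_of_nonneg_right (Real.log_le_log (hc.trans_le hbounds.1) hbounds.2)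
      zero_le_two

theorem isUnboundedWarpingEnd_of_ratio_tendsto_atTop
    (hpos : ∀ᶠ t in atTop, 0 < x t ∧ 0 < y t)
    (hratio : Tendsto (fun t => x t * y t ^ 2 / x t ^ 3) atTop atTop) :
    IsUnboundedWarpingEnd ⊤ x y := by
  refine ⟨rfl, tendsto_abs_atTop_atTop.comp
    (((Real.tendsto_log_atTop.comp hratio).atTop_div_const two_pos).congr' ?_)⟩
  filter_upwards [hpos] with t ht
  exact (log_div_eq_half_log ht.1 ht.2).symm

theorem isUnboundedWarpingEnd_of_ratio_tendsto_zero
    (hpos : ∀ᶠ t in atTop, 0 < x t ∧ 0 < y t)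
    (hratio : Tendsto (fun t => x t * y t ^ 2 / x t ^ 3) atTop (𝓝 0)) :
    IsUnboundedWarpingEnd ⊤ x y := by
  have hratio' : Tendsto (fun t => x t * y t ^ 2 / x t ^ 3) atTop (𝓝[>] 0) := by
    refine tendsto_nhdsWithin_iff.2 ⟨hratio, ?_⟩
    filter_upwards [hpos] with t ht
    exact div_pos (mul_pos ht.1 (pow_pos ht.2 2)) (pow_pos ht.1 3)
  refine ⟨rfl, tendsto_abs_atBot_atTop.comp
    (((Real.tendsto_log_nhdsGT_zero.comp hratio').atBot_div_const two_pos).congr' ?_)⟩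
  filter_upwards [hpos] with t ht
  exact (log_div_eq_half_log ht.1 ht.2).symm

theorem tendsto_log_y_div {g : ℝ → ℝ} {c d : ℝ} (hpos : ∀ᶠ t in atTop, 0 < x t ∧ 0 < y t)
    (hv : Tendsto (fun t => Real.log (x t * y t ^ 2) / g t) atTop (𝓝 c))
    (hx : Tendsto (fun t => Real.log (x t) / g t) atTop (𝓝 d)) :
    Tendsto (fun t => Real.log (y t) / g t) atTop (𝓝 ((c - d) / 2)) := by
  refine ((hv.sub hx).div_const 2).congr' ?_
  filter_upwards [hpos] with t ht
  rw [log_eq_half_log_sub_log ht.1 ht.2]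
  ring

theorem not_isBoundedWarpingEnd_and_isUnboundedWarpingEnd {T : EReal} :
    ¬ (IsBoundedWarpingEnd T x y ∧ IsUnboundedWarpingEnd T x y) := by
  rintro ⟨⟨-, C, hC⟩, -, hunb⟩
  obtain ⟨t, hle, hlt⟩ := (hC.and (hunb.eventually_gt_atTop C)).exists
  exact hle.not_gt hlt

theorem IsForwardIncompleteEnd.ne_top {T : EReal} (h : IsForwardIncompleteEnd T) : T ≠ ⊤ := by
  obtain ⟨b, rfl⟩ := h
  exact EReal.coe_ne_top b

end Warping

namespace IsSp2SolitonEnd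

variable {lam a : ℝ} {T : EReal} {x y τ₁ τ₂ u : ℝ → ℝ}

theorem eventually_pos (h : IsSp2SolitonEnd lam a ⊤ x y τ₁ τ₂ u) :
    ∀ᶠ t in atTop, 0 < x t ∧ 0 < y t := by
  filter_upwards [eventually_gt_atTop a] with t ht
  exact ⟨h.soliton.x_pos t ht (EReal.coe_lt_top t), h.soliton.y_pos t ht (EReal.coe_lt_top t)⟩

theorem forwardComplete_cases (h : IsSp2SolitonEnd lam a ⊤ x y τ₁ τ₂ u) (hlam : lam ≠ 0) :
    (IsBoundedWarpingEnd ⊤ x y ∧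
      ∃ c₁ c₂, IsClosedSp2Cone c₁ c₂ ∧ IsAsymptoticRateNegTwo x y c₁ c₂) ∨
    (IsUnboundedWarpingEnd ⊤ x y ∧ 0 < lam ∧
      Tendsto (fun t => t * x t) atTop (𝓝 (3 / lam)) ∧
      Tendsto (fun t => Real.log (x t * y t ^ 2) / t ^ 2) atTop (𝓝 (lam / 6)) ∧
      Tendsto x atTop (𝓝 0) ∧
      Tendsto (fun t => Real.log (y t) / t ^ 2) atTop (𝓝 (lam / 12))) ∨
    (IsUnboundedWarpingEnd ⊤ x y ∧ lam < 0 ∧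
      Tendsto (fun t => Real.log (x t) / t) atTop (𝓝 √(-lam / 18)) ∧
      Tendsto (fun t => y t ^ 4 / x t ^ 2) atTop (𝓝 (-9 / (8 * lam))) ∧
      Tendsto (fun t => Real.log (y t) / t) atTop (𝓝 (√(-lam / 18) / 2))) := by
  have hpos := h.eventually_pos
  obtain ⟨⟨ε, hε, hratio⟩, c₁, c₂, k, hcone, hxO, hyO⟩ | ⟨hlam, hratio, htx, hv, hx⟩ |
    ⟨hlam, hratio, hx, hv4, hv⟩ := h.soliton.reduced.asymptotics hlam
  · refine .inl ⟨isBoundedWarpingEnd_of_ratio_bounds (half_pos hε) hpos hratio,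
      c₁, c₂, hcone, k, hxO, hyO.congr' ?_ .rfl⟩
    filter_upwards [hpos] with t ht
    rw [mul_div_cancel_left₀ _ ht.1.ne', Real.sqrt_sq ht.2.le]
  · refine .inr (.inl ⟨isUnboundedWarpingEnd_of_ratio_tendsto_atTop hpos hratio, hlam, htx, hv, hx,
      ?_⟩)
    convert tendsto_log_y_div hpos hv
      (tendsto_log_div_sq_of_tendsto_mul (div_pos three_pos hlam) htx) using 2
    ring
  · refine .inr (.inr ⟨isUnboundedWarpingEnd_of_ratio_tendsto_zero hpos hratio, hlam, hx,
      hv4.congr' ?_, ?_⟩)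
    · filter_upwards [hpos] with t ht
      obtain ⟨hxt, hyt⟩ := ht
      field_simp
    · convert tendsto_log_y_div hpos hv hx using 2
      ring

theorem trichotomy (h : IsSp2SolitonEnd lam a T x y τ₁ τ₂ u) (hlam : lam ≠ 0) :
    IsBoundedWarpingEnd T x y ∨ IsUnboundedWarpingEnd T x y ∨ IsForwardIncompleteEnd T := by
  induction T with
  | bot => exact absurd h.lt not_lt_bot
  | coe b => exact .inr (.inr ⟨b, rfl⟩)
  | top =>
    obtain ⟨hB, -⟩ | ⟨hU, -⟩ | ⟨hU, -⟩ := h.forwardComplete_cases hlam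
    exacts [.inl hB, .inr (.inl hU), .inr (.inl hU)]

theorem existsUnique_cone (h : IsSp2SolitonEnd lam a T x y τ₁ τ₂ u) (hlam : lam ≠ 0)
    (hB : IsBoundedWarpingEnd T x y) :
    ∃! c : ℝ × ℝ, IsClosedSp2Cone c.1 c.2 ∧ IsAsymptoticRateNegTwo x y c.1 c.2 := by
  obtain rfl := hB.1
  obtain ⟨-, c₁, c₂, hcone, hasymp⟩ | ⟨hU, -⟩ | ⟨hU, -⟩ := h.forwardComplete_cases hlam
  · exact ⟨(c₁, c₂), ⟨hcone, hasymp⟩, fun d hd => hd.2.unique hasymp⟩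
  all_goals exact absurd ⟨hB, hU⟩ not_isBoundedWarpingEnd_and_isUnboundedWarpingEnd

theorem expander_asymptotics (h : IsSp2SolitonEnd lam a T x y τ₁ τ₂ u)
    (hU : IsUnboundedWarpingEnd T x y) (hlam : 0 < lam) :
    Tendsto (fun t => t * x t) atTop (𝓝 (3 / lam)) ∧
      Tendsto (fun t => Real.log (x t * y t ^ 2) / t ^ 2) atTop (𝓝 (lam / 6)) ∧
      Tendsto x atTop (𝓝 0) ∧
      Tendsto (fun t => Real.log (y t) / t ^ 2) atTop (𝓝 (lam / 12)) := by
  obtain rfl := hU.1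
  obtain ⟨hB, -⟩ | ⟨-, -, hlim⟩ | ⟨-, hneg, -⟩ := h.forwardComplete_cases hlam.ne'
  · exact absurd ⟨hB, hU⟩ not_isBoundedWarpingEnd_and_isUnboundedWarpingEnd
  · exact hlim
  · exact absurd hneg hlam.not_gt

theorem shrinker_asymptotics (h : IsSp2SolitonEnd lam a T x y τ₁ τ₂ u)
    (hU : IsUnboundedWarpingEnd T x y) (hlam : lam < 0) :
    Tendsto (fun t => Real.log (x t) / t) atTop (𝓝 √(-lam / 18)) ∧
      Tendsto (fun t => y t ^ 4 / x t ^ 2) atTop (𝓝 (-9 / (8 * lam))) ∧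
      Tendsto (fun t => Real.log (y t) / t) atTop (𝓝 (√(-lam / 18) / 2)) := by
  obtain rfl := hU.1
  obtain ⟨hB, -⟩ | ⟨-, hpos, -⟩ | ⟨-, -, hlim⟩ := h.forwardComplete_cases hlam.ne
  · exact absurd ⟨hB, hU⟩ not_isBoundedWarpingEnd_and_isUnboundedWarpingEnd
  · exact absurd hpos hlam.not_gt
  · exact hlim

end IsSp2SolitonEnd

theorem theoremD (lam : ℝ) (hlam : lam ≠ 0) (a : ℝ) (T : EReal) (x y τ₁ τ₂ u : ℝ → ℝ)
    (hend : IsSp2SolitonEnd lam a T x y τ₁ τ₂ u) :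
    -- exactly one of the three cases occurs
    ((IsBoundedWarpingEnd T x y ∨ IsUnboundedWarpingEnd T x y ∨ IsForwardIncompleteEnd T) ∧
      ¬ (IsBoundedWarpingEnd T x y ∧ IsUnboundedWarpingEnd T x y) ∧
      ¬ (IsBoundedWarpingEnd T x y ∧ IsForwardIncompleteEnd T) ∧
      ¬ (IsUnboundedWarpingEnd T x y ∧ IsForwardIncompleteEnd T)) ∧
    -- (i)
    (IsBoundedWarpingEnd T x y →
      ∃! c : ℝ × ℝ, IsClosedSp2Cone c.1 c.2 ∧ IsAsymptoticRateNegTwo x y c.1 c.2) ∧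
    -- (ii.a)
    (IsUnboundedWarpingEnd T x y → 0 < lam →
      Tendsto (fun t => t * x t) atTop (𝓝 (3 / lam)) ∧
      Tendsto (fun t => Real.log (x t * y t ^ 2) / t ^ 2) atTop (𝓝 (lam / 6)) ∧
      Tendsto x atTop (𝓝 0) ∧
      Tendsto (fun t => Real.log (y t) / t ^ 2) atTop (𝓝 (lam / 12))) ∧
    -- (ii.b)
    (IsUnboundedWarpingEnd T x y → lam < 0 →
      Tendsto (fun t => Real.log (x t) / t) atTop (𝓝 (Real.sqrt (-lam / 18))) ∧
      Tendsto (fun t => y t ^ 4 / x t ^ 2) atTop (𝓝 (-9 / (8 * lam))) ∧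
      Tendsto (fun t => Real.log (y t) / t) atTop (𝓝 (Real.sqrt (-lam / 18) / 2))) ∧
    -- (iii)
    (∀ tstar : ℝ, T = (tstar : EReal) →
      Tendsto (fun t => y t / x t) (𝓝[<] tstar) atTop ∧
      x =O[𝓝[<] tstar] (fun t => Real.sqrt (tstar - t)) ∧
      y =O[𝓝[<] tstar] (fun t => (tstar - t) ^ (-(1 / 4) : ℝ))) := by
  exact ⟨⟨hend.trichotomy hlam, not_isBoundedWarpingEnd_and_isUnboundedWarpingEnd,
      fun ⟨hB, hF⟩ => hF.ne_top hB.1, fun ⟨hU, hF⟩ => hF.ne_top hU.1⟩,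
    hend.existsUnique_cone hlam, hend.expander_asymptotics, hend.shrinker_asymptotics,
    fun b hb => by subst hb; exact hend.finite_time_rates hlam⟩
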